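/- Let $G=(V,E,\omega)$ be an undirected graph with $n\ge 1$ vertices, $m$ edges and positive edge weights (all equal to $1$ in the unweighted case), let $h\ge 1$ be an integer and $t=(4/3)^h$. Let $d_G$ be the weighted distance in $G$. The \emph{path-reporting distance oracle} $\Lambda_h$ is the following randomized data structure. \textbf{Parameters and sampling.} Let $\rho_i=n^{\alpha_i}$ with $\alpha_i=1-(3/4)^{h-i+1}$ for $1\le i\le h$. There are two variants. In the first one $\lambda=\lambda(G)=\max_{U\subseteq V,|U|\ge 2}|E(U)|/(|U|-1)$ is the arboricity of $G$, and every vertex belongs to $L_i$ independently with probability $\rho_i/n$, independently for all $i$. In the second one $\lambda=m/n$, every vertex $v$ has $\lceil \deg(v)/\lambda\rceil$ copies, every copy is selected at level $i$ independently with probability $\rho_i/n$, and $v\in L_i$ if and only if at least one of its copies is selected at level $i$. The elements of $L_i$ are the $i$-landmarks. Let $\ell_i(v)$ be an $i$-landmark closest to $v$, $r_i(v)=d_G(v,\ell_i(v))$ ($\infty$ if there is none), and $\mathrm{Ball}_i(v)=\{x: d_G(v,x)<r_i(v)\}$; ties between landmarks and between shortest paths are broken consistently. \textbf{Stored data.}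 The graph $G$; for each $i\in[1,h]$ a forest of shortest path trees that connects every vertex $v$ to $\ell_i(v)$, with the distances $r_i(v)$; and for each $i\in[1,h]$ a distance-preserving path-reporting oracle for a set $\mathcal P_i$ of pairs. Here $\mathcal P_h$ is the set of all pairs of distinct $h$-landmarks, and for $i<h$, $\mathcal P_i$ consists of the pairs $u\neq v$ of $i$-landmarks with $d_G(u,v)<\frac13 r_{i+1}(u)$ or $d_G(u,v)<\frac13 r_{i+1}(v)$. (Pairs in different components are omitted.) The distance-preserving oracle fixes a shortest path for each pair and keeps: for each vertex that is an inner vertex of such a path, one such path (its home path) and the two neighbours on it; for each pair the first and the last edge of its path; and a hash table of the branching events, i.e. of the triples $(\Pi,\Pi',x)$ of distinct chosen paths $\Pi,\Pi'$ through $x$ with $\{\mathrm{pred}_\Pi(x),\mathrm{succ}_\Pi(x)\}\ne\{\mathrm{pred}_{\Pi'}(x),\mathrm{succ}_{\Pi'}(x)\}$, with the edges of both paths at $x$. \textbf{Query $(u,v)$.} Test by truncated Dijkstra searches whether $v\in \mathrm{Ball}_1(u)$ or $u\in\mathrm{Ball}_1(v)$; if so, return the shortest path found. Otherwise let $u^{(0)}=u$,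 $v^{(0)}=v$, $u^{(j)}=\ell_j(u^{(j-1)})$, $v^{(j)}=\ell_j(v^{(j-1)})$, take the least $j\ge 1$ such that $u^{(j)}=v^{(j)}$ or $(u^{(j)},v^{(j)})\in\mathcal P_j$, and return the concatenation $\Pi$ of the stored paths from $u$ via $u^{(1)},\dots,u^{(j)},v^{(j)},\dots,v^{(1)}$ to $v$. Space is counted in machine words (a word holds a vertex or a weight), and time in elementary steps, where an access to an array or a hash table costs $O(1)$. Let $|\Pi|$ be the number of edges of the returned path $\Pi$. \textbf{Statement.} For any constant $t=(4/3)^h$ the following hold, in both variants. (1) The expected space of $\Lambda_h$, in addition to the space needed to store $G$, is $O(n)$. (2) For every outcome of the sampling and all vertices $u,v$ in the same component of $G$, the oracle returns a path in $G$ between $u$ and $v$ of length at least $d_G(u,v)$ and at most $t^{\log_{4/3}7}\cdot d_G(u,v)$. (3) With high probability the query time is $\tilde O(n^{1/t}\lambda)$ plus $O(|\Pi|)$: there is an absolute constant $\kappa$, and for every $c$ a constant $B$ (depending on $c$ and $t$ only), such that with probability at least $1-n^{-c}$ all queries $(u,v)$ with $u,v$ in the same component take at most $B\,(n^{1/t}\lambda\log^{\kappa}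 n+1+|\Pi|)$ steps. For non-constant $t$ the expected extra space is $O(n\log t)$, with an absolute constant, the stretch is again at most $t^{\log_{4/3}7}$, and with probability at least $1-n^{-c}$ all such queries take at most $B\,(n^{1/t}\lambda\log^{\kappa} n+\log t+|\Pi|)$ steps, where $B$ depends on $c$ only. -/

import Mathlib

open MeasureTheory ProbabilityTheory
open scoped NNReal ENNReal

namespace PathOracle

noncomputable section

/-! ### Weighted graphs: lengths, distances, canonical shortest paths, arboricity -/

section Graph

variable {n : ℕ}

/-- The length of a walk: the sum of the weights of its edges. -/
def wlen {G : SimpleGraph (Fin n)} (w : Sym2 (Fin n) → ℝ≥0) {u v : Fin n} (p : G.Walk u v) : ℝ≥0 :=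
  (p.edges.map w).sum

/-- The distance `d_G(u,v)` in the weighted graph (`⊤` if there is no walk from `u` to `v`). -/
def gdist (G : SimpleGraph (Fin n)) (w : Sym2 (Fin n) → ℝ≥0) (u v : Fin n) : ℝ≥0∞ :=
  ⨅ p : G.Walk u v, (wlen w p : ℝ≥0∞)

/-- A number that determines the set of edges of a path; it is used to break ties between
shortest paths in a consistent way (so that two chosen paths that have two vertices in common
share the whole subpath between them). -/
def pathCode {G : SimpleGraph (Fin n)} {u v : Fin n} (p : G.Walk u v) : ℕ :=
  (p.edges.map fun e => 2 ^ (Fintype.equivFin (Sym2 (Fin n)) e : ℕ)).sum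

/-- `p` is the shortest path from `u` to `v` that has the least code. -/
def IsCanon {G : SimpleGraph (Fin n)} (w : Sym2 (Fin n) → ℝ≥0) {u v : Fin n}
    (p : G.Walk u v) : Prop :=
  p.IsPath ∧ ∀ q : G.Walk u v, q.IsPath →
    wlen w p < wlen w q ∨ (wlen w p = wlen w q ∧ pathCode p ≤ pathCode q)

open Classical in
/-- The chosen shortest path `Π_{u,v}`, as the list of its vertices from `u` to `v`
(the empty list if `v` cannot be reached from `u`). -/
def canonPath (G : SimpleGraph (Fin n)) (w : Sym2 (Fin n) → ℝ≥0) (u v : Fin n) : List (Fin n) :=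
  if h : ∃ p : G.Walk u v, IsCanon w p then h.choose.support else []

/-- The successor of `x` on a path (`none` if there is none). -/
def succOf (l : List (Fin n)) (x : Fin n) : Option (Fin n) := l[l.idxOf x + 1]?

/-- The predecessor of `x` on a path (`none` if there is none). -/
def predOf (l : List (Fin n)) (x : Fin n) : Option (Fin n) := succOf l.reverse x

/-- `max |E(U)| / (|U| - 1)` over all vertex sets `U` with at least two elements
(`0` if the graph has fewer than two vertices). -/
def arboricity (G : SimpleGraph (Fin n)) : ℝ :=
  ⨆ U : {U : Finset (Fin n) // 2 ≤ U.card},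
    ({e ∈ G.edgeSet | ∀ x ∈ e, x ∈ U.1}.ncard : ℝ) / ((U.1.card : ℝ) - 1)

/-- `m / n`, the number of edges divided by the number of vertices. -/
def density (G : SimpleGraph (Fin n)) : ℝ := (G.edgeSet.ncard : ℝ) / n

/-- The distance from `v` to the nearest element of `L` (`⊤` if no element can be reached). -/
def radius (G : SimpleGraph (Fin n)) (w : Sym2 (Fin n) → ℝ≥0) (L : Set (Fin n)) (v : Fin n) :
    ℝ≥0∞ := ⨅ l ∈ L, gdist G w v l

open Classical in
/-- The element of `L` nearest to `v`; ties are broken by the order of the vertices. -/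
def nearest (G : SimpleGraph (Fin n)) (w : Sym2 (Fin n) → ℝ≥0) (L : Set (Fin n)) (v : Fin n) :
    Option (Fin n) :=
  (List.finRange n).find? fun l =>
    decide (l ∈ L ∧ gdist G w v l ≠ ⊤ ∧ gdist G w v l = radius G w L v)

end Graph

/-! ### Computations with a step count

Elementary steps: one access to a table (array or hash table), one step of a loop with a bounded
number of comparisons, additions and moves of machine words. A word holds a vertex or an edge
weight / distance. -/

/-- A value together with the number of elementary steps spent on computing it. -/
structure Timed (α : Type) where
  val : α
  steps : ℕ

namespace Timed

instance : Monad Timed where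
  pure a := ⟨a, 0⟩
  bind x f := ⟨(f x.val).val, x.steps + (f x.val).steps⟩

/-- One elementary step. -/
def tick : Timed Unit := ⟨(), 1⟩

end Timed

open Timed

/-- A table (array or hash table), seen as the partial function that it represents. -/
abbrev Table (K X : Type) := K → Option X

namespace Table

variable {K X : Type}

/-- One access to a table costs one step. -/
def get (t : Table K X) (k : K) : Timed (Option X) := ⟨t k, 1⟩

/-- The number of entries of a table. -/
def entries [Fintype K] (t : Table K X) : ℕ := (Finset.univ.filter fun k => (t k).isSome).card

end Table

/-! ### What the oracle stores -/

section Data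

/-- The record kept for a vertex `x` in a forest of shortest path trees: its parent
(`none` at a root) and its distance to the root. -/
structure TreeEntry (n : ℕ) where
  parent : Option (Fin n)
  dist : ℝ≥0

/-- The record of the home path of `x`: the identity of the path, and the two neighbours
of `x` on it. -/
structure HomeEntry (n : ℕ) where
  path : Fin n × Fin n
  left : Fin n
  right : Fin n

/-- The record of a branching event `(Π, Π', x)`: the neighbours of `x` on both paths. -/
structure BranchEntry (n : ℕ) where
  pred₁ : Option (Fin n)
  succ₁ : Option (Fin n)
  pred₂ : Option (Fin n)
  succ₂ : Option (Fin n)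

/-- The record of a pair `(x,y)`: the first edge `(x, second)` and the last edge
`(penultimate, y)` of the path `Π_{x,y}`. -/
structure EndsEntry (n : ℕ) where
  second : Fin n
  penultimate : Fin n

/-- A distance-preserving path-reporting oracle. Paths are identified by their end points.
The table `ends` also serves for membership queries to the set of pairs. -/
structure DPPRO (n : ℕ) where
  home : Table (Fin n) (HomeEntry n)
  branch : Table ((Fin n × Fin n) × (Fin n × Fin n) × Fin n) (BranchEntry n)
  ends : Table (Fin n × Fin n) (EndsEntry n)

/-- The number of words (keys and values) stored in a `DPPRO`. -/
def DPPRO.words {n : ℕ} (D : DPPRO n) : ℕ :=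
  5 * D.home.entries + 9 * D.branch.entries + 4 * D.ends.entries

/-- One level of the oracle: the forest that leads to the landmarks of this level, and the
`DPPRO` for pairs of landmarks of this level. -/
structure Level (n : ℕ) where
  forest : Table (Fin n) (TreeEntry n)
  dppro : DPPRO n

/-- The number of words stored for one level. -/
def Level.words {n : ℕ} (l : Level n) : ℕ := 3 * l.forest.entries + l.dppro.words

/-- The content of the oracle: the input graph, stored by adjacency lists, and the levels. -/
structure Oracle (n : ℕ) where
  adj : Fin n → List (Fin n × ℝ≥0)
  levels : List (Level n)

/-- The number of words stored by the oracle in addition to the input graph. -/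
def Oracle.extraWords {n : ℕ} (O : Oracle n) : ℕ := (O.levels.map Level.words).sum

end Data

/-! ### The query algorithm

It has access to the stored tables only. All loops carry a counter that bounds the number of
iterations (to make the recursion structural); the counter never runs out. -/

section Query

variable {n : ℕ}

/-- An item of the priority queue: a tentative distance, a vertex, and the vertex from which it
was reached. -/
structure QItem (n : ℕ) where
  dist : ℝ≥0
  vtx : Fin n
  pred : Fin n

/-- Leftist heaps. -/
inductive Heap (n : ℕ) : Type where
  | nil : Heap n
  | node (rank : ℕ) (item : QItem n) (left right : Heap n) : Heap n

namespace Heap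

/-- The rank that is stored at the root. -/
def rank : Heap n → ℕ
  | nil => 0
  | node r _ _ _ => r

/-- The number of items. -/
def size : Heap n → ℕ
  | nil => 0
  | node _ _ l r => l.size + r.size + 1

/-- Join two heaps under a root; the heap of larger rank goes to the left. -/
def join (a : QItem n) (s t : Heap n) : Heap n :=
  if t.rank ≤ s.rank then node (t.rank + 1) a s t else node (s.rank + 1) a t s

/-- Merge two leftist heaps. -/
def merge : Heap n → Heap n → Timed (Heap n)
  | nil, t => do tick; return t
  | s@(node _ _ _ _), nil => do tick; return s
  | node k a l r, node k' a' l' r' => do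
      tick
      if a.dist ≤ a'.dist then
        let s ← merge r (node k' a' l' r')
        return join a l s
      else
        let s ← merge (node k a l r) r'
        return join a' l' s
termination_by s t => s.size + t.size
decreasing_by
  all_goals simp only [size]; omega

/-- Insert one item. -/
def insert (a : QItem n) (s : Heap n) : Timed (Heap n) := merge (node 1 a nil nil) s

end Heap

/-- `d` is smaller than the radius `r`, where `none` is an infinite radius. -/
def below (d : ℝ≥0) (r : Option ℝ≥0) : Prop := ∀ x ∈ r, d < x

open Classical in
/-- Relax the edges of `x` (at distance `d` from the source) in increasing order of weight;
stop at the first edge that leads to a tentative distance of at least `r`. -/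
def scan (r : Option ℝ≥0) (d : ℝ≥0) (x : Fin n) :
    List (Fin n × ℝ≥0) → Heap n → Timed (Heap n)
  | [], H => do tick; return H
  | (y, e) :: rest, H => do
      tick
      if below (d + e) r then
        let H' ← H.insert ⟨d + e, y, x⟩
        scan r d x rest H'
      else
        return H

/-- Dijkstra's algorithm in the ball of radius `r` around the source, until `target` is found.
The array `seen` holds, for every vertex found so far, the vertex from which it was reached. -/
def explore (adj : Fin n → List (Fin n × ℝ≥0)) (r : Option ℝ≥0) (target : Fin n) :
    ℕ → Heap n → Table (Fin n) (Fin n) → Timed (Option (Table (Fin n) (Fin n)))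
  | 0, _, _ => do tick; return none
  | _ + 1, .nil, _ => do tick; return none
  | k + 1, .node _ a s t, seen => do
      tick
      let H ← s.merge t
      match ← seen.get a.vtx with
      | some _ => explore adj r target k H seen
      | none =>
          let seen' := Function.update seen a.vtx (some a.pred)
          if a.vtx = target then
            return some seen'
          else
            let H' ← scan r a.dist a.vtx (adj a.vtx) H
            explore adj r target k H' seen'

/-- Follow the predecessors from `x` back to `source`; the result is the path from `source`
to the vertex where the walk began, when `acc` is `[x]` at the beginning. -/
def traceBack (seen : Table (Fin n) (Fin n)) (source : Fin n) :
    ℕ → Fin n → List (Fin n) → Timed (Option (List (Fin n)))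
  | 0, _, _ => do tick; return none
  | k + 1, x, acc => do
      tick
      if x = source then
        return some acc
      else
        match ← seen.get x with
        | none => return none
        | some y => traceBack seen source k y (y :: acc)

open Classical in
/-- Test whether `target` lies in the first-level ball of `source`, and return a shortest path
from `source` to `target` if it does. -/
def ballSearch (O : Oracle n) (source target : Fin n) : Timed (Option (List (Fin n))) := do
  tick
  let r : Option ℝ≥0 ← match O.levels with
    | [] => pure none
    | lev :: _ => do
        let e ← lev.forest.get source
        pure (e.map TreeEntry.dist)
  if below 0 r then
    match ← explore O.adj r target (n * n + 2) (.node 1 ⟨0, source, source⟩ .nil .nil)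
        (fun _ => none) with
    | none => return none
    | some seen => traceBack seen source (n + 1) target [target]
  else
    return none

/-- Walk from `x` to the root of its tree; the vertices that are passed are put in front of
`acc`, whose head is `x`. Returns the root and the extended list. -/
def climbTree (f : Table (Fin n) (TreeEntry n)) :
    ℕ → Fin n → List (Fin n) → Timed (Option (Fin n × List (Fin n)))
  | 0, _, _ => do tick; return none
  | k + 1, x, acc => do
      tick
      match ← f.get x with
      | none => return none
      | some e =>
          match e.parent with
          | none => return some (x, acc)
          | some y => climbTree f k y (y :: acc)

/-- Traverse the path `Π_{x,y}`, whose last edge is `(last, y)`: the current vertex is `cur`,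
it was entered from `prev`, and `acc` holds the vertices passed so far in reverse order. -/
def followPath (D : DPPRO n) (x y last : Fin n) :
    ℕ → Fin n → Fin n → List (Fin n) → Timed (Option (List (Fin n)))
  | 0, _, _, _ => do tick; return none
  | k + 1, prev, cur, acc => do
      tick
      if cur = last then
        return some (y :: acc)
      else
        match ← D.home.get cur with
        | none => return none
        | some e =>
            match ← D.branch.get (e.path, (x, y), cur) with
            | none =>
                let next := if e.left = prev then e.right else e.left
                followPath D x y last k cur next (next :: acc)
            | some b =>
                match b.succ₂ with
                | none => return none
                | some next => followPath D x y last k cur next (next :: acc)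

/-- Report the path `Π_{x,y}` for a stored pair with record `e`; `acc` has head `x`. -/
def DPPRO.report (D : DPPRO n) (x y : Fin n) (e : EndsEntry n) (acc : List (Fin n)) :
    Timed (Option (List (Fin n))) := do
  tick
  if x = e.penultimate then
    return some (y :: acc)
  else
    followPath D x y e.penultimate n x e.second (e.second :: acc)

/-- Output the vertices of the reversed list `a`, followed by those of `b`. -/
def emit : List (Fin n) → List (Fin n) → Timed (List (Fin n))
  | [], b => do tick; return b
  | x :: a, b => do tick; emit a (x :: b)

/-- Process the levels one after the other. `accU` is the reversed path from `u` to the current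
landmark `x`, and `accV` is the path from the current landmark `y` to `v`. -/
def climb : List (Level n) → Fin n → Fin n → List (Fin n) → List (Fin n) →
    Timed (Option (List (Fin n)))
  | [], _, _, _, _ => do tick; return none
  | lev :: rest, x, y, accU, accV => do
      tick
      match ← climbTree lev.forest (n + 1) x accU with
      | none => return none
      | some (x', accU') =>
          match ← climbTree lev.forest (n + 1) y accV with
          | none => return none
          | some (y', accV') =>
              if x' = y' then
                let path ← emit accU' accV'.tail
                return some path
              else
                match ← lev.dppro.ends.get (x', y') with
                | none => climb rest x' y' accU' accV'
                | some e =>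
                    match ← lev.dppro.report x' y' e accU' with
                    | none => return none
                    | some acc =>
                        let path ← emit acc accV'.tail
                        return some path

/-- The query algorithm: a list of vertices from `u` to `v` (or `none`). -/
def Oracle.query (O : Oracle n) (u v : Fin n) : Timed (Option (List (Fin n))) := do
  match ← ballSearch O u v with
  | some path => return some path
  | none =>
      match ← ballSearch O v u with
      | some path =>
          let rev ← emit path []
          return some rev
      | none => climb O.levels u v [u] [v]

end Query

/-! ### The construction of the oracle -/

section Construction

variable {n : ℕ}

open Classical in
/-- The adjacency list of `x`, sorted by weight. -/
def adjList (G : SimpleGraph (Fin n)) (w : Sym2 (Fin n) → ℝ≥0) (x : Fin n) :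
    List (Fin n × ℝ≥0) :=
  (((List.finRange n).filter fun y => decide (G.Adj x y)).map fun y => (y, w s(x, y))).insertionSort
    fun a b => a.2 ≤ b.2

/-- The forest of shortest path trees rooted at the elements of `L`: the tree of a root contains
the vertices whose nearest element of `L` it is. -/
def mkForest (G : SimpleGraph (Fin n)) (w : Sym2 (Fin n) → ℝ≥0) (L : Set (Fin n)) :
    Table (Fin n) (TreeEntry n) := fun v =>
  (nearest G w L v).map fun l => ⟨succOf (canonPath G w v l) v, (gdist G w v l).toNNReal⟩

/-- `e` describes a path `Π_{x,y}` with `(x,y) ∈ P` that contains `z` as an inner vertex. -/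
def IsHome (G : SimpleGraph (Fin n)) (w : Sym2 (Fin n) → ℝ≥0) (P : Set (Fin n × Fin n))
    (z : Fin n) (e : HomeEntry n) : Prop :=
  e.path ∈ P ∧ predOf (canonPath G w e.path.1 e.path.2) z = some e.left ∧
    succOf (canonPath G w e.path.1 e.path.2) z = some e.right

/-- `(p, q, z)` is a branching event: the distinct paths `Π_p` and `Π_q`, with `p, q ∈ P`, both
contain `z`, and `{pred(z), succ(z)}` differs between them. -/
def IsBranching (G : SimpleGraph (Fin n)) (w : Sym2 (Fin n) → ℝ≥0) (P : Set (Fin n × Fin n))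
    (p q : Fin n × Fin n) (z : Fin n) : Prop :=
  p ∈ P ∧ q ∈ P ∧ p ≠ q ∧ z ∈ canonPath G w p.1 p.2 ∧ z ∈ canonPath G w q.1 q.2 ∧
    s(predOf (canonPath G w p.1 p.2) z, succOf (canonPath G w p.1 p.2) z) ≠
      s(predOf (canonPath G w q.1 q.2) z, succOf (canonPath G w q.1 q.2) z)

open Classical in
/-- The distance-preserving path-reporting oracle for the set `P` of pairs. -/
def mkDPPRO (G : SimpleGraph (Fin n)) (w : Sym2 (Fin n) → ℝ≥0) (P : Set (Fin n × Fin n)) :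
    DPPRO n where
  home z := if h : ∃ e, IsHome G w P z e then some h.choose else none
  branch k :=
    if IsBranching G w P k.1 k.2.1 k.2.2 then
      some ⟨predOf (canonPath G w k.1.1 k.1.2) k.2.2, succOf (canonPath G w k.1.1 k.1.2) k.2.2,
        predOf (canonPath G w k.2.1.1 k.2.1.2) k.2.2, succOf (canonPath G w k.2.1.1 k.2.1.2) k.2.2⟩
    else none
  ends k :=
    if k ∈ P then
      match succOf (canonPath G w k.1 k.2) k.1, predOf (canonPath G w k.1 k.2) k.2 with
      | some a, some b => some ⟨a, b⟩
      | _, _ => none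
    else none

/-- The set `P_i` of pairs of `i`-landmarks, where `L i` is the set of `i`-landmarks: for `i < h`
one of the two landmarks lies in the one-third-ball of the other one with respect to the
`(i+1)`-landmarks; for `i = h` all pairs of distinct landmarks (that are connected in `G`). -/
def levelPairs (G : SimpleGraph (Fin n)) (w : Sym2 (Fin n) → ℝ≥0) (h : ℕ) (L : ℕ → Set (Fin n))
    (i : ℕ) : Set (Fin n × Fin n) :=
  {p | p.1 ∈ L i ∧ p.2 ∈ L i ∧ p.1 ≠ p.2 ∧
    ((i < h ∧ (gdist G w p.1 p.2 < radius G w (L (i + 1)) p.1 / 3 ∨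
        gdist G w p.2 p.1 < radius G w (L (i + 1)) p.2 / 3)) ∨
      (i = h ∧ gdist G w p.1 p.2 ≠ ⊤))}

/-- The `h`-level oracle for the sets `L 1, …, L h` of landmarks. -/
def mkOracle (G : SimpleGraph (Fin n)) (w : Sym2 (Fin n) → ℝ≥0) (h : ℕ) (L : ℕ → Set (Fin n)) :
    Oracle n where
  adj := adjList G w
  levels := (List.range h).map fun j =>
    ⟨mkForest G w (L (j + 1)), mkDPPRO G w (levelPairs G w h L (j + 1))⟩

end Construction

/-! ### Sampling of the landmarks -/

section Sampling

variable {n : ℕ}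

/-- `ρ_i = n ^ α_i` with `α_i = 1 - (3/4)^(h-i+1)`, for `1 ≤ i ≤ h`. -/
def rho (n h i : ℕ) : ℝ := (n : ℝ) ^ (1 - (3 / 4 : ℝ) ^ (h + 1 - i))

theorem rho_div_mem (n h i : ℕ) : rho n h i / n ∈ unitInterval := by
  refine ⟨div_nonneg (Real.rpow_nonneg (Nat.cast_nonneg n) _) (Nat.cast_nonneg n), ?_⟩
  rcases Nat.eq_zero_or_pos n with rfl | hn
  · simp
  · have hn1 : (1 : ℝ) ≤ n := by exact_mod_cast hn
    refine div_le_one_of_le₀ ?_ (Nat.cast_nonneg n)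
    calc rho n h i ≤ (n : ℝ) ^ (1 : ℝ) :=
          Real.rpow_le_rpow_of_exponent_le hn1 (by
            have : (0 : ℝ) ≤ (3 / 4 : ℝ) ^ (h + 1 - i) := by positivity
            linarith)
      _ = n := Real.rpow_one _

/-- The two variants of the result: for the arboricity, and for the density `m / n`. -/
inductive Variant where
  | byArboricity
  | byDensity

/-- The parameter `λ` of a graph. -/
def Variant.lam (G : SimpleGraph (Fin n)) : Variant → ℝ
  | byArboricity => arboricity G
  | byDensity => density G

/-- The number of copies (virtual nodes) of a vertex that take part in the sampling: one in the
first variant, and `⌈deg(v) / λ⌉` in the second one. -/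
def Variant.copies (G : SimpleGraph (Fin n)) : Variant → Fin n → ℕ
  | byArboricity, _ => 1
  | byDensity, v => ⌈((G.neighborSet v).ncard : ℝ) / density G⌉₊

/-- Outcomes of the coins: one coin for every level and every copy of every vertex. The coin
`(j, ⟨v, c⟩)` belongs to the level `j + 1`. -/
abbrev Coins (G : SimpleGraph (Fin n)) (h : ℕ) (var : Variant) : Type :=
  Fin h × (Σ v : Fin n, Fin (var.copies G v)) → Bool

/-- Independent coins; a coin of level `i` comes up `true` with probability `ρ_i / n`. -/
def coinLaw (G : SimpleGraph (Fin n)) (h : ℕ) (var : Variant) : Measure (Coins G h var) :=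
  Measure.pi fun x => bernoulliMeasure true false ⟨rho n h (x.1 + 1) / n, rho_div_mem n h (x.1 + 1)⟩

/-- The set `L_i` of `i`-landmarks: the vertices that have a selected copy. -/
def landmarks (G : SimpleGraph (Fin n)) (h : ℕ) (var : Variant) (ω : Coins G h var) (i : ℕ) :
    Set (Fin n) :=
  {v | ∃ j : Fin h, (j : ℕ) + 1 = i ∧ ∃ c, ω (j, ⟨v, c⟩) = true}

/-- The random oracle `Λ_h`. -/
def Lambda (G : SimpleGraph (Fin n)) (w : Sym2 (Fin n) → ℝ≥0) (h : ℕ) (var : Variant)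
    (ω : Coins G h var) : Oracle n :=
  mkOracle G w h (landmarks G h var ω)

/-- The expected number of words stored by `Λ_h` in addition to the input graph. -/
def expectedSpace (G : SimpleGraph (Fin n)) (w : Sym2 (Fin n) → ℝ≥0) (h : ℕ) (var : Variant) :
    ℝ :=
  ∫ ω, ((Lambda G w h var ω).extraWords : ℝ) ∂(coinLaw G h var)

/-- For every outcome of the coins and all vertices `u`, `v` that are connected in `G`, the oracle
`Λ_h` returns a path of `G` from `u` to `v` of length at most `α` times their distance. -/
def HasStretch (G : SimpleGraph (Fin n)) (w : Sym2 (Fin n) → ℝ≥0) (h : ℕ) (var : Variant)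
    (α : ℝ) : Prop :=
  ∀ (ω : Coins G h var) (u v : Fin n), G.Reachable u v →
    ∃ p : G.Walk u v, ((Lambda G w h var ω).query u v).val = some p.support ∧
      gdist G w u v ≤ wlen w p ∧ (wlen w p : ℝ≥0∞) ≤ ENNReal.ofReal α * gdist G w u v

/-- The event that every query takes at most `T + a * |Π|` steps, where `|Π|` is the number of
edges of the path that is returned. -/
def FastQueries (G : SimpleGraph (Fin n)) (w : Sym2 (Fin n) → ℝ≥0) (h : ℕ) (var : Variant)
    (T a : ℝ) : Set (Coins G h var) :=
  {ω | ∀ u v : Fin n, G.Reachable u v →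
    ∃ p : G.Walk u v, ((Lambda G w h var ω).query u v).val = some p.support ∧
      (((Lambda G w h var ω).query u v).steps : ℝ) ≤ T + a * p.length}

end Sampling

end

end PathOracle

open PathOracle

/-! Stretch. When both ball tests fail, both first radii are at most `d = gdist G w u v`. At each
level let `A` bound the distance of the two current vertices plus twice their radius bound, and also
the length walked so far plus the same. The landmarks reached next are then at distance at most `A`.
If no stored path joins them, the one-third rule bounds the next radii by `3A`, and `A` is replaced
by `A + 2·3A = 7A`. The start value is `3d`, the top level joins every connected pair, and the final
path costs at most `2A`. The result is `2·3·7^(h-1)·d ≤ 7^h·d`, and `7^h` is the claimed power of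
`t` (`climb_spec`, `query_spec`).

Space. A chosen path minimises length and then a code that determines its edge set. Hence two chosen
paths share the whole subpath between any two common vertices, and they branch at no more than two
vertices (`card_branching_le_two`). It remains to count pairs of stored paths that meet. Below the
top level, the four ends of such a pair consist of a landmark `a` and three landmarks in the ball of
`a` (`exists_ballTuple`). Let `p` and `p'` be the sampling probabilities of this level and the next.
A ball holds about `p/p'` landmarks, with a geometric tail, so the expected number of such
quadruples has order `n·p·(p/p')^3`. The exponents `α_i` are chosen so that `p^4 = p'^3`, which
makes this linear (`integral_inBall_cube_le`). At the top there are about `n^(1/4)` landmarks, whose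
fourth moment is again linear (`integral_card_pow_four_le`). Both moments come from exponential
moments of independent coins.

Time. A search relaxes only edges inside a first-level ball, and their number is at most `2λ` times
the number of copies in the ball (`ballEdges_le`). A ball with more than order `n^(1/t) log n`
copies avoids all landmarks with tiny probability, and only `n(n+1)` balls are possible, so a union
bound applies (`coinLaw_small_balls`). Heap operations cost one more logarithm. All other work is a
constant per level and per edge of the answer. -/

/-! ### Chosen shortest paths and how often two of them branch. -/

namespace PathOracle

/-! ### Lengths, codes and distances -/

section Distance

variable {n : ℕ} {G : SimpleGraph (Fin n)} {w : Sym2 (Fin n) → ℝ≥0}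

@[simp] lemma wlen_nil (u : Fin n) : wlen w (SimpleGraph.Walk.nil : G.Walk u u) = 0 := by
  simp [wlen]

@[simp] lemma wlen_cons {u v x : Fin n} (h : G.Adj u v) (p : G.Walk v x) :
    wlen w (SimpleGraph.Walk.cons h p) = w s(u, v) + wlen w p := by
  simp [wlen]

@[simp] lemma wlen_append {u v x : Fin n} (p : G.Walk u v) (q : G.Walk v x) :
    wlen w (p.append q) = wlen w p + wlen w q := by
  simp [wlen]

@[simp] lemma wlen_reverse {u v : Fin n} (p : G.Walk u v) : wlen w p.reverse = wlen w p := by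
  simp [wlen, List.map_reverse, List.sum_reverse]

lemma wlen_bypass_le {u v : Fin n} (p : G.Walk u v) : wlen w p.bypass ≤ wlen w p :=
  (p.edges_bypass_sublist_edges.map w).sum_le_sum (by simp)

@[simp] lemma pathCode_append {u v x : Fin n} (p : G.Walk u v) (q : G.Walk v x) :
    pathCode (p.append q) = pathCode p + pathCode q := by
  simp [pathCode]

@[simp] lemma pathCode_reverse {u v : Fin n} (p : G.Walk u v) :
    pathCode p.reverse = pathCode p := by
  simp [pathCode, List.map_reverse, List.sum_reverse]

lemma pathCode_bypass_le {u v : Fin n} (p : G.Walk u v) : pathCode p.bypass ≤ pathCode p :=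
  (p.edges_bypass_sublist_edges.map _).sum_le_sum (by simp)

lemma gdist_le_wlen {u v : Fin n} (p : G.Walk u v) : gdist G w u v ≤ wlen w p := iInf_le _ p

@[simp] lemma gdist_self (u : Fin n) : gdist G w u u = 0 :=
  le_antisymm (by simpa using gdist_le_wlen (w := w) (SimpleGraph.Walk.nil : G.Walk u u)) zero_le

lemma gdist_comm (u v : Fin n) : gdist G w u v = gdist G w v u := by
  have key : ∀ a b : Fin n, gdist G w a b ≤ gdist G w b a := fun a b =>
    le_iInf fun p => by simpa using gdist_le_wlen (w := w) p.reverse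
  exact le_antisymm (key _ _) (key _ _)

lemma gdist_triangle (u v x : Fin n) : gdist G w u x ≤ gdist G w u v + gdist G w v x := by
  unfold gdist
  refine ENNReal.le_iInf_add_iInf fun p q => ?_
  exact (iInf_le _ (p.append q)).trans (by simp)

lemma gdist_ne_top_iff {u v : Fin n} : gdist G w u v ≠ ⊤ ↔ G.Reachable u v := by
  constructor
  · intro h
    by_contra hn
    apply h
    have : IsEmpty (G.Walk u v) := ⟨fun p => hn ⟨p⟩⟩
    simp [gdist]
  · rintro ⟨p⟩
    exact ne_top_of_le_ne_top ENNReal.coe_ne_top (gdist_le_wlen p)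

lemma gdist_le_of_adj {u v : Fin n} (h : G.Adj u v) : gdist G w u v ≤ w s(u, v) := by
  simpa using gdist_le_wlen (w := w) (SimpleGraph.Walk.cons h SimpleGraph.Walk.nil)

lemma IsCanon.wlen_le {u v : Fin n} {p : G.Walk u v} (hp : IsCanon w p) (q : G.Walk u v) :
    wlen w p ≤ wlen w q := by
  refine le_trans ?_ (wlen_bypass_le q)
  rcases hp.2 _ q.bypass_isPath with h | h
  · exact h.le
  · exact h.1.le

lemma IsCanon.gdist_eq {u v : Fin n} {p : G.Walk u v} (hp : IsCanon w p) :
    gdist G w u v = wlen w p :=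
  le_antisymm (gdist_le_wlen p) (le_iInf fun q => by exact_mod_cast hp.wlen_le q)

lemma exists_isCanon {u v : Fin n} (h : G.Reachable u v) : ∃ p : G.Walk u v, IsCanon w p := by
  classical
  obtain ⟨p⟩ := h
  have : Nonempty (G.Path u v) := ⟨p.toPath⟩
  obtain ⟨q, hq⟩ := Finite.exists_min
    (fun q : G.Path u v => toLex (wlen w q.1, pathCode q.1))
  refine ⟨q.1, q.2, fun r hr => ?_⟩
  have := hq ⟨r, hr⟩
  rw [Prod.Lex.le_iff] at this
  simpa using this

lemma canonPath_of_reachable (w : Sym2 (Fin n) → ℝ≥0) {u v : Fin n} (h : G.Reachable u v) :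
    ∃ p : G.Walk u v, IsCanon w p ∧ canonPath G w u v = p.support := by
  have hex := exists_isCanon (w := w) h
  exact ⟨hex.choose, hex.choose_spec, by simp [canonPath, hex]⟩

lemma canonPath_of_mem {u v z : Fin n} (h : z ∈ canonPath G w u v) :
    ∃ p : G.Walk u v, IsCanon w p ∧ canonPath G w u v = p.support := by
  have hex : ∃ p : G.Walk u v, IsCanon w p := by
    by_contra hn
    simp [canonPath, hn] at h
  exact canonPath_of_reachable w ⟨hex.choose⟩

/-- Subpaths of chosen paths are chosen. -/
lemma IsCanon.subpath {u x y v : Fin n} {p : G.Walk u x} {q : G.Walk x y} {r : G.Walk y v}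
    (h : IsCanon w (p.append (q.append r))) : IsCanon w q := by
  refine ⟨h.1.of_append_right.of_append_left, fun q' _ => ?_⟩
  -- Replacing `q` by `q'` may create a walk that repeats vertices; removing the detours increases
  -- neither its length nor its code, so the minimality of the whole path applies to it.
  have hle := wlen_bypass_le (w := w) (p.append (q'.append r))
  have hce := pathCode_bypass_le (p.append (q'.append r))
  simp only [wlen_append, pathCode_append] at hle hce
  rcases h.2 _ (p.append (q'.append r)).bypass_isPath with h1 | ⟨h1, h2⟩
  · left
    simp only [wlen_append] at h1
    have h2 := h1.trans_le hle
    rw [← NNReal.coe_lt_coe] at h2 ⊢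
    push_cast at h2
    linarith
  · simp only [wlen_append, pathCode_append] at h1 h2
    have h3 := h1.le.trans hle
    have h4 := h2.trans hce
    have h5 : wlen w q ≤ wlen w q' := by
      rw [← NNReal.coe_le_coe] at h3 ⊢
      push_cast at h3
      linarith
    rcases h5.lt_or_eq with h5 | h5
    · exact Or.inl h5
    · exact Or.inr ⟨h5, by omega⟩

lemma IsCanon.reverse {u v : Fin n} {p : G.Walk u v} (h : IsCanon w p) : IsCanon w p.reverse := by
  refine ⟨h.1.reverse, fun q hq => ?_⟩
  simpa using h.2 _ hq.reverse

/-- A path uses no edge twice, so its code is the binary expansion of its edge set. Uniqueness of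
binary expansions then makes the tie-breaking decisive. -/
lemma pathCode_eq_sum {u v : Fin n} {p : G.Walk u v} (hp : p.IsPath) :
    pathCode p = ∑ i ∈ (p.edges.map fun e => (Fintype.equivFin (Sym2 (Fin n)) e : ℕ)).toFinset,
      2 ^ i := by
  rw [List.sum_toFinset]
  · simp [pathCode, Function.comp_def]
  · refine hp.1.edges_nodup.map fun a b hab => ?_
    exact (Fintype.equivFin _).injective (Fin.ext hab)

/-- The chosen path is determined by its end points. -/
lemma IsCanon.mem_edges_iff {u v : Fin n} {p q : G.Walk u v} (hp : IsCanon w p)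
    (hq : IsCanon w q) (e : Sym2 (Fin n)) : e ∈ p.edges ↔ e ∈ q.edges := by
  have hcode : pathCode p = pathCode q := by
    have hw : wlen w p = wlen w q := le_antisymm (hp.wlen_le q) (hq.wlen_le p)
    rcases hp.2 q hq.1 with h | h
    · exact absurd hw h.ne
    rcases hq.2 p hp.1 with h' | h'
    · exact absurd hw h'.ne'
    exact le_antisymm h.2 h'.2
  rw [pathCode_eq_sum hp.1, pathCode_eq_sum hq.1] at hcode
  have hset := Finset.geomSum_injective le_rfl hcode
  have hinj : Function.Injective fun e => (Fintype.equivFin (Sym2 (Fin n)) e : ℕ) :=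
    fun a b hab => (Fintype.equivFin _).injective (Fin.ext hab)
  have key := Finset.ext_iff.1 hset (Fintype.equivFin (Sym2 (Fin n)) e : ℕ)
  simp only [List.mem_toFinset] at key
  rwa [List.mem_map_of_injective hinj, List.mem_map_of_injective hinj] at key

end Distance

/-! ### Neighbours on a path -/

section Neighbours

variable {n : ℕ} {G : SimpleGraph (Fin n)} {w : Sym2 (Fin n) → ℝ≥0}

lemma succOf_append {pre post : List (Fin n)} {a b : Fin n} (h : (pre ++ a :: b :: post).Nodup) :
    succOf (pre ++ a :: b :: post) a = some b := by
  have ha : a ∉ pre := fun ha => (List.nodup_append.1 h).2.2 a ha a (by simp) rfl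
  simp [succOf, List.idxOf_append_of_notMem ha]

lemma predOf_append {pre post : List (Fin n)} {a b : Fin n} (h : (pre ++ a :: b :: post).Nodup) :
    predOf (pre ++ a :: b :: post) b = some a := by
  have hr := List.nodup_reverse.2 h
  simp only [List.reverse_append, List.reverse_cons, List.append_assoc, List.cons_append,
    List.nil_append] at hr
  simp only [predOf, List.reverse_append, List.reverse_cons, List.append_assoc, List.cons_append,
    List.nil_append]
  exact succOf_append hr

lemma exists_append_of_succOf {l : List (Fin n)} {a b : Fin n} (h : succOf l a = some b) :
    ∃ pre post, l = pre ++ a :: b :: post := by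
  obtain ⟨h1, h2⟩ := List.getElem?_eq_some_iff.1 h
  refine ⟨l.take (l.idxOf a), l.drop (l.idxOf a + 2), ?_⟩
  have ha : l[l.idxOf a] = a := List.getElem_idxOf (by omega)
  conv_lhs => rw [← List.take_append_drop (l.idxOf a) l]
  rw [List.drop_eq_getElem_cons (by omega), List.drop_eq_getElem_cons h1, ha, h2]

lemma exists_append_of_predOf {l : List (Fin n)} {a b : Fin n} (h : predOf l b = some a) :
    ∃ pre post, l = pre ++ a :: b :: post := by
  obtain ⟨pre, post, h1⟩ := exists_append_of_succOf h
  refine ⟨post.reverse, pre.reverse, ?_⟩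
  rw [← List.reverse_reverse l, h1]
  simp

lemma exists_append_of_support_eq {u v a : Fin n} (p : G.Walk u v) {pre post : List (Fin n)}
    (h : p.support = pre ++ a :: post) :
    ∃ (p₁ : G.Walk u a) (p₂ : G.Walk a v), p = p₁.append p₂ ∧ p₁.support = pre ++ [a] ∧
      p₂.support = a :: post := by
  induction pre generalizing u with
  | nil =>
    have : u = a := by
      have := p.cons_tail_support
      rw [h] at this
      exact (List.cons.inj this).1
    subst this
    exact ⟨.nil, p, by simp, by simp, by simpa using h⟩
  | cons b pre ih =>
    cases p with
    | nil => simp at h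
    | cons hadj p =>
      simp only [SimpleGraph.Walk.support_cons, List.cons_append, List.cons.injEq] at h
      obtain ⟨p₁, p₂, h1, h2, h3⟩ := ih p h.2
      exact ⟨.cons hadj p₁, p₂, by simp [h1], by simp [h2, h.1], h3⟩

lemma adj_of_support_eq {u v a b : Fin n} {p : G.Walk u v} {pre post : List (Fin n)}
    (h : p.support = pre ++ a :: b :: post) : G.Adj a b ∧ s(a, b) ∈ p.edges := by
  obtain ⟨p₁, p₂, h1, -, h3⟩ := exists_append_of_support_eq p h
  cases p₂ with
  | nil => simp at h3
  | cons hadj q =>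
    rename_i c
    have hc : c = b := by
      have := q.cons_tail_support
      simp only [SimpleGraph.Walk.support_cons, List.cons.injEq, true_and] at h3
      rw [← this] at h3
      exact (List.cons.inj h3).1
    subst hc
    exact ⟨hadj, by simp [h1]⟩

lemma exists_append_of_mem_edges {u v a b : Fin n} {p : G.Walk u v} (h : s(a, b) ∈ p.edges) :
    ∃ pre post, p.support = pre ++ a :: b :: post ∨ p.support = pre ++ b :: a :: post := by
  induction p with
  | nil => simp at h
  | cons hadj q ih =>
    rename_i x y z
    simp only [SimpleGraph.Walk.edges_cons, List.mem_cons, Sym2.eq_iff] at h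
    rcases h with (⟨rfl, rfl⟩ | ⟨rfl, rfl⟩) | h
    · exact ⟨[], q.support.tail, Or.inl (by simp)⟩
    · exact ⟨[], q.support.tail, Or.inr (by simp)⟩
    · obtain ⟨pre, post, h | h⟩ := ih h
      · exact ⟨x :: pre, post, Or.inl (by simp [h])⟩
      · exact ⟨x :: pre, post, Or.inr (by simp [h])⟩

lemma exists_append_of_idxOf_lt {l : List (Fin n)} {a z c : Fin n} (haz : l.idxOf a < l.idxOf z)
    (hzc : l.idxOf z < l.idxOf c) (hc : c ∈ l) :
    ∃ l₁ l₂ l₃ l₄, l = l₁ ++ a :: l₂ ++ z :: l₃ ++ c :: l₄ := by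
  have hz : z ∈ l := List.idxOf_lt_length_iff.1 (hzc.trans (List.idxOf_lt_length_iff.2 hc))
  obtain ⟨s, t, rfl, hzs⟩ := List.eq_append_cons_of_mem hz
  rw [List.idxOf_append_of_notMem hzs] at haz hzc
  have ha : a ∈ s := by
    by_contra hn
    rw [List.idxOf_append_of_notMem hn] at haz
    simp at haz
  have hcs : c ∉ s := by
    intro hn
    rw [List.idxOf_append_of_mem hn] at hzc
    have := List.idxOf_lt_length_iff.2 hn
    omega
  have hcz : c ≠ z := by
    rintro rfl
    rw [List.idxOf_append_of_notMem hcs] at hzc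
    omega
  have hct : c ∈ t := by
    simpa [hcs, hcz] using hc
  obtain ⟨l₁, l₂, rfl⟩ := List.append_of_mem ha
  obtain ⟨l₃, l₄, rfl⟩ := List.append_of_mem hct
  exact ⟨l₁, l₂, l₃, l₄, by simp⟩

/-- Two chosen paths that have two vertices in common share the subpath between them. -/
lemma IsCanon.edges_subset {u v u' v' x y : Fin n} {p₁ : G.Walk u x} {p₂ : G.Walk x y}
    {p₃ : G.Walk y v} (hp : IsCanon w (p₁.append (p₂.append p₃))) {q : G.Walk u' v'}
    (hq : IsCanon w q) (hx : x ∈ q.support) (hy : y ∈ q.support) :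
    ∀ e ∈ p₂.edges, e ∈ q.edges := by
  have hp₂ := hp.subpath
  obtain ⟨l₁, l₂, hl⟩ := List.append_of_mem hx
  obtain ⟨q₁, q₂, rfl, h1, h2⟩ := exists_append_of_support_eq q hl
  intro e he
  -- The path `q` may meet `y` before `x`; its subpath is then compared after reversal, which keeps
  -- it chosen because length and code ignore the direction.
  have hy' : y ∈ q₁.support ∨ y ∈ q₂.support := by
    simpa using hy
  rcases hy' with hy | hy
  · obtain ⟨l₃, l₄, hl'⟩ := List.append_of_mem hy
    obtain ⟨q₃, q₄, rfl, -, -⟩ := exists_append_of_support_eq q₁ hl'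
    rw [← SimpleGraph.Walk.append_assoc] at hq
    have h := (hp₂.mem_edges_iff hq.subpath.reverse e).1 he
    simp only [SimpleGraph.Walk.edges_reverse, List.mem_reverse] at h
    simp [h]
  · obtain ⟨l₃, l₄, hl'⟩ := List.append_of_mem hy
    obtain ⟨q₃, q₄, rfl, -, -⟩ := exists_append_of_support_eq q₂ hl'
    have h := (hp₂.mem_edges_iff hq.subpath e).1 he
    simp [h]

lemma mem_neighbours_of_mem_edges {u v a z : Fin n} {q : G.Walk u v} (hq : q.IsPath)
    (h : s(a, z) ∈ q.edges) : some a = predOf q.support z ∨ some a = succOf q.support z := by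
  have hnd := hq.support_nodup
  obtain ⟨pre, post, h | h⟩ := exists_append_of_mem_edges h
  · rw [h] at hnd ⊢
    exact Or.inl (predOf_append hnd).symm
  · rw [h] at hnd ⊢
    exact Or.inr (succOf_append hnd).symm

/-- The subpath of `p` from `a` to `c` is shared with `q`, so both edges of `p` at `z` lie on `q`. A
path has only one predecessor and one successor at `z`, and two distinct neighbours must fill both
places. -/
lemma IsCanon.neighbours_eq {u v u' v' a z c : Fin n} {p : G.Walk u v} (hp : IsCanon w p)
    {q : G.Walk u' v'} (hq : IsCanon w q) (haz : p.support.idxOf a < p.support.idxOf z)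
    (hzc : p.support.idxOf z < p.support.idxOf c) (hc : c ∈ p.support) (haq : a ∈ q.support)
    (hcq : c ∈ q.support) :
    s(predOf p.support z, succOf p.support z) = s(predOf q.support z, succOf q.support z) := by
  obtain ⟨l₁, l₂, l₃, l₄, hl⟩ := exists_append_of_idxOf_lt haz hzc hc
  have hnd := hp.1.support_nodup
  obtain ⟨p₁, p', rfl, -, hs'⟩ := exists_append_of_support_eq p (pre := l₁) (a := a)
    (post := l₂ ++ z :: l₃ ++ c :: l₄) (by simp [hl])
  obtain ⟨p₂, p₃, rfl, hs₂, -⟩ := exists_append_of_support_eq p' (pre := a :: l₂ ++ z :: l₃)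
    (a := c) (post := l₄) (by simp [hs'])
  have hsub := hp.edges_subset hq haq hcq
  obtain ⟨m, y₁, hm⟩ : ∃ m y₁, a :: l₂ = m ++ [y₁] :=
    ⟨_, _, (List.dropLast_append_getLast (by simp)).symm⟩
  obtain ⟨y₂, m', hm'⟩ : ∃ y₂ m', l₃ ++ [c] = y₂ :: m' := by
    cases l₃ with
    | nil => exact ⟨_, _, rfl⟩
    | cons y l => exact ⟨_, _, rfl⟩
  have hl2 : (p₁.append (p₂.append p₃)).support = (l₁ ++ m) ++ y₁ :: z :: y₂ :: (m' ++ l₄) := by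
    rw [hl]
    have : l₁ ++ a :: l₂ ++ z :: l₃ ++ c :: l₄ = l₁ ++ (a :: l₂) ++ z :: (l₃ ++ [c]) ++ l₄ := by
      simp
    rw [this, hm, hm']
    simp
  have hs2' : p₂.support = m ++ y₁ :: z :: y₂ :: m' := by
    rw [hs₂]
    have : a :: l₂ ++ z :: l₃ ++ [c] = (a :: l₂) ++ z :: (l₃ ++ [c]) := by simp
    rw [this, hm, hm']
    simp
  rw [hl2] at hnd ⊢
  have hpred := predOf_append (pre := l₁ ++ m) (a := y₁) (b := z) hnd
  have hsucc := succOf_append (pre := (l₁ ++ m) ++ [y₁]) (a := z) (b := y₂) (post := m' ++ l₄)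
    (by simpa using hnd)
  rw [hpred, show (l₁ ++ m) ++ y₁ :: z :: y₂ :: (m' ++ l₄) =
    ((l₁ ++ m) ++ [y₁]) ++ z :: y₂ :: (m' ++ l₄) by simp, hsucc]
  have hne : y₁ ≠ y₂ := by
    rintro rfl
    simp [List.nodup_append] at hnd
  have e1 := hsub _ (adj_of_support_eq (pre := m) (a := y₁) (b := z) hs2').2
  have e2 := hsub _ (adj_of_support_eq (pre := m ++ [y₁]) (a := z) (b := y₂) (post := m')
    (by simp [hs2'])).2
  rw [Sym2.eq_swap] at e2
  have hne' : some y₁ ≠ some y₂ := by simpa using hne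
  rcases mem_neighbours_of_mem_edges hq.1 e1 with h1 | h1 <;>
    rcases mem_neighbours_of_mem_edges hq.1 e2 with h2 | h2
  · exact absurd (h1.trans h2.symm) hne'
  · rw [h1, h2]
  · rw [h1, h2, Sym2.eq_swap]
  · exact absurd (h1.trans h2.symm) hne'

/-- Two chosen paths branch at two vertices at most. -/
lemma card_branching_le_two (P : Set (Fin n × Fin n)) (p q : Fin n × Fin n) :
    {z | IsBranching G w P p q z}.ncard ≤ 2 := by
  classical
  by_contra! hcon
  rw [Set.two_lt_ncard_iff] at hcon
  obtain ⟨a, b, c, ha, hb, hc, hab, hac, hbc⟩ := hcon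
  simp only [Set.mem_ofPred_eq, IsBranching] at ha hb hc
  obtain ⟨-, -, -, ha1, ha2, ha3⟩ := ha
  obtain ⟨-, -, -, hb1, hb2, hb3⟩ := hb
  obtain ⟨-, -, -, hc1, hc2, hc3⟩ := hc
  obtain ⟨P, hP, hPl⟩ := canonPath_of_mem ha1
  obtain ⟨Q, hQ, hQl⟩ := canonPath_of_mem ha2
  rw [hPl] at ha1 hb1 hc1 ha3 hb3 hc3
  rw [hQl] at ha2 hb2 hc2 ha3 hb3 hc3
  have inj : ∀ {x y : Fin n}, x ∈ P.support → x ≠ y → P.support.idxOf x ≠ P.support.idxOf y :=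
    fun hx hxy h => hxy ((List.idxOf_inj hx).1 h)
  have h1 := inj ha1 hab
  have h2 := inj ha1 hac
  have h3 := inj hb1 hbc
  -- Of three common vertices, the middle one in the order of the first path lies strictly between
  -- two common vertices, so it cannot be a branching. The cases below run through the possible
  -- orders.
  have key : ∀ {x z y : Fin n}, P.support.idxOf x < P.support.idxOf z →
      P.support.idxOf z < P.support.idxOf y → y ∈ P.support → x ∈ Q.support → y ∈ Q.support →
      s(predOf P.support z, succOf P.support z) ≠ s(predOf Q.support z, succOf Q.support z) →
      False := fun h1 h2 h3 h4 h5 h6 => h6 (hP.neighbours_eq hQ h1 h2 h3 h4 h5)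
  rcases lt_or_gt_of_ne h1 with h1 | h1 <;> rcases lt_or_gt_of_ne h2 with h2 | h2 <;>
    rcases lt_or_gt_of_ne h3 with h3 | h3
  · exact key h1 h3 hc1 ha2 hc2 hb3
  · exact key h2 h3 hb1 ha2 hb2 hc3
  · exact absurd (h1.trans h3) h2.asymm
  · exact key h2 h1 hb1 hc2 hb2 ha3
  · exact key h1 h2 hc1 hb2 hc2 ha3
  · exact absurd (h2.trans h3) h1.asymm
  · exact key h3 h2 ha1 hb2 ha2 hc3
  · exact key h3 h1 ha1 hc2 ha2 hb3

end Neighbours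

end PathOracle

/-! ### Cost and correctness of the ball searches; nearest landmarks. -/

namespace PathOracle

noncomputable section

/-! ### Step counts of composed computations -/

namespace Timed

@[simp] lemma val_bind {α β : Type} (x : Timed α) (f : α → Timed β) :
    (x >>= f).val = (f x.val).val := rfl

@[simp] lemma steps_bind {α β : Type} (x : Timed α) (f : α → Timed β) :
    (x >>= f).steps = x.steps + (f x.val).steps := rfl

@[simp] lemma val_pure {α : Type} (a : α) : (pure a : Timed α).val = a := rfl

@[simp] lemma steps_pure {α : Type} (a : α) : (pure a : Timed α).steps = 0 := rfl

@[simp] lemma steps_tick : tick.steps = 1 := rfl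

end Timed

@[simp] lemma Table.val_get {K X : Type} (t : Table K X) (k : K) : (t.get k).val = t k := rfl

@[simp] lemma Table.steps_get {K X : Type} (t : Table K X) (k : K) : (t.get k).steps = 1 := rfl

/-! ### Leftist heaps -/

namespace Heap

variable {n : ℕ}

/-- The items of a heap. -/
def items : Heap n → List (QItem n)
  | nil => []
  | node _ a l r => a :: (l.items ++ r.items)

/-- Heap order and the leftist condition on the ranks. -/
def Good : Heap n → Prop
  | nil => True
  | node k a l r => k = r.rank + 1 ∧ r.rank ≤ l.rank ∧ (∀ b ∈ l.items, a.dist ≤ b.dist) ∧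
      (∀ b ∈ r.items, a.dist ≤ b.dist) ∧ l.Good ∧ r.Good

@[simp] lemma rank_node (k : ℕ) (a : QItem n) (l r : Heap n) : (node k a l r).rank = k := rfl

@[simp] lemma rank_nil : (nil : Heap n).rank = 0 := rfl

/-- The left subtree has at least the rank of the right one, so each unit of rank doubles the size.
This is what makes a merge logarithmic. -/
lemma two_pow_rank_le {s : Heap n} (h : s.Good) : 2 ^ s.rank ≤ s.items.length + 1 := by
  induction s with
  | nil => simp [rank]
  | node k a l r ihl ihr =>
    obtain ⟨rfl, h2, -, -, hl, hr⟩ := h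
    have h3 := ihl hl
    have h4 := ihr hr
    have h5 : 2 ^ r.rank ≤ 2 ^ l.rank := Nat.pow_le_pow_right (by norm_num) h2
    simp only [rank_node, items, List.length_cons, List.length_append, pow_succ]
    omega

lemma rank_le_log {s : Heap n} (h : s.Good) {M : ℕ} (hM : s.items.length ≤ M) :
    s.rank ≤ Nat.log 2 (M + 1) :=
  Nat.le_log_of_pow_le (by norm_num) ((two_pow_rank_le h).trans (by omega))

lemma items_join (a : QItem n) (s t : Heap n) :
    (join a s t).items.Perm (a :: (s.items ++ t.items)) := by
  unfold join
  split
  · exact List.Perm.refl _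
  · exact List.Perm.cons _ List.perm_append_comm

lemma good_join {a : QItem n} {s t : Heap n} (hs : s.Good) (ht : t.Good)
    (has : ∀ b ∈ s.items, a.dist ≤ b.dist) (hat : ∀ b ∈ t.items, a.dist ≤ b.dist) :
    (join a s t).Good := by
  unfold join
  split
  · exact ⟨rfl, by assumption, has, hat, hs, ht⟩
  · exact ⟨rfl, by omega, hat, has, ht, hs⟩

/-- Every recursive call moves one step down a right spine, and the length of a right spine is the
stored rank. -/
lemma merge_spec : ∀ s t : Heap n, s.Good → t.Good →
    (merge s t).val.Good ∧ (merge s t).val.items.Perm (s.items ++ t.items) ∧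
      (merge s t).steps ≤ s.rank + t.rank + 1
  | nil, t, _, ht => by
    rw [merge]
    exact ⟨ht, List.Perm.refl _, by simp⟩
  | node k a l r, nil, hs, _ => by
    rw [merge]
    exact ⟨hs, by simp [items], by simp⟩
  | node k a l r, node k' a' l' r', hs, ht => by
    rw [merge]
    have hs' := hs
    have ht' := ht
    obtain ⟨hk, hr, hal, har, hgl, hgr⟩ := hs'
    obtain ⟨hk', hr', hal', har', hgl', hgr'⟩ := ht'
    by_cases hd : a.dist ≤ a'.dist
    · obtain ⟨h1, h2, h3⟩ := merge_spec r (node k' a' l' r') hgr ht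
      simp only [Timed.val_bind, Timed.steps_bind, hd, if_true, Timed.val_pure, Timed.steps_pure,
        Timed.steps_tick]
      refine ⟨good_join hgl h1 hal fun b hb => ?_, (items_join _ _ _).trans ?_, ?_⟩
      · rw [h2.mem_iff, List.mem_append] at hb
        rcases hb with hb | hb
        · exact har b hb
        · simp only [items, List.mem_cons, List.mem_append] at hb
          rcases hb with rfl | hb | hb
          · exact hd
          · exact hd.trans (hal' b hb)
          · exact hd.trans (har' b hb)
      · refine (List.Perm.cons _ (h2.append_left _)).trans ?_
        simp [items]
      · simp only [rank_node] at h3 ⊢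
        omega
    · obtain ⟨h1, h2, h3⟩ := merge_spec (node k a l r) r' hs hgr'
      simp only [Timed.val_bind, Timed.steps_bind, hd, if_false, Timed.val_pure, Timed.steps_pure,
        Timed.steps_tick]
      have hd' := (not_le.1 hd).le
      refine ⟨good_join hgl' h1 hal' fun b hb => ?_, (items_join _ _ _).trans ?_, ?_⟩
      · rw [h2.mem_iff, List.mem_append] at hb
        rcases hb with hb | hb
        · simp only [items, List.mem_cons, List.mem_append] at hb
          rcases hb with rfl | hb | hb
          · exact hd'
          · exact hd'.trans (hal b hb)
          · exact hd'.trans (har b hb)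
        · exact har' b hb
      · refine (List.Perm.cons _ (h2.append_left _)).trans ?_
        rw [← List.append_assoc]
        refine List.Perm.trans ?_ List.perm_middle.symm
        refine List.Perm.cons _ ?_
        rw [← List.append_assoc]
        exact List.Perm.append_right _ List.perm_append_comm
      · simp only [rank_node] at h3 ⊢
        omega
termination_by s t => s.size + t.size
decreasing_by
  all_goals simp only [size]; omega

lemma insert_spec (a : QItem n) {s : Heap n} (hs : s.Good) :
    (insert a s).val.Good ∧ (insert a s).val.items.Perm (a :: s.items) ∧
      (insert a s).steps ≤ s.rank + 2 := by
  obtain ⟨h1, h2, h3⟩ := merge_spec (node 1 a nil nil) s (by simp [Good, rank, items]) hs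
  refine ⟨h1, ?_, h3.trans ?_⟩
  · exact h2.trans (by simp [items])
  · simp only [rank_node]
    omega

end Heap

/-! ### Truncated Dijkstra searches -/

section Dijkstra

variable {n : ℕ} {G : SimpleGraph (Fin n)} {w : Sym2 (Fin n) → ℝ≥0}

lemma mem_adjList {x y : Fin n} {e : ℝ≥0} :
    (y, e) ∈ adjList G w x ↔ G.Adj x y ∧ e = w s(x, y) := by
  classical
  simp only [adjList, List.mem_insertionSort, List.mem_map, List.mem_filter, List.mem_finRange,
    true_and, decide_eq_true_eq, Prod.mk.injEq]
  constructor
  · rintro ⟨z, hz, rfl, rfl⟩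
    exact ⟨hz, rfl⟩
  · rintro ⟨h, rfl⟩
    exact ⟨y, h, rfl, rfl⟩

lemma pairwise_adjList (x : Fin n) : (adjList G w x).Pairwise fun a b => a.2 ≤ b.2 := by
  have h1 : Std.Total (fun a b : Fin n × ℝ≥0 => a.2 ≤ b.2) := ⟨fun a b => le_total a.2 b.2⟩
  have h2 : IsTrans (Fin n × ℝ≥0) (fun a b => a.2 ≤ b.2) := ⟨fun a b c => le_trans⟩
  exact List.pairwise_insertionSort _ _

lemma nodup_adjList (x : Fin n) : (adjList G w x).Nodup := by
  classical
  refine (List.perm_insertionSort _ _).nodup_iff.2 ?_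
  refine List.Nodup.map (fun a b h => (Prod.ext_iff.1 h).1) ?_
  exact (List.nodup_finRange n).filter _

open Classical in
/-- The edges of `x` that lead to a tentative distance below `R`. -/
def relaxed (G : SimpleGraph (Fin n)) (w : Sym2 (Fin n) → ℝ≥0) (R : ℝ≥0∞) (s x : Fin n) :
    List (Fin n × ℝ≥0) :=
  (adjList G w x).filter fun a => decide (gdist G w s x + a.2 < R)

lemma mem_relaxed {R : ℝ≥0∞} {s x y : Fin n} {e : ℝ≥0} :
    (y, e) ∈ relaxed G w R s x ↔ G.Adj x y ∧ e = w s(x, y) ∧ gdist G w s x + e < R := by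
  simp [relaxed, mem_adjList, and_assoc]

open Classical in
lemma length_relaxed (R : ℝ≥0∞) (s x : Fin n) :
    (relaxed G w R s x).length =
      (Finset.univ.filter fun y => G.Adj x y ∧ gdist G w s x + w s(x, y) < R).card := by
  have hnd : (relaxed G w R s x).Nodup := (nodup_adjList x).filter _
  rw [← List.toFinset_card_of_nodup hnd]
  refine Finset.card_bij (fun a _ => a.1) ?_ ?_ ?_
  · rintro ⟨y, e⟩ ha
    rw [List.mem_toFinset, mem_relaxed] at ha
    obtain ⟨h1, rfl, h2⟩ := ha
    simp [h1, h2]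
  · rintro ⟨y, e⟩ ha ⟨y', e'⟩ ha' h
    rw [List.mem_toFinset, mem_relaxed] at ha ha'
    simp only at h
    subst h
    rw [ha.2.1, ha'.2.1]
  · intro y hy
    rw [Finset.mem_filter] at hy
    exact ⟨(y, w s(x, y)), by rw [List.mem_toFinset, mem_relaxed]; exact ⟨hy.2.1, rfl, hy.2.2⟩, rfl⟩

lemma length_relaxed_le (R : ℝ≥0∞) (s x : Fin n) : (relaxed G w R s x).length ≤ n := by
  classical
  rw [length_relaxed]
  exact (Finset.card_le_univ _).trans (by simp)

open Classical in
-- Since the list is sorted by weight, the edges that stay below the radius form a prefix. Edges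
-- leaving the ball therefore cost a single failed test, the final `+ 1`, and not one step each. `M`
-- bounds the heap size throughout the scan, so that one logarithm serves all insertions.
lemma scan_spec {r : Option ℝ≥0} {R : ℝ≥0∞} (hr : ∀ d : ℝ≥0, below d r ↔ (d : ℝ≥0∞) < R)
    (d : ℝ≥0) (x : Fin n) {M : ℕ} (l : List (Fin n × ℝ≥0))
    (hl : l.Pairwise fun a b => a.2 ≤ b.2) (H : Heap n) (hH : H.Good)
    (hM : H.items.length + (l.filter fun a => decide ((d : ℝ≥0∞) + a.2 < R)).length ≤ M) :
    (scan r d x l H).val.Good ∧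
    (scan r d x l H).val.items.Perm
      (((l.filter fun a => decide ((d : ℝ≥0∞) + a.2 < R)).map fun a => ⟨d + a.2, a.1, x⟩) ++
        H.items) ∧
    (scan r d x l H).steps ≤
      (l.filter fun a => decide ((d : ℝ≥0∞) + a.2 < R)).length * (Nat.log 2 (M + 1) + 3) + 1 := by
  induction l generalizing H with
  | nil => simp [scan, hH]
  | cons a l ih =>
    obtain ⟨y, e⟩ := a
    rw [List.pairwise_cons] at hl
    by_cases hb : below (d + e) r
    · have hb' : (d : ℝ≥0∞) + e < R := by exact_mod_cast (hr _).1 hb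
      obtain ⟨h1, h2, h3⟩ := Heap.insert_spec ⟨d + e, y, x⟩ hH
      have hlen := h2.length_eq
      simp only [List.length_cons] at hlen
      have hrank := Heap.rank_le_log hH (M := M) (by omega)
      rw [List.filter_cons_of_pos (by simpa using hb')] at hM ⊢
      simp only [List.length_cons] at hM
      obtain ⟨h4, h5, h6⟩ := ih hl.2 (Heap.insert ⟨d + e, y, x⟩ H).val h1 (by omega)
      rw [scan]
      simp only [Timed.val_bind, Timed.steps_bind, hb, if_true, Timed.steps_tick, List.map_cons,
        List.length_cons, List.cons_append]
      refine ⟨h4, h5.trans ((h2.append_left _).trans List.perm_middle), ?_⟩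
      nlinarith
    · have hnil : ((y, e) :: l).filter (fun a => decide ((d : ℝ≥0∞) + a.2 < R)) = [] := by
        have hb' : R ≤ (d : ℝ≥0∞) + e := by
          have := mt (hr _).2 hb
          push_cast at this
          exact not_lt.1 this
        rw [List.filter_eq_nil_iff]
        intro a ha
        simp only [decide_eq_true_eq, not_lt]
        rw [List.mem_cons] at ha
        rcases ha with rfl | ha
        · exact hb'
        · refine hb'.trans ?_
          gcongr
          exact hl.1 a ha
      rw [hnil, scan]
      simp [hb, hH]

/-- The pointers of a search from `s` lead backwards along shortest paths. -/
def Pointers (G : SimpleGraph (Fin n)) (w : Sym2 (Fin n) → ℝ≥0) (s : Fin n)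
    (seen : Table (Fin n) (Fin n)) : Prop :=
  ∀ x y, seen y = some x → gdist G w s y ≠ ⊤ ∧ (y = s ∨ (seen x ≠ none ∧ G.Adj x y ∧
    gdist G w s y = gdist G w s x + w s(x, y)))

/-- The state of a search from `s` in the ball of radius `R`. -/
structure Searching (G : SimpleGraph (Fin n)) (w : Sym2 (Fin n) → ℝ≥0) (R : ℝ≥0∞) (s : Fin n)
    (H : Heap n) (seen : Table (Fin n) (Fin n)) : Prop where
  good : H.Good
  lt : ∀ a ∈ H.items, (a.dist : ℝ≥0∞) < R
  item : ∀ a ∈ H.items, a = ⟨0, s, s⟩ ∨ (seen a.pred ≠ none ∧ G.Adj a.pred a.vtx ∧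
    (a.dist : ℝ≥0∞) = gdist G w s a.pred + w s(a.pred, a.vtx))
  source : seen s = none → ⟨0, s, s⟩ ∈ H.items
  frontier : ∀ x y, seen x ≠ none → seen y = none → G.Adj x y →
    gdist G w s x + w s(x, y) < R →
      ∃ a ∈ H.items, a.vtx = y ∧ (a.dist : ℝ≥0∞) ≤ gdist G w s x + w s(x, y)
  pointers : Pointers G w s seen

namespace Searching

variable {R : ℝ≥0∞} {s : Fin n} {H : Heap n} {seen : Table (Fin n) (Fin n)}

/-- A walk from a seen to an unseen vertex has a first edge that leaves the seen set, and `frontier`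
supplies an item for it. The hypothesis `hR` ensures that this edge was not cut off by the radius.
-/
lemma exists_item_of_walk (h : Searching G w R s H seen) {x y : Fin n} (p : G.Walk x y)
    (hx : seen x ≠ none) (hy : seen y = none) (hR : gdist G w s x + wlen w p < R) :
    ∃ a ∈ H.items, (a.dist : ℝ≥0∞) ≤ gdist G w s x + wlen w p := by
  induction p with
  | nil => exact absurd hy hx
  | cons hadj p ih =>
    rename_i x x' y
    simp only [wlen_cons, ENNReal.coe_add] at hR ⊢
    rw [← add_assoc] at hR ⊢
    by_cases hx' : seen x' = none
    · obtain ⟨a, h1, -, h3⟩ := h.frontier x x' hx hx' hadj (le_self_add.trans_lt hR)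
      exact ⟨a, h1, h3.trans le_self_add⟩
    · have hle : gdist G w s x' ≤ gdist G w s x + w s(x, x') :=
        (gdist_triangle s x x').trans (by gcongr; exact gdist_le_of_adj hadj)
      have hle' : gdist G w s x' + wlen w p ≤ gdist G w s x + w s(x, x') + wlen w p := by gcongr
      obtain ⟨a, h1, h2⟩ := ih hx' hy (hle'.trans_lt hR)
      exact ⟨a, h1, h2.trans hle'⟩

lemma exists_item (h : Searching G w R s H seen) {y : Fin n} (hy : seen y = none)
    (hR : gdist G w s y < R) : ∃ a ∈ H.items, (a.dist : ℝ≥0∞) ≤ gdist G w s y := by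
  by_cases hs : seen s = none
  · exact ⟨_, h.source hs, by simp⟩
  · obtain ⟨p, hp⟩ := exists_isCanon (w := w) (gdist_ne_top_iff.1 (ne_top_of_lt hR))
    have := h.exists_item_of_walk p hs hy (by simpa [hp.gdist_eq] using hR)
    simpa [hp.gdist_eq] using this

variable {k : ℕ} {a : QItem n} {l r : Heap n}

/-- The correctness of Dijkstra's rule: no item underestimates its vertex, some item is at most the
true distance of the unseen vertex `a.vtx`, and the root is minimal in the heap. -/
lemma dist_eq (h : Searching G w R s (.node k a l r) seen) (ha : seen a.vtx = none) :
    (a.dist : ℝ≥0∞) = gdist G w s a.vtx := by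
  have hmem : a ∈ (Heap.node k a l r).items := by simp [Heap.items]
  have hge : gdist G w s a.vtx ≤ a.dist := by
    rcases h.item a hmem with h1 | ⟨-, h1, h2⟩
    · rw [h1]
      simp
    · rw [h2]
      refine (gdist_triangle s a.pred a.vtx).trans ?_
      gcongr
      exact gdist_le_of_adj h1
  refine le_antisymm ?_ hge
  obtain ⟨b, hb, hle⟩ := h.exists_item ha (hge.trans_lt (h.lt a hmem))
  refine le_trans ?_ hle
  obtain ⟨-, -, h1, h2, -, -⟩ := h.good
  simp only [Heap.items, List.mem_cons, List.mem_append] at hb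
  rcases hb with rfl | hb | hb
  · exact le_rfl
  · exact_mod_cast h1 b hb
  · exact_mod_cast h2 b hb

lemma mem_merge (h : Searching G w R s (.node k a l r) seen) {b : QItem n} :
    b ∈ (Heap.merge l r).val.items ↔ b ∈ l.items ∨ b ∈ r.items := by
  rw [(Heap.merge_spec l r h.good.2.2.2.2.1 h.good.2.2.2.2.2).2.1.mem_iff, List.mem_append]

/-- An item that belongs to a vertex found before is dropped. -/
lemma drop (h : Searching G w R s (.node k a l r) seen) (ha : seen a.vtx ≠ none) :
    Searching G w R s (Heap.merge l r).val seen where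
  good := (Heap.merge_spec l r h.good.2.2.2.2.1 h.good.2.2.2.2.2).1
  lt b hb := h.lt b (by rw [h.mem_merge] at hb; simp [Heap.items, hb])
  item b hb := h.item b (by rw [h.mem_merge] at hb; simp [Heap.items, hb])
  source hs := by
    rw [h.mem_merge]
    have := h.source hs
    simp only [Heap.items, List.mem_cons, List.mem_append] at this
    refine this.resolve_left ?_
    rintro rfl
    exact ha hs
  frontier x y hx hy hadj hR := by
    obtain ⟨b, hb, h1, h2⟩ := h.frontier x y hx hy hadj hR
    refine ⟨b, ?_, h1, h2⟩
    rw [h.mem_merge]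
    simp only [Heap.items, List.mem_cons, List.mem_append] at hb
    refine hb.resolve_left ?_
    rintro rfl
    exact ha (h1 ▸ hy)
  pointers := h.pointers

lemma pointers_update (h : Searching G w R s (.node k a l r) seen) (ha : seen a.vtx = none) :
    Pointers G w s (Function.update seen a.vtx (some a.pred)) := by
  have hmem : a ∈ (Heap.node k a l r).items := by simp [Heap.items]
  intro x y hxy
  by_cases hy : y = a.vtx
  · subst hy
    simp only [Function.update_self, Option.some.injEq] at hxy
    subst hxy
    refine ⟨?_, ?_⟩
    · rw [← h.dist_eq ha]
      exact ENNReal.coe_ne_top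
    · rcases h.item a hmem with h1 | ⟨h1, h2, h3⟩
      · exact Or.inl (by rw [h1])
      · refine Or.inr ⟨?_, h2, by rw [← h.dist_eq ha, h3]⟩
        rw [Function.update_of_ne]
        · exact h1
        · exact h2.ne
  · rw [Function.update_of_ne hy] at hxy
    obtain ⟨h1, h2⟩ := h.pointers x y hxy
    refine ⟨h1, h2.imp_right fun ⟨h3, h4⟩ => ⟨?_, h4⟩⟩
    rw [Function.update_of_ne]
    · exact h3
    · rintro rfl
      exact h3 ha

/-- The next vertex is found, and its edges are relaxed. -/
lemma step (h : Searching G w R s (.node k a l r) seen) (ha : seen a.vtx = none) {H' : Heap n}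
    (hg : H'.Good)
    (hH' : H'.items.Perm (((relaxed G w R s a.vtx).map fun b => ⟨a.dist + b.2, b.1, a.vtx⟩) ++
      (Heap.merge l r).val.items)) :
    Searching G w R s H' (Function.update seen a.vtx (some a.pred)) := by
  have hmem : ∀ b, b ∈ H'.items ↔ (∃ y e, (y, e) ∈ relaxed G w R s a.vtx ∧
      b = ⟨a.dist + e, y, a.vtx⟩) ∨ b ∈ l.items ∨ b ∈ r.items := by
    intro b
    rw [hH'.mem_iff, List.mem_append, h.mem_merge, List.mem_map]
    refine or_congr_left ?_
    constructor
    · rintro ⟨⟨y, e⟩, h1, rfl⟩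
      exact ⟨y, e, h1, rfl⟩
    · rintro ⟨y, e, h1, rfl⟩
      exact ⟨(y, e), h1, rfl⟩
  have hdist := h.dist_eq ha
  refine ⟨hg, ?_, ?_, ?_, ?_, h.pointers_update ha⟩
  · intro b hb
    rw [hmem] at hb
    rcases hb with ⟨y, e, h1, rfl⟩ | hb
    · rw [mem_relaxed] at h1
      push_cast
      rw [hdist]
      exact h1.2.2
    · exact h.lt b (by simp [Heap.items, hb])
  · intro b hb
    rw [hmem] at hb
    rcases hb with ⟨y, e, h1, rfl⟩ | hb
    · rw [mem_relaxed] at h1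
      right
      simp only [Function.update_self]
      refine ⟨by simp, h1.1, ?_⟩
      push_cast
      rw [hdist, h1.2.1]
    · refine (h.item b (by simp [Heap.items, hb])).imp_right fun ⟨h1, h2⟩ => ⟨?_, h2⟩
      rw [Function.update_of_ne]
      · exact h1
      · intro heq
        exact h1 (heq ▸ ha)
  · intro hs
    have hne : s ≠ a.vtx := by
      rintro rfl
      simp at hs
    rw [Function.update_of_ne hne] at hs
    have := h.source hs
    rw [hmem]
    right
    simp only [Heap.items, List.mem_cons, List.mem_append] at this
    refine this.resolve_left ?_
    rintro rfl
    exact hne rfl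
  · intro x y hx hy hadj hR
    have hne : y ≠ a.vtx := by
      rintro rfl
      simp at hy
    rw [Function.update_of_ne hne] at hy
    by_cases hxa : x = a.vtx
    · subst hxa
      refine ⟨⟨a.dist + w s(a.vtx, y), y, a.vtx⟩, ?_, rfl, ?_⟩
      · rw [hmem]
        exact Or.inl ⟨y, _, mem_relaxed.2 ⟨hadj, rfl, hR⟩, rfl⟩
      · push_cast
        rw [hdist]
    · rw [Function.update_of_ne hxa] at hx
      obtain ⟨b, hb, h1, h2⟩ := h.frontier x y hx hy hadj hR
      refine ⟨b, ?_, h1, h2⟩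
      rw [hmem]
      right
      simp only [Heap.items, List.mem_cons, List.mem_append] at hb
      refine hb.resolve_left ?_
      rintro rfl
      exact hne h1.symm

end Searching

open Classical in
/-- The number of edges that remain to be relaxed. -/
def remaining (G : SimpleGraph (Fin n)) (w : Sym2 (Fin n) → ℝ≥0) (R : ℝ≥0∞) (s : Fin n)
    (seen : Table (Fin n) (Fin n)) : ℕ :=
  ∑ x with seen x = none, (relaxed G w R s x).length

lemma remaining_update {R : ℝ≥0∞} {s z p : Fin n} {seen : Table (Fin n) (Fin n)}
    (hz : seen z = none) :
    remaining G w R s seen = (relaxed G w R s z).length +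
      remaining G w R s (Function.update seen z (some p)) := by
  classical
  unfold remaining
  rw [← Finset.add_sum_erase _ _ (a := z) (by simp [hz])]
  congr 1
  refine Finset.sum_congr ?_ fun _ _ => rfl
  ext x
  by_cases hx : x = z
  · simp [hx]
  · simp [hx]

/-- The step bound is a potential. Removing an item costs at most `2 log + 4`: the merge, the loop
overhead, and the last step of a scan. An edge not yet relaxed carries `3 log + 7`, of which `log +
3` pays for its insertion and the rest stays with the new item. The sum of items and unrelaxed edges
drops in every round, so the counter does not run out. -/
lemma explore_spec {r : Option ℝ≥0} {R : ℝ≥0∞} {s : Fin n}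
    (hr : ∀ d : ℝ≥0, below d r ↔ (d : ℝ≥0∞) < R) (target : Fin n) {M : ℕ} (k : ℕ) :
    ∀ (H : Heap n) (seen : Table (Fin n) (Fin n)), Searching G w R s H seen →
    seen target = none → H.items.length + remaining G w R s seen < k →
    H.items.length + remaining G w R s seen ≤ M →
    ((gdist G w s target < R ∧ ∃ seen', (explore (adjList G w) r target k H seen).val = some seen' ∧
        Pointers G w s seen' ∧ seen' target ≠ none) ∨
      (R ≤ gdist G w s target ∧ (explore (adjList G w) r target k H seen).val = none)) ∧
    (explore (adjList G w) r target k H seen).steps ≤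
      H.items.length * (2 * Nat.log 2 (M + 1) + 4) +
        remaining G w R s seen * (3 * Nat.log 2 (M + 1) + 7) + 1 := by
  induction k with
  | zero => intro H seen _ _ h; omega
  | succ k ih =>
    intro H seen hS ht hk hM
    cases H with
    | nil =>
      refine ⟨Or.inr ⟨?_, rfl⟩, by simp [explore]⟩
      by_contra! hlt
      obtain ⟨a, ha, -⟩ := hS.exists_item ht hlt
      simp [Heap.items] at ha
    | node m a lh rh =>
      obtain ⟨h1, h2, h3⟩ := Heap.merge_spec lh rh hS.good.2.2.2.2.1 hS.good.2.2.2.2.2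
      have hlen := h2.length_eq
      simp only [List.length_append] at hlen
      simp only [Heap.items, List.length_cons, List.length_append] at hk hM ⊢
      have hrl := Heap.rank_le_log hS.good.2.2.2.2.1 (M := M) (by omega)
      have hrr := Heap.rank_le_log hS.good.2.2.2.2.2 (M := M) (by omega)
      rw [explore]
      simp only [Timed.val_bind, Timed.steps_bind, Timed.steps_tick, Table.val_get, Table.steps_get]
      cases hseen : seen a.vtx with
      | some p =>
        obtain ⟨h4, h5⟩ := ih _ seen (hS.drop (by simp [hseen])) ht (by omega) (by omega)
        refine ⟨h4, ?_⟩
        rw [hlen] at h5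
        simp only
        nlinarith
      | none =>
        simp only
        split
        · rename_i heq
          refine ⟨Or.inl ⟨?_, _, rfl, ?_, ?_⟩, ?_⟩
          · rw [← heq, ← hS.dist_eq hseen]
            exact hS.lt a (by simp [Heap.items])
          · exact hS.pointers_update hseen
          · rw [← heq]
            simp
          · simp only [Timed.steps_pure]
            nlinarith
        · rename_i hne
          have hrem := remaining_update (G := G) (w := w) (R := R) (s := s) (p := a.pred) hseen
          obtain ⟨h4, h5, h6⟩ := scan_spec (M := M) hr a.dist a.vtx (adjList G w a.vtx)
            (pairwise_adjList _) (Heap.merge lh rh).val h1 (by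
              rw [hS.dist_eq hseen, hlen]
              change _ + (relaxed G w R s a.vtx).length ≤ M
              omega)
          rw [hS.dist_eq hseen] at h5 h6
          change _ ≤ (relaxed G w R s a.vtx).length * _ + 1 at h6
          have hlen' := h5.length_eq
          simp only [List.length_append, List.length_map] at hlen'
          change _ = (relaxed G w R s a.vtx).length + _ at hlen'
          have hne' : target ≠ a.vtx := fun h => hne h.symm
          obtain ⟨h7, h8⟩ := ih _ (Function.update seen a.vtx (some a.pred))
            (hS.step hseen h4 h5)
            (by rw [Function.update_of_ne hne', ht]) (by omega) (by omega)
          refine ⟨h7, ?_⟩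
          simp only [Timed.steps_bind]
          rw [hlen', hlen] at h8
          rw [hrem]
          nlinarith

open Classical in
-- Positive weights make the distance to `s` fall strictly along the pointers, so the number of
-- vertices nearer to `s` bounds the number of rounds. The walk `q` is the part already traced;
-- stating the cost relative to its length makes the induction additive.
lemma traceBack_spec (hw : ∀ e ∈ G.edgeSet, 0 < w e) {s target : Fin n}
    {seen : Table (Fin n) (Fin n)} (hp : Pointers G w s seen) (k : ℕ) :
    ∀ (x : Fin n) (q : G.Walk x target), seen x ≠ none →
    (Finset.univ.filter fun y => gdist G w s y < gdist G w s x).card < k →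
    ∃ p : G.Walk s target, (traceBack seen s k x q.support).val = some p.support ∧
      (wlen w p : ℝ≥0∞) = gdist G w s x + wlen w q ∧
      (traceBack seen s k x q.support).steps + 2 * q.length ≤ 2 * p.length + 1 := by
  induction k with
  | zero => intro x q _ h; omega
  | succ k ih =>
    intro x q hx hk
    rw [traceBack]
    by_cases hxs : x = s
    · subst hxs
      refine ⟨q, ?_⟩
      simp
      omega
    · simp only [Timed.val_bind, Timed.steps_bind, Timed.steps_tick, Table.val_get, Table.steps_get,
        hxs, if_false]
      obtain ⟨y, hy⟩ := Option.ne_none_iff_exists'.1 hx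
      obtain ⟨htop, h1⟩ := hp y x hy
      obtain ⟨hy1, hadj, hdist⟩ := h1.resolve_left hxs
      have hpos : (0 : ℝ≥0∞) < w s(y, x) := by exact_mod_cast hw _ hadj
      have hlt : gdist G w s y < gdist G w s x := by
        rw [hdist]
        refine ENNReal.lt_add_right ?_ hpos.ne'
        intro htop'
        rw [htop'] at hdist
        exact htop (by simp [hdist])
      have hcard : (Finset.univ.filter fun z => gdist G w s z < gdist G w s y).card <
          (Finset.univ.filter fun z => gdist G w s z < gdist G w s x).card := by
        refine Finset.card_lt_card ⟨fun z hz => ?_, fun hsub => ?_⟩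
        · simp only [Finset.mem_filter, Finset.mem_univ, true_and] at hz ⊢
          exact hz.trans hlt
        · have := hsub (Finset.mem_filter.2 ⟨Finset.mem_univ y, hlt⟩)
          simp at this
      obtain ⟨p, h2, h3, h4⟩ := ih y (.cons hadj q) hy1 (by omega)
      simp only [SimpleGraph.Walk.support_cons, SimpleGraph.Walk.length_cons] at h2 h4
      refine ⟨p, ?_, ?_, ?_⟩
      · rw [hy]
        exact h2
      · rw [h3, hdist, wlen_cons]
        push_cast
        rw [add_assoc]
      · rw [hy]
        simp only
        omega

/-- The number of edges relaxed by a search, counted from both sides. -/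
def ballEdges (G : SimpleGraph (Fin n)) (w : Sym2 (Fin n) → ℝ≥0) (R : ℝ≥0∞) (s : Fin n) : ℕ :=
  ∑ x, (relaxed G w R s x).length

/-- A bound for the number of steps of a search. -/
def searchCost (F : ℕ) : ℕ := 2 * Nat.log 2 (F + 2) + 8 + F * (3 * Nat.log 2 (F + 2) + 7)

/-! ### Nearest landmarks -/

variable {L : Set (Fin n)}

lemma exists_radius_eq {v : Fin n} (h : radius G w L v ≠ ⊤) :
    ∃ l ∈ L, gdist G w v l = radius G w L v := by
  classical
  have hne : L.Nonempty := by
    by_contra hn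
    rw [Set.not_nonempty_iff_eq_empty] at hn
    exact h (by simp [radius, hn])
  obtain ⟨l, hl, hmin⟩ := Set.exists_min_image L (gdist G w v) (Set.toFinite L) hne
  exact ⟨l, hl, le_antisymm (le_iInf₂ hmin) (iInf₂_le l hl)⟩

lemma radius_le {v l : Fin n} (hl : l ∈ L) : radius G w L v ≤ gdist G w v l := iInf₂_le l hl

lemma nearest_spec {v l : Fin n} (h : nearest G w L v = some l) :
    l ∈ L ∧ gdist G w v l ≠ ⊤ ∧ gdist G w v l = radius G w L v := by
  have := List.find?_some h
  simpa using this

lemma nearest_eq_none_iff {v : Fin n} : nearest G w L v = none ↔ radius G w L v = ⊤ := by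
  constructor
  · intro h
    by_contra hn
    obtain ⟨l, hl, heq⟩ := exists_radius_eq hn
    have := List.find?_eq_none.1 h l (List.mem_finRange l)
    simp only [decide_eq_true_eq, not_and] at this
    exact this hl (heq ▸ hn) heq
  · intro h
    rw [nearest, List.find?_eq_none]
    rintro l - hl
    simp only [decide_eq_true_eq] at hl
    exact hl.2.1 (hl.2.2.trans h)

lemma below_forest_iff (v : Fin n) (d : ℝ≥0) :
    below d ((mkForest G w L v).map TreeEntry.dist) ↔ (d : ℝ≥0∞) < radius G w L v := by
  cases h : nearest G w L v with
  | none =>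
    rw [nearest_eq_none_iff.1 h]
    simp only [below, mkForest, h, Option.map_none]
    exact ⟨fun _ => ENNReal.coe_lt_top, fun _ x hx => by cases hx⟩
  | some l =>
    obtain ⟨-, h1, h2⟩ := nearest_spec h
    simp only [below, mkForest, h, Option.map_some, Option.mem_def, Option.some.injEq, forall_eq']
    rw [← h2, ← ENNReal.coe_lt_coe, ENNReal.coe_toNNReal h1]

lemma ballSearch_spec (hw : ∀ e ∈ G.edgeSet, 0 < w e) {h : ℕ} (hh : 1 ≤ h)
    (L : ℕ → Set (Fin n)) (u v : Fin n) :
    (∃ p : G.Walk u v, (ballSearch (mkOracle G w h L) u v).val = some p.support ∧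
      (wlen w p : ℝ≥0∞) = gdist G w u v ∧
      (ballSearch (mkOracle G w h L) u v).steps ≤
        searchCost (ballEdges G w (radius G w (L 1) u) u) + 2 * p.length) ∨
    ((ballSearch (mkOracle G w h L) u v).val = none ∧ radius G w (L 1) u ≤ gdist G w u v ∧
      (ballSearch (mkOracle G w h L) u v).steps ≤
        searchCost (ballEdges G w (radius G w (L 1) u) u)) := by
  classical
  obtain ⟨m, rfl⟩ : ∃ m, h = m + 1 := ⟨h - 1, by omega⟩
  set R := radius G w (L 1) u with hR
  set r := (mkForest G w (L 1) u).map TreeEntry.dist with hr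
  have hbelow : ∀ d : ℝ≥0, below d r ↔ (d : ℝ≥0∞) < R := below_forest_iff u
  set E := explore (adjList G w) r v (n * n + 2) (.node 1 ⟨0, u, u⟩ .nil .nil)
    (fun _ => none) with hE
  set X : Timed (Option (List (Fin n))) :=
    if below 0 r then E >>= fun o => match o with
      | none => pure none
      | some seen => traceBack seen u (n + 1) v [v]
    else pure none with hX
  have hval : ballSearch (mkOracle G w (m + 1) L) u v = ⟨X.val, 1 + (1 + (0 + X.steps))⟩ := by
    rw [ballSearch]
    simp only [mkOracle, List.range_succ_eq_map, List.map_cons]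
    rfl
  rw [hval]
  simp only
  by_cases h0 : below 0 r
  · rw [if_pos h0] at hX
    rw [hX]
    simp only [Timed.val_bind, Timed.steps_bind]
    have hRpos : 0 < R := by simpa using (hbelow 0).1 h0
    have hS : Searching G w R u (.node 1 ⟨0, u, u⟩ .nil .nil) (fun _ => none) := by
      refine ⟨by simp [Heap.Good, Heap.rank, Heap.items], ?_, ?_, ?_, ?_, ?_⟩
      · simp [Heap.items, hRpos]
      · simp [Heap.items]
      · simp [Heap.items]
      · simp
      · intro x y hxy
        simp at hxy
    have hrem : remaining G w R u (fun _ => none) = ballEdges G w R u := by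
      simp [remaining, ballEdges]
    have hF : ballEdges G w R u ≤ n * n := by
      refine (Finset.sum_le_sum fun x _ => length_relaxed_le R u x).trans ?_
      simp
    -- One initial item and at most `n * n` edge relaxations leave the counter `n * n + 2` positive.
    obtain ⟨h1, h2⟩ := explore_spec (M := 1 + ballEdges G w R u) hbelow v (n * n + 2) _ _ hS rfl
      (by simp [Heap.items, hrem]; omega) (by simp [Heap.items, hrem])
    rw [← hE] at h1 h2
    rw [hrem, show 1 + ballEdges G w R u + 1 = ballEdges G w R u + 2 by ring] at h2
    simp only [Heap.items, List.append_nil, List.length_cons, List.length_nil, zero_add,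
      one_mul] at h2
    rcases h1 with ⟨h3, seen', h4, h5, h6⟩ | ⟨h3, h4⟩
    · left
      rw [h4]
      simp only
      have hcard : (Finset.univ.filter fun y => gdist G w u y < gdist G w u v).card < n + 1 :=
        Nat.lt_succ_of_le ((Finset.card_le_univ _).trans (by simp))
      obtain ⟨p, h7, h8, h9⟩ := traceBack_spec hw h5 (n + 1) v .nil h6 hcard
      simp only [SimpleGraph.Walk.support_nil, SimpleGraph.Walk.length_nil, mul_zero,
        add_zero] at h7 h9
      refine ⟨p, h7, by simpa using h8, ?_⟩
      unfold searchCost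
      omega
    · right
      rw [h4]
      refine ⟨rfl, h3, ?_⟩
      simp only [Timed.steps_pure]
      unfold searchCost
      omega
  · right
    rw [if_neg h0] at hX
    rw [hX]
    simp only [Timed.val_pure, Timed.steps_pure, true_and]
    have hR0 : R = 0 := by
      by_contra hne
      exact h0 ((hbelow 0).2 (by simpa using pos_iff_ne_zero.2 hne))
    rw [hR0]
    exact ⟨zero_le, by unfold searchCost; omega⟩

end Dijkstra

end

end PathOracle

/-! ### Correctness, stretch and step count of a query. -/

namespace PathOracle

noncomputable section

/-! ### Climbing in the forests -/

section Climb

variable {n : ℕ} {G : SimpleGraph (Fin n)} {w : Sym2 (Fin n) → ℝ≥0} {L : Set (Fin n)}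

/-- This makes the trees consistent: a landmark that is as near to `y` as `l` is also as near to
`x`, so an earlier competitor for `y` would already have been chosen for `x`. -/
lemma nearest_of_between {x y l : Fin n} (h : nearest G w L x = some l)
    (hd : gdist G w x y + gdist G w y l = gdist G w x l) : nearest G w L y = some l := by
  obtain ⟨hl, htop, hrad⟩ := nearest_spec h
  have hxy : gdist G w x y ≠ ⊤ := ne_top_of_le_ne_top htop (hd ▸ le_self_add)
  have hyl : gdist G w y l ≠ ⊤ := ne_top_of_le_ne_top htop (hd ▸ le_add_self)
  have hrad' : gdist G w y l = radius G w L y := by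
    refine le_antisymm (le_iInf₂ fun l' hl' => ?_) (radius_le hl)
    rw [← ENNReal.add_le_add_iff_left hxy, hd, hrad]
    exact (radius_le hl').trans (gdist_triangle x y l')
  unfold nearest at h ⊢
  rw [List.find?_eq_some_iff_append] at h ⊢
  obtain ⟨-, as, bs, h1, h2⟩ := h
  refine ⟨by simp [hl, ← hrad', hyl], as, bs, h1, fun a ha => ?_⟩
  have h3 := h2 a ha
  simp only [Bool.not_eq_eq_eq_not, Bool.not_true, decide_eq_false_iff_not, not_and] at h3 ⊢
  intro haL hatop harad
  have hxa : gdist G w x a = radius G w L x := by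
    refine le_antisymm ?_ (radius_le haL)
    refine (gdist_triangle x y a).trans ?_
    rw [harad, ← hrad', hd, hrad]
  exact h3 haL (hxa ▸ hrad ▸ htop) hxa

lemma succOf_canonPath {x l : Fin n} (hr : G.Reachable x l) (hne : x ≠ l) :
    ∃ y, succOf (canonPath G w x l) x = some y ∧ G.Adj x y ∧
      gdist G w x l = w s(x, y) + gdist G w y l := by
  obtain ⟨p, hp, hpl⟩ := canonPath_of_reachable w hr
  rw [hpl]
  have hnd := hp.1.support_nodup
  have hd := hp.gdist_eq
  cases p with
  | nil => exact absurd rfl hne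
  | cons hadj q =>
    rename_i y
    rw [SimpleGraph.Walk.support_cons, ← SimpleGraph.Walk.cons_tail_support q] at hnd ⊢
    refine ⟨y, succOf_append (pre := []) hnd, hadj, le_antisymm ?_ ?_⟩
    · exact (gdist_triangle x y l).trans (by gcongr; exact gdist_le_of_adj hadj)
    · rw [hd, wlen_cons]
      push_cast
      gcongr
      exact gdist_le_wlen q

lemma succOf_canonPath_self (x : Fin n) : succOf (canonPath G w x x) x = none := by
  obtain ⟨p, hp, hpl⟩ := canonPath_of_reachable w (SimpleGraph.Reachable.refl (G := G) x)
  rw [hpl, (SimpleGraph.Walk.isPath_iff_nil.1 hp.1).eq_nil]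
  simp [succOf]

open Classical in
-- The parent lies on a shortest path to `l`, so by `nearest_of_between` it belongs to the same
-- tree, and positive weights bring it strictly nearer to `l`. Two steps are spent per tree edge.
lemma climbTree_spec (hw : ∀ e ∈ G.edgeSet, 0 < w e) {l z : Fin n} (k : ℕ) :
    ∀ (x : Fin n) (q : G.Walk x z), nearest G w L x = some l →
    (Finset.univ.filter fun y => gdist G w y l < gdist G w x l).card < k →
    ∃ p : G.Walk l z, (climbTree (mkForest G w L) k x q.support).val = some (l, p.support) ∧
      (wlen w p : ℝ≥0∞) = gdist G w x l + wlen w q ∧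
      (climbTree (mkForest G w L) k x q.support).steps + 2 * q.length ≤ 2 * p.length + 2 := by
  induction k with
  | zero => intro x q _ h; omega
  | succ k ih =>
    intro x q hx hk
    obtain ⟨hl, htop, hrad⟩ := nearest_spec hx
    have hf : mkForest G w L x =
        some ⟨succOf (canonPath G w x l) x, (gdist G w x l).toNNReal⟩ := by
      simp [mkForest, hx]
    rw [climbTree]
    simp only [Timed.val_bind, Timed.steps_bind, Timed.steps_tick, Table.val_get, Table.steps_get,
      hf]
    by_cases hxl : x = l
    · subst hxl
      rw [succOf_canonPath_self]
      refine ⟨q, rfl, by simp, ?_⟩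
      simp only [Timed.steps_pure]
      omega
    · obtain ⟨y, hy, hadj, hd⟩ := succOf_canonPath (w := w) (gdist_ne_top_iff.1 htop) hxl
      rw [hy]
      have hpos : (0 : ℝ≥0∞) < w s(x, y) := by exact_mod_cast hw _ hadj
      have hytop : gdist G w y l ≠ ⊤ := ne_top_of_le_ne_top htop (hd ▸ le_add_self)
      have hlt : gdist G w y l < gdist G w x l := by
        rw [hd, add_comm]
        exact ENNReal.lt_add_right hytop hpos.ne'
      have hcard : (Finset.univ.filter fun z => gdist G w z l < gdist G w y l).card <
          (Finset.univ.filter fun z => gdist G w z l < gdist G w x l).card := by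
        refine Finset.card_lt_card ⟨fun z hz => ?_, fun hsub => ?_⟩
        · simp only [Finset.mem_filter, Finset.mem_univ, true_and] at hz ⊢
          exact hz.trans hlt
        · have := hsub (Finset.mem_filter.2 ⟨Finset.mem_univ y, hlt⟩)
          simp at this
      have hbet : gdist G w x y + gdist G w y l = gdist G w x l := by
        refine le_antisymm ?_ (gdist_triangle x y l)
        rw [hd]
        gcongr
        exact gdist_le_of_adj hadj
      obtain ⟨p, h1, h2, h3⟩ := ih y (.cons hadj.symm q) (nearest_of_between hx hbet) (by omega)
      simp only [SimpleGraph.Walk.support_cons, SimpleGraph.Walk.length_cons] at h1 h3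
      refine ⟨p, h1, ?_, ?_⟩
      · rw [h2, hd, wlen_cons, Sym2.eq_swap]
        push_cast
        ring
      · simp only
        omega

/-! ### Reporting a stored path -/

lemma mem_of_succOf {l : List (Fin n)} {a b : Fin n} (h : succOf l a = some b) : a ∈ l := by
  obtain ⟨pre, post, rfl⟩ := exists_append_of_succOf h
  simp

lemma mem_of_predOf {l : List (Fin n)} {a b : Fin n} (h : predOf l b = some a) : b ∈ l := by
  obtain ⟨pre, post, rfl⟩ := exists_append_of_predOf h
  simp

/-- The neighbours that the tables give for an inner vertex of a stored path. -/
lemma followPath_next {P : Set (Fin n × Fin n)} {x y prev cur next last : Fin n} {k : ℕ}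
    {acc : List (Fin n)} (hP : (x, y) ∈ P)
    (hpred : predOf (canonPath G w x y) cur = some prev)
    (hsucc : succOf (canonPath G w x y) cur = some next) (hne : cur ≠ last) :
    (followPath (mkDPPRO G w P) x y last (k + 1) prev cur acc).val =
      (followPath (mkDPPRO G w P) x y last k cur next (next :: acc)).val ∧
    (followPath (mkDPPRO G w P) x y last (k + 1) prev cur acc).steps =
      3 + (followPath (mkDPPRO G w P) x y last k cur next (next :: acc)).steps := by
  have hex : ∃ e, IsHome G w P cur e := ⟨⟨(x, y), prev, next⟩, hP, hpred, hsucc⟩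
  obtain ⟨e, he, heP, hel, her⟩ : ∃ e, (mkDPPRO G w P).home cur = some e ∧ IsHome G w P cur e :=
    ⟨hex.choose, by simp [mkDPPRO, hex], hex.choose_spec⟩
  rw [followPath]
  simp only [hne, if_false, Timed.val_bind, Timed.steps_bind, Timed.steps_tick, Table.val_get,
    Table.steps_get, he]
  by_cases hbr : IsBranching G w P e.path (x, y) cur
  · have hb : (mkDPPRO G w P).branch (e.path, (x, y), cur) = some ⟨some e.left, some e.right,
        some prev, some next⟩ := by
      simp [mkDPPRO, hbr, hel, her, hpred, hsucc]
    simp only [hb]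
    exact ⟨trivial, by omega⟩
  · have hb : (mkDPPRO G w P).branch (e.path, (x, y), cur) = none := by
      simp [mkDPPRO, hbr]
    -- Without a branching event the home path has the same two neighbours at `cur`, possibly in the
    -- opposite direction; the one that differs from `prev` is the way on.
    have hnext : (if e.left = prev then e.right else e.left) = next := by
      by_cases hpath : e.path = (x, y)
      · rw [hpath, hpred, Option.some.injEq] at hel
        rw [hpath, hsucc, Option.some.injEq] at her
        simp [← hel, ← her]
      · have hs : s(some e.left, some e.right) = s(some prev, some next) := by
          by_contra hcon
          refine hbr ⟨heP, hP, hpath, mem_of_predOf hel, mem_of_predOf hpred, ?_⟩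
          rw [hel, her]
          simp only [hpred, hsucc]
          exact hcon
        simp only [Sym2.eq_iff, Option.some.injEq] at hs
        rcases hs with ⟨h1, h2⟩ | ⟨h1, h2⟩
        · simp [h1, h2]
        · by_cases h3 : e.left = prev
          · simp only [h3, if_true, h2]
            rw [← h1, h3]
          · simp [h1, ← h2]
            intro h4
            exact absurd (h1.trans h4) (h2 ▸ h3)
    simp only [hb, hnext]
    exact ⟨trivial, by omega⟩

/-- Here `p₁` has been traversed, `p₂` is still to be reported, and `q` is the accumulator read as a
walk back to its start. Each edge costs a tick and two table lookups. -/
lemma followPath_spec {P : Set (Fin n × Fin n)} {x y last z : Fin n} (hP : (x, y) ∈ P)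
    {p : G.Walk x y} (hp : p.IsPath) (hpl : canonPath G w x y = p.support)
    (hlast : predOf p.support y = some last) (k : ℕ) :
    ∀ (prev cur : Fin n) (p₁ : G.Walk x cur) (p₂ : G.Walk cur y) (q : G.Walk cur z),
    p = p₁.append p₂ → predOf p.support cur = some prev → cur ≠ y → p₂.length ≤ k →
    (followPath (mkDPPRO G w P) x y last k prev cur q.support).val =
      some (p₂.reverse.append q).support ∧
    (followPath (mkDPPRO G w P) x y last k prev cur q.support).steps ≤ 3 * p₂.length := by
  induction k with
  | zero =>
    intro prev cur p₁ p₂ q _ _ hne hlen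
    exact absurd (SimpleGraph.Walk.eq_of_length_eq_zero (Nat.le_zero.1 hlen)) hne
  | succ k ih =>
    intro prev cur p₁ p₂ q hpp hpred hne hlen
    cases p₂ with
    | nil => exact absurd rfl hne
    | cons hadj p₃ =>
      rename_i next
      obtain ⟨pre, hpre⟩ : ∃ pre, p₁.support = pre ++ [cur] := by
        refine ⟨p₁.support.dropLast, ?_⟩
        conv_lhs => rw [← List.dropLast_append_getLast p₁.support_ne_nil]
        rw [SimpleGraph.Walk.getLast_support]
      have hsupp : p.support = pre ++ cur :: next :: p₃.support.tail := by
        rw [hpp, SimpleGraph.Walk.support_append, hpre]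
        simp
      have hnd := hp.support_nodup
      have hsucc : succOf p.support cur = some next := by
        rw [hsupp] at hnd ⊢
        exact succOf_append hnd
      have hpred' : predOf p.support next = some cur := by
        rw [hsupp] at hnd ⊢
        exact predOf_append hnd
      by_cases hcl : cur = last
      · obtain ⟨pre', post', h1⟩ := exists_append_of_predOf hlast
        have hy : next = y := by
          rw [h1] at hnd hsucc
          rw [hcl, succOf_append hnd] at hsucc
          exact (Option.some.inj hsucc).symm
        subst hy
        have hnil : p₃ = .nil := by
          rw [hpp] at hp
          exact (SimpleGraph.Walk.isPath_iff_nil.1 hp.of_append_right.of_cons).eq_nil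
        subst hnil
        rw [followPath]
        simp [hcl]
      · have hny : next ≠ y := by
          rintro rfl
          rw [hlast] at hpred'
          exact hcl (Option.some.inj hpred').symm
        obtain ⟨h1, h2⟩ := followPath_next (k := k) (acc := q.support) hP (hpl ▸ hpred)
          (hpl ▸ hsucc) hcl
        simp only [SimpleGraph.Walk.length_cons] at hlen
        obtain ⟨h3, h4⟩ := ih cur next (p₁.concat hadj) p₃ (.cons hadj.symm q)
          (by rw [hpp, SimpleGraph.Walk.concat_append]) hpred' hny (by omega)
        simp only [SimpleGraph.Walk.support_cons] at h3 h4
        rw [h1, h2, h3]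
        refine ⟨?_, ?_⟩
        · simp [SimpleGraph.Walk.support_append]
        · simp only [SimpleGraph.Walk.length_cons]
          omega

lemma exists_succOf_support {x y : Fin n} {p : G.Walk x y} (hp : p.IsPath) (hne : x ≠ y) :
    ∃ z, succOf p.support x = some z := by
  have hnd := hp.support_nodup
  cases p with
  | nil => exact absurd rfl hne
  | cons hadj q =>
    rw [SimpleGraph.Walk.support_cons, ← SimpleGraph.Walk.cons_tail_support q] at hnd ⊢
    exact ⟨_, succOf_append (pre := []) hnd⟩

lemma ends_spec {P : Set (Fin n × Fin n)} {x y : Fin n} (hP : (x, y) ∈ P)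
    (hr : G.Reachable x y) (hne : x ≠ y) :
    ∃ e, (mkDPPRO G w P).ends (x, y) = some e ∧
      succOf (canonPath G w x y) x = some e.second ∧
      predOf (canonPath G w x y) y = some e.penultimate := by
  obtain ⟨a, ha, -, -⟩ := succOf_canonPath (w := w) hr hne
  obtain ⟨b, hb⟩ : ∃ b, predOf (canonPath G w x y) y = some b := by
    obtain ⟨p, hp, hpl⟩ := canonPath_of_reachable w hr
    obtain ⟨b, hb⟩ := exists_succOf_support hp.1.reverse hne.symm
    exact ⟨b, by rwa [hpl, predOf, ← SimpleGraph.Walk.support_reverse]⟩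
  exact ⟨⟨a, b⟩, by simp [mkDPPRO, hP, ha, hb], ha, hb⟩

lemma report_spec {P : Set (Fin n × Fin n)} {x y z : Fin n} {e : EndsEntry n}
    (he : (mkDPPRO G w P).ends (x, y) = some e) (hne : x ≠ y) (q : G.Walk x z) :
    ∃ p : G.Walk y z, ((mkDPPRO G w P).report x y e q.support).val = some p.support ∧
      (wlen w p : ℝ≥0∞) = gdist G w x y + wlen w q ∧
      ((mkDPPRO G w P).report x y e q.support).steps + 3 * q.length ≤ 3 * p.length := by
  have hP : (x, y) ∈ P := by
    by_contra hn
    simp [mkDPPRO, hn] at he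
  obtain ⟨hsucc, hpred⟩ : succOf (canonPath G w x y) x = some e.second ∧
      predOf (canonPath G w x y) y = some e.penultimate := by
    simp only [mkDPPRO, hP, if_true] at he
    split at he
    · rename_i a b ha hb
      rw [Option.some.injEq] at he
      rw [← he]
      exact ⟨ha, hb⟩
    · simp at he
  obtain ⟨p, hp, hpl⟩ := canonPath_of_mem (mem_of_succOf hsucc)
  rw [hpl] at hsucc hpred
  suffices h : ((mkDPPRO G w P).report x y e q.support).val =
      some (p.reverse.append q).support ∧
      ((mkDPPRO G w P).report x y e q.support).steps ≤ 3 * p.length by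
    refine ⟨p.reverse.append q, h.1, by simp [hp.gdist_eq], ?_⟩
    simp only [SimpleGraph.Walk.length_append, SimpleGraph.Walk.length_reverse]
    omega
  have hpath := hp.1
  have hnd := hpath.support_nodup
  cases p with
  | nil => exact absurd rfl hne
  | cons hadj p₃ =>
    rename_i next
    have hsupp : (SimpleGraph.Walk.cons hadj p₃).support = x :: next :: p₃.support.tail := by
      simp
    have hnext : e.second = next := by
      rw [hsupp] at hsucc hnd
      exact Option.some.inj (hsucc.symm.trans (succOf_append (pre := []) hnd))
    rw [DPPRO.report, hnext]
    by_cases hxe : x = e.penultimate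
    · obtain ⟨pre', post', h1⟩ := exists_append_of_predOf hpred
      have hy : next = y := by
        rw [h1] at hnd hsucc
        rw [← hxe] at hnd hsucc
        rw [succOf_append hnd, hnext] at hsucc
        exact (Option.some.inj hsucc).symm
      subst hy
      have hnil : p₃ = .nil := (SimpleGraph.Walk.isPath_iff_nil.1 hpath.of_cons).eq_nil
      subst hnil
      simp [← hxe]
    · have hpred' : predOf (SimpleGraph.Walk.cons hadj p₃).support next = some x := by
        rw [hsupp] at hnd ⊢
        exact predOf_append (pre := []) hnd
      have hny : next ≠ y := by
        rintro rfl
        rw [hpred] at hpred'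
        exact hxe (Option.some.inj hpred').symm
      -- A path has fewer than `n` edges, so the counter `n` suffices.
      have hlen := hpath.length_lt
      simp only [SimpleGraph.Walk.length_cons, Fintype.card_fin] at hlen
      obtain ⟨h3, h4⟩ := followPath_spec hP hpath hpl hpred n x next (.cons hadj .nil) p₃
        (.cons hadj.symm q) (by simp) hpred' hny (by omega)
      simp only [SimpleGraph.Walk.support_cons] at h3 h4
      simp only [Timed.val_bind, Timed.steps_bind, Timed.steps_tick, hxe, if_false]
      rw [h3]
      refine ⟨?_, ?_⟩
      · simp [SimpleGraph.Walk.support_append]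
      · simp only [SimpleGraph.Walk.length_cons]
        omega

lemma emit_spec (a b : List (Fin n)) :
    (emit a b).val = a.reverse ++ b ∧ (emit a b).steps = a.length + 1 := by
  induction a generalizing b with
  | nil => simp [emit]
  | cons x a ih =>
    obtain ⟨h1, h2⟩ := ih (x :: b)
    rw [emit]
    simp only [Timed.val_bind, Timed.steps_bind, Timed.steps_tick, h1, h2]
    refine ⟨by simp, ?_⟩
    simp only [List.length_cons]
    omega

/-- The `i`-th level of the oracle. -/
def level (G : SimpleGraph (Fin n)) (w : Sym2 (Fin n) → ℝ≥0) (h : ℕ) (L : ℕ → Set (Fin n))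
    (i : ℕ) : Level n :=
  ⟨mkForest G w (L i), mkDPPRO G w (levelPairs G w h L i)⟩

lemma exists_nearest {L : Set (Fin n)} {x : Fin n} (h : radius G w L x ≠ ⊤) :
    ∃ l, nearest G w L x = some l := by
  rw [← Option.ne_none_iff_exists']
  exact fun h' => h (nearest_eq_none_iff.1 h')

/-- One level either finishes or hands over longer accumulated walks. Climbing costs two steps per
edge, reporting three, and the final output one more, so four per edge of the answer is enough. The
term `2 * (qU.length + qV.length)` on the left records what earlier levels have already paid, so
that levels telescope with an overhead of 8 each. -/
lemma climb_cons (hw : ∀ e ∈ G.edgeSet, 0 < w e) {h i : ℕ} {L : ℕ → Set (Fin n)}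
    {u v x y l l' : Fin n} (hx : nearest G w (L i) x = some l)
    (hy : nearest G w (L i) y = some l') (hr : G.Reachable l l')
    (qU : G.Walk x u) (qV : G.Walk y v) (rest : List (Level n)) :
    (∃ p : G.Walk u v,
      (climb (level G w h L i :: rest) x y qU.support qV.support).val = some p.support ∧
      (wlen w p : ℝ≥0∞) ≤ gdist G w l l' + ((gdist G w x l + wlen w qU) +
        (gdist G w y l' + wlen w qV)) ∧
      (climb (level G w h L i :: rest) x y qU.support qV.support).steps +
        2 * (qU.length + qV.length) ≤ 8 + 4 * p.length) ∨
    (l ≠ l' ∧ (l, l') ∉ levelPairs G w h L i ∧ ∃ (pU : G.Walk l u) (pV : G.Walk l' v),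
      (wlen w pU : ℝ≥0∞) = gdist G w x l + wlen w qU ∧
      (wlen w pV : ℝ≥0∞) = gdist G w y l' + wlen w qV ∧
      (climb (level G w h L i :: rest) x y qU.support qV.support).val =
        (climb rest l l' pU.support pV.support).val ∧
      (climb (level G w h L i :: rest) x y qU.support qV.support).steps +
        2 * (qU.length + qV.length) ≤
          8 + (climb rest l l' pU.support pV.support).steps + 2 * (pU.length + pV.length)) := by
  classical
  have hcard : ∀ x l : Fin n,
      (Finset.univ.filter fun y => gdist G w y l < gdist G w x l).card < n + 1 := fun x l =>
    Nat.lt_succ_of_le ((Finset.card_le_univ _).trans (by simp))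
  obtain ⟨pU, hU1, hU2, hU3⟩ := climbTree_spec hw (n + 1) x qU hx (hcard x l)
  obtain ⟨pV, hV1, hV2, hV3⟩ := climbTree_spec hw (n + 1) y qV hy (hcard y l')
  rw [climb]
  simp only [Timed.val_bind, Timed.steps_bind, Timed.steps_tick, level, hU1, hV1]
  by_cases hll : l = l'
  · subst hll
    left
    obtain ⟨h1, h2⟩ := emit_spec pU.support pV.support.tail
    refine ⟨pU.reverse.append pV, ?_, ?_, ?_⟩
    · simp [h1, SimpleGraph.Walk.support_append]
    · simp [hU2, hV2]
    · simp only [if_true, Timed.steps_bind, Timed.steps_pure, h2, SimpleGraph.Walk.length_append,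
        SimpleGraph.Walk.length_reverse, SimpleGraph.Walk.length_support]
      omega
  · simp only [hll, if_false, Timed.val_bind, Timed.steps_bind, Table.val_get, Table.steps_get]
    cases he : (mkDPPRO G w (levelPairs G w h L i)).ends (l, l') with
    | none =>
      right
      refine ⟨hll, fun hmem => ?_, pU, pV, hU2, hV2, rfl, ?_⟩
      · obtain ⟨e, he', -⟩ := ends_spec hmem hr hll
        rw [he] at he'
        simp at he'
      · simp only
        omega
    | some e =>
      left
      obtain ⟨pR, hR1, hR2, hR3⟩ := report_spec he hll pU
      obtain ⟨h1, h2⟩ := emit_spec pR.support pV.support.tail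
      refine ⟨pR.reverse.append pV, ?_, ?_, ?_⟩
      · simp [hR1, h1, SimpleGraph.Walk.support_append]
      · simp [hR2, hU2, hV2, add_assoc]
      · simp only [hR1, Timed.steps_bind, Timed.steps_pure, h2, SimpleGraph.Walk.length_append,
          SimpleGraph.Walk.length_reverse, SimpleGraph.Walk.length_support]
        omega

/-- The single quantity `A` controls both the distance of the next two landmarks and the length of
the two accumulated walks after climbing to them; `ρ` bounds both climbs. Stopping at this level
costs at most `2A`, and each further level multiplies `A` by 7. Finiteness of `A` guarantees that
the landmarks exist. -/
lemma climb_spec (hw : ∀ e ∈ G.edgeSet, 0 < w e) {h : ℕ} (L : ℕ → Set (Fin n)) {u v : Fin n}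
    (m : ℕ) : ∀ (j : ℕ) (x y : Fin n) (qU : G.Walk x u) (qV : G.Walk y v) (ρ A : ℝ≥0∞),
    j + (m + 1) = h → A ≠ ⊤ → radius G w (L (j + 1)) x ≤ ρ → radius G w (L (j + 1)) y ≤ ρ →
    gdist G w x y + 2 * ρ ≤ A → (wlen w qU : ℝ≥0∞) + wlen w qV + 2 * ρ ≤ A →
    ∃ p : G.Walk u v,
      (climb ((List.range (m + 1)).map fun i => level G w h L (j + i + 1)) x y qU.support
        qV.support).val = some p.support ∧
      (wlen w p : ℝ≥0∞) ≤ 2 * 7 ^ m * A ∧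
      (climb ((List.range (m + 1)).map fun i => level G w h L (j + i + 1)) x y qU.support
        qV.support).steps + 2 * (qU.length + qV.length) ≤ 8 * (m + 1) + 4 * p.length := by
  induction m using Nat.strong_induction_on with
  | _ m ih =>
  intro j x y qU qV ρ A hj hA hx hy hD hS
  have hρ : ρ ≠ ⊤ := by
    rintro rfl
    exact hA (top_le_iff.1 (le_trans (by simp) hD))
  obtain ⟨l, hl⟩ := exists_nearest (ne_top_of_le_ne_top hρ hx)
  obtain ⟨l', hl'⟩ := exists_nearest (ne_top_of_le_ne_top hρ hy)
  obtain ⟨hlL, -, hlr⟩ := nearest_spec hl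
  obtain ⟨hlL', -, hlr'⟩ := nearest_spec hl'
  rw [← hlr] at hx
  rw [← hlr'] at hy
  have hD' : gdist G w l l' ≤ A := by
    refine le_trans ?_ hD
    calc gdist G w l l' ≤ gdist G w l x + (gdist G w x y + gdist G w y l') :=
          (gdist_triangle l x l').trans (by gcongr; exact gdist_triangle x y l')
      _ ≤ ρ + (gdist G w x y + ρ) := by
          rw [gdist_comm l x]
          gcongr
      _ = gdist G w x y + 2 * ρ := by ring
  have hS' : (gdist G w x l + wlen w qU) + (gdist G w y l' + wlen w qV) ≤ A := by
    refine le_trans ?_ hS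
    calc (gdist G w x l + wlen w qU) + (gdist G w y l' + wlen w qV)
        ≤ (ρ + wlen w qU) + (ρ + wlen w qV) := by gcongr
      _ = wlen w qU + wlen w qV + 2 * ρ := by ring
  have hr : G.Reachable l l' := gdist_ne_top_iff.1 (ne_top_of_le_ne_top hA hD')
  have hlist : ((List.range (m + 1)).map fun i => level G w h L (j + i + 1)) =
      level G w h L (j + 1) :: (List.range m).map fun i => level G w h L (j + 1 + i + 1) := by
    rw [List.range_succ_eq_map, List.map_cons, List.map_map, add_zero]
    congr 2
    funext i
    simp only [Function.comp_apply, Nat.succ_eq_add_one]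
    congr 1
    omega
  rw [hlist]
  rcases climb_cons hw hl hl' hr qU qV
    ((List.range m).map fun i => level G w h L (j + 1 + i + 1)) with
    ⟨p, h1, h2, h3⟩ | ⟨hne, hmem, pU, pV, hU, hV, h1, h2⟩
  · refine ⟨p, h1, h2.trans ?_, by omega⟩
    calc gdist G w l l' + ((gdist G w x l + wlen w qU) + (gdist G w y l' + wlen w qV))
        ≤ A + A := by gcongr
      _ = 2 * 1 * A := by ring
      _ ≤ 2 * 7 ^ m * A := by
          gcongr
          exact one_le_pow₀ (by norm_num)
  · cases m with
    | zero =>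
      -- At the top level every connected pair of distinct landmarks is stored, so the climb cannot
      -- continue.
      refine absurd ⟨hlL, hlL', hne, Or.inr ⟨by omega, ?_⟩⟩ hmem
      exact gdist_ne_top_iff.2 hr
    | succ m =>
      have hdiv : ∀ {a b : ℝ≥0∞}, ¬ a < b / 3 → b ≤ 3 * a := by
        intro a b hab
        rw [not_lt, ENNReal.div_le_iff_le_mul (by simp) (by simp)] at hab
        rwa [mul_comm]
      have hnot : ¬ (gdist G w l l' < radius G w (L (j + 1 + 1)) l / 3 ∨
          gdist G w l' l < radius G w (L (j + 1 + 1)) l' / 3) := fun hcon =>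
        hmem ⟨hlL, hlL', hne, Or.inl ⟨by omega, hcon⟩⟩
      rw [not_or] at hnot
      have hr1 : radius G w (L (j + 1 + 1)) l ≤ 3 * A := (hdiv hnot.1).trans (by gcongr)
      have hr2 : radius G w (L (j + 1 + 1)) l' ≤ 3 * A :=
        (hdiv hnot.2).trans (by gcongr; rwa [gdist_comm])
      -- The new distance and the new accumulated length are at most `A`, and both new radii at most
      -- `3 * A`; this is the source of the factor 7.
      have e : A + 2 * (3 * A) = 7 * A := by ring
      obtain ⟨p, h3, h4, h5⟩ := ih m (by omega) (j + 1) l l' pU pV (3 * A) (7 * A) (by omega)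
        (ENNReal.mul_ne_top (by simp) hA) hr1 hr2 (e ▸ by gcongr)
        (e ▸ by rw [hU, hV]; gcongr)
      refine ⟨p, h1.trans h3, h4.trans (le_of_eq (by ring)), by omega⟩

/-- The query algorithm returns a path of small stretch after a small number of steps. -/
theorem query_spec (hw : ∀ e ∈ G.edgeSet, 0 < w e) {h : ℕ} (hh : 1 ≤ h) (L : ℕ → Set (Fin n))
    {u v : Fin n} (hr : G.Reachable u v) :
    ∃ p : G.Walk u v, ((mkOracle G w h L).query u v).val = some p.support ∧
      (wlen w p : ℝ≥0∞) ≤ 7 ^ h * gdist G w u v ∧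
      ((mkOracle G w h L).query u v).steps ≤
        searchCost (ballEdges G w (radius G w (L 1) u) u) +
        searchCost (ballEdges G w (radius G w (L 1) v) v) + 8 * h + 2 + 4 * p.length := by
  have h7 : gdist G w u v ≤ 7 ^ h * gdist G w u v := by
    conv_lhs => rw [← one_mul (gdist G w u v)]
    gcongr
    exact one_le_pow₀ (by norm_num)
  unfold Oracle.query
  simp only [Timed.val_bind, Timed.steps_bind]
  rcases ballSearch_spec hw hh L u v with ⟨p, h1, h2, h3⟩ | ⟨h1, h2, h3⟩
  · simp only [h1]
    exact ⟨p, rfl, h2 ▸ h7, by simp only [Timed.steps_pure]; omega⟩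
  · simp only [h1, Timed.val_bind, Timed.steps_bind]
    rcases ballSearch_spec hw hh L v u with ⟨p, h4, h5, h6⟩ | ⟨h4, h5, h6⟩
    · simp only [h4, Timed.val_bind, Timed.steps_bind]
      obtain ⟨h7', h8⟩ := emit_spec p.support []
      refine ⟨p.reverse, ?_, ?_, ?_⟩
      · simp [h7']
      · rw [wlen_reverse, h5, gdist_comm]
        exact h7
      · simp only [Timed.steps_pure, h8, SimpleGraph.Walk.length_support,
          SimpleGraph.Walk.length_reverse]
        omega
    · simp only [h4]
      obtain ⟨m, rfl⟩ : ∃ m, h = m + 1 := ⟨h - 1, by omega⟩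
      rw [gdist_comm] at h5
      have e : gdist G w u v + 2 * gdist G w u v = 3 * gdist G w u v := by ring
      -- Both failed ball tests bound the first radii by the distance itself, so `A` starts at three
      -- times the distance.
      obtain ⟨p, h7', h8, h9⟩ := climb_spec hw (h := m + 1) L m 0 u v .nil .nil (gdist G w u v)
        (3 * gdist G w u v) (by omega)
        (ENNReal.mul_ne_top (by simp) (gdist_ne_top_iff.2 hr)) h2 h5 e.le
        (by simpa using by gcongr; norm_num)
      have hlev : (mkOracle G w (m + 1) L).levels =
          (List.range (m + 1)).map fun i => level G w (m + 1) L (0 + i + 1) := by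
        simp [mkOracle, level]
      rw [hlev]
      refine ⟨p, h7', h8.trans ?_, ?_⟩
      · calc 2 * 7 ^ m * (3 * gdist G w u v) = 6 * (7 ^ m * gdist G w u v) := by ring
          _ ≤ 7 * (7 ^ m * gdist G w u v) := by
              gcongr
              norm_num
          _ = 7 ^ (m + 1) * gdist G w u v := by ring
      · simp only [SimpleGraph.Walk.support_nil, SimpleGraph.Walk.length_nil] at h9
        omega

end Climb

end

end PathOracle

/-! ### Moments of the numbers of selected landmarks. -/

namespace PathOracle

noncomputable section

/-! ### Elements of a ball -/

section InBall

variable {ι κ : Type*}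

open Classical in
/-- The number of elements of `S` that are selected by the coins `x`, and that are nearer (with
respect to `D`) than all elements of `S` that are selected by the coins `y`. -/
def inBall (D : κ → ℝ≥0∞) (x y : κ → ι) (S : Finset κ) (ω : ι → Bool) : ℕ :=
  (S.filter fun k => ω (x k) = true ∧ ∀ k' ∈ S, ω (y k') = true → D k < D k').card

/-- This exposes the coins in order of distance: a hit of the `y`-coin at the nearest element
empties the ball, and otherwise that element contributes at most its own `x`-coin. The count thus
behaves like a stopped sum. -/
lemma inBall_insert_le [DecidableEq κ] {D : κ → ℝ≥0∞} {x y : κ → ι} {S : Finset κ} {a : κ} (ha : a ∉ S)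
    (hmin : ∀ k ∈ S, D a ≤ D k) (ω : ι → Bool) :
    inBall D x y (insert a S) ω ≤
      if ω (y a) = true then 0 else (if ω (x a) = true then 1 else 0) + inBall D x y S ω := by
  classical
  split_ifs with hy hx
  · rw [Nat.le_zero, inBall, Finset.card_eq_zero, Finset.filter_eq_empty_iff]
    rintro k hk ⟨-, h⟩
    have h1 := h a (Finset.mem_insert_self _ _) hy
    rcases Finset.mem_insert.1 hk with rfl | hk
    · exact lt_irrefl _ h1
    · exact absurd (hmin k hk) (not_le.2 h1)
  · unfold inBall
    rw [Finset.filter_insert]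
    have hsub : S.filter (fun k => ω (x k) = true ∧
        ∀ k' ∈ insert a S, ω (y k') = true → D k < D k') ⊆
        S.filter (fun k => ω (x k) = true ∧ ∀ k' ∈ S, ω (y k') = true → D k < D k') := by
      intro k hk
      rw [Finset.mem_filter] at hk ⊢
      exact ⟨hk.1, hk.2.1, fun k' hk' => hk.2.2 k' (Finset.mem_insert_of_mem hk')⟩
    split_ifs
    · refine (Finset.card_insert_le _ _).trans ?_
      have := Finset.card_le_card hsub
      omega
    · have := Finset.card_le_card hsub
      omega
  · unfold inBall
    rw [Finset.filter_insert, if_neg (by tauto), zero_add]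
    refine Finset.card_le_card fun k hk => ?_
    rw [Finset.mem_filter] at hk ⊢
    exact ⟨hk.1, hk.2.1, fun k' hk' => hk.2.2 k' (Finset.mem_insert_of_mem hk')⟩

lemma inBall_univ_le [Fintype κ] [DecidableEq κ] {D : κ → ℝ≥0∞} {x y : κ → ι} (α : κ) (ω : ι → Bool) :
    inBall D x y Finset.univ ω ≤ 1 + inBall D x y (Finset.univ.erase α) ω := by
  classical
  unfold inBall
  rw [add_comm]
  refine le_trans (Finset.card_le_card fun k hk => ?_) (Finset.card_insert_le α _)
  simp only [Finset.mem_filter, Finset.mem_univ, Finset.mem_insert, Finset.mem_erase, true_and,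
    and_true, forall_true_left] at hk ⊢
  exact or_iff_not_imp_left.2 fun hka => ⟨hka, hk.1, fun k' _ => hk.2 k'⟩

end InBall

/-! ### Independent coins -/

section Coins

variable {ι : Type*} [Fintype ι]

/-- Independent coins; the coin `x` comes up `true` with probability `P x`. -/
abbrev coinMeasure (P : ι → unitInterval) : Measure (ι → Bool) :=
  Measure.pi fun x => bernoulliMeasure true false (P x)

variable {P : ι → unitInterval}

lemma coinMeasure_real_singleton (ω : ι → Bool) :
    (coinMeasure P).real {ω} = ∏ i, if ω i = true then (P i : ℝ) else 1 - P i := by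
  rw [measureReal_def, coinMeasure, Measure.pi_singleton, ENNReal.toReal_prod]
  refine Finset.prod_congr rfl fun i _ => ?_
  rw [← measureReal_def, bernoulliMeasure_real_apply _ (MeasurableSet.singleton _)]
  cases ω i <;> simp

variable [DecidableEq ι]

lemma integral_coinMeasure (f : (ι → Bool) → ℝ) :
    ∫ ω, f ω ∂(coinMeasure P) =
      ∑ ω, (∏ i, if ω i = true then (P i : ℝ) else 1 - P i) * f ω := by
  rw [integral_fintype Integrable.of_finite]
  simp only [coinMeasure_real_singleton, smul_eq_mul]

/-- A coin is independent of a function of the other coins. -/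
lemma integral_mul_coin (i : ι) (g : (ι → Bool) → ℝ)
    (hg : ∀ ω b, g (Function.update ω i b) = g ω) (φ : Bool → ℝ) :
    ∫ ω, g ω * φ (ω i) ∂(coinMeasure P) =
      (P i * φ true + (1 - P i) * φ false) * ∫ ω, g ω ∂(coinMeasure P) := by
  set c := (P i : ℝ) * φ true + (1 - P i) * φ false with hc
  have key : ∫ ω, g ω * (φ (ω i) - c) ∂(coinMeasure P) = 0 := by
    rw [integral_coinMeasure]
    -- After subtracting its mean, `φ` has weighted values of opposite sign at the two outcomes that
    -- differ only in the coin `i`, and `g` does not see that coin; the integral cancels in pairs.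
    have hflip : ∀ ω : ι → Bool,
        (∏ j, if ω j = true then (P j : ℝ) else 1 - P j) * (g ω * (φ (ω i) - c)) +
        (∏ j, if Function.update ω i (!ω i) j = true then (P j : ℝ) else 1 - P j) *
          (g (Function.update ω i (!ω i)) * (φ (Function.update ω i (!ω i) i) - c)) = 0 := by
      intro ω
      rw [hg, Function.update_self, ← Finset.mul_prod_erase _ _ (Finset.mem_univ i),
        ← Finset.mul_prod_erase Finset.univ
          (fun j => if Function.update ω i (!ω i) j = true then (P j : ℝ) else 1 - P j)
          (Finset.mem_univ i), Function.update_self]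
      have : ∏ j ∈ Finset.univ.erase i,
          (if Function.update ω i (!ω i) j = true then (P j : ℝ) else 1 - P j) =
          ∏ j ∈ Finset.univ.erase i, if ω j = true then (P j : ℝ) else 1 - P j := by
        refine Finset.prod_congr rfl fun j hj => ?_
        rw [Function.update_of_ne (Finset.ne_of_mem_erase hj)]
      rw [this, hc]
      cases ω i <;> simp <;> ring
    refine Finset.sum_ninvolution (fun ω => Function.update ω i (!ω i)) hflip ?_ (by simp) ?_
    · intro ω _ h
      have := congrFun h i
      simp at this
    · intro ω
      simp
  have : ∀ ω, g ω * φ (ω i) = g ω * (φ (ω i) - c) + c * g ω := fun ω => by ring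
  simp only [this]
  rw [integral_add Integrable.of_finite Integrable.of_finite, key, zero_add, integral_const_mul]

lemma integral_prod_coin (S : Finset ι) (φ : ι → Bool → ℝ) :
    ∫ ω, ∏ i ∈ S, φ i (ω i) ∂(coinMeasure P) =
      ∏ i ∈ S, ((P i : ℝ) * φ i true + (1 - P i) * φ i false) := by
  induction S using Finset.induction_on with
  | empty => simp
  | insert a s ha ih =>
    rw [Finset.prod_insert ha, ← ih, ← integral_mul_coin a _ _ (φ a)]
    · simp only [Finset.prod_insert ha, mul_comm]
    · intro ω b
      refine Finset.prod_congr rfl fun j hj => ?_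
      rw [Function.update_of_ne]
      rintro rfl
      exact ha hj

/-- The probability that all coins of `S` come up `false`. -/
lemma coinMeasure_forall_false_le (S : Finset ι) {p : ℝ} (hp : ∀ i ∈ S, (P i : ℝ) = p) :
    (coinMeasure P).real {ω | ∀ i ∈ S, ω i = false} ≤ Real.exp (-(p * S.card)) := by
  classical
  have h1 : (coinMeasure P).real {ω | ∀ i ∈ S, ω i = false} =
      ∫ ω, ∏ i ∈ S, (if ω i = true then (0 : ℝ) else 1) ∂(coinMeasure P) := by
    rw [← integral_indicator_one (Set.toFinite _).measurableSet]
    refine integral_congr_ae (Filter.Eventually.of_forall fun ω => ?_)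
    simp only [Set.indicator_apply, Set.mem_ofPred_eq, Pi.one_apply]
    split_ifs with h
    · rw [Finset.prod_eq_one]
      intro i hi
      simp [h i hi]
    · push Not at h
      obtain ⟨i, hi, hne⟩ := h
      rw [Finset.prod_eq_zero hi]
      simpa using hne
  rw [h1, integral_prod_coin S fun _ b => if b = true then (0 : ℝ) else 1]
  have h2 : ∀ i ∈ S, ((P i : ℝ) * (if true = true then (0 : ℝ) else 1) +
      (1 - P i) * (if false = true then (0 : ℝ) else 1)) = 1 - p := by
    intro i hi
    simp [hp i hi]
  rw [Finset.prod_congr rfl h2, Finset.prod_const]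
  rcases S.eq_empty_or_nonempty with rfl | ⟨i, hi⟩
  · simp
  have h3 : 0 ≤ 1 - p := by
    rw [← hp i hi]
    linarith [(P i).2.2]
  calc (1 - p) ^ S.card ≤ Real.exp (-p) ^ S.card := by
        gcongr
        linarith [Real.add_one_le_exp (-p)]
    _ = Real.exp (-(p * S.card)) := by
        rw [← Real.exp_nat_mul]
        congr 1
        ring

/-- The fourth moment of the number of selected elements. -/
lemma integral_card_pow_four_le {κ : Type*} [Fintype κ] {x : κ → ι} (hx : Function.Injective x) {p m : ℝ}
    (hp : ∀ k, (P (x k) : ℝ) = p) (hp0 : 0 ≤ p) (hm : 1 ≤ m)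
    (hcard : p * Fintype.card κ ≤ 3 * m) :
    ∫ ω, ((Finset.univ.filter fun k => ω (x k) = true).card : ℝ) ^ 4 ∂(coinMeasure P) ≤
      3 * 45 ^ 4 * m ^ 4 := by
  classical
  -- The constant is `45 = 3 · 15`: with `θ - 1 ≤ 15 s` the exponent `p * card * (θ - 1)` is at most
  -- 1. Bernoulli's inequality turns `θ ^ N` into a bound on the fourth power of `N`.
  set s : ℝ := (45 * m)⁻¹ with hs
  have hs0 : 0 < s := by positivity
  have hs1 : s ≤ 1 := inv_le_one_of_one_le₀ (by linarith)
  set θ : ℝ := (1 + s) ^ 4 with hθ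
  have hθs : θ - 1 ≤ 15 * s := by
    have h2 : s ^ 2 ≤ s := by nlinarith
    have h3 : s ^ 3 ≤ s := by nlinarith
    have h4 : s ^ 4 ≤ s := by nlinarith
    have : θ - 1 = 4 * s + 6 * s ^ 2 + 4 * s ^ 3 + s ^ 4 := by
      rw [hθ]
      ring
    linarith
  have hθ1 : 1 ≤ θ := one_le_pow₀ (by linarith)
  have hpt : ∀ m : ℕ, (m : ℝ) ^ 4 ≤ s⁻¹ ^ 4 * θ ^ m := by
    intro m
    have h1 : 1 + (m : ℝ) * s ≤ (1 + s) ^ m := one_add_mul_le_pow (by linarith) m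
    have h2 : (m * s : ℝ) ^ 4 ≤ θ ^ m := by
      rw [hθ, ← pow_mul, mul_comm 4 m, pow_mul]
      gcongr
      linarith
    rw [inv_pow, ← div_eq_inv_mul, le_div_iff₀ (by positivity), ← mul_pow]
    exact h2
  have hprod : ∀ ω : ι → Bool, θ ^ (Finset.univ.filter fun k => ω (x k) = true).card =
      ∏ i ∈ Finset.univ.image x, if ω i = true then θ else 1 := by
    intro ω
    rw [Finset.prod_image (fun a _ b _ h => hx h), Finset.prod_ite]
    simp
  have hint : ∫ ω, θ ^ (Finset.univ.filter fun k => ω (x k) = true).card ∂(coinMeasure P) ≤ 3 := by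
    simp only [hprod]
    rw [integral_prod_coin _ fun _ b => if b = true then θ else 1,
      Finset.prod_image (fun a _ b _ h => hx h)]
    simp only [hp]
    rw [Finset.prod_const, Finset.card_univ]
    have h1 : p * (if true = true then θ else 1) + (1 - p) * (if false = true then θ else 1) ≤
        Real.exp (p * (θ - 1)) := by
      have := Real.add_one_le_exp (p * (θ - 1))
      simp only [if_true, Bool.false_eq_true, if_false]
      linarith
    have h0 : 0 ≤ p * (if true = true then θ else 1) +
        (1 - p) * (if false = true then θ else 1) := by
      simp only [if_true, Bool.false_eq_true, if_false]
      nlinarith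
    calc _ ≤ Real.exp (p * (θ - 1)) ^ Fintype.card κ := pow_le_pow_left₀ h0 h1 _
      _ = Real.exp (p * Fintype.card κ * (θ - 1)) := by
        rw [← Real.exp_nat_mul]
        congr 1
        ring
      _ ≤ Real.exp 1 := by
        refine Real.exp_le_exp.2 ?_
        calc p * Fintype.card κ * (θ - 1) ≤ 3 * m * (15 * s) :=
              mul_le_mul hcard hθs (by linarith) (by linarith)
          _ = 1 := by
            rw [hs]
            field_simp
            norm_num
      _ ≤ 3 := Real.exp_one_lt_three.le
  calc ∫ ω, ((Finset.univ.filter fun k => ω (x k) = true).card : ℝ) ^ 4 ∂(coinMeasure P)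
      ≤ ∫ ω, s⁻¹ ^ 4 * θ ^ (Finset.univ.filter fun k => ω (x k) = true).card ∂(coinMeasure P) :=
        integral_mono Integrable.of_finite Integrable.of_finite fun ω => hpt _
    _ ≤ s⁻¹ ^ 4 * 3 := by
        rw [integral_const_mul]
        gcongr
    _ = 3 * 45 ^ 4 * m ^ 4 := by
        rw [hs, inv_inv]
        ring

variable {κ : Type*} [DecidableEq κ]

/-- The number of selected elements of a ball has an exponential moment. -/
lemma integral_pow_inBall_le {D : κ → ℝ≥0∞} {x y : κ → ι} (hx : Function.Injective x)
    (hy : Function.Injective y) (hxy : ∀ k k', x k ≠ y k') {p p' θ : ℝ}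
    (hp : ∀ k, (P (x k) : ℝ) = p) (hp' : ∀ k, (P (y k) : ℝ) = p')
    (hp1 : p' ≤ 1) (hθ : 1 ≤ θ) (hpθ : p * (θ - 1) ≤ p' / 2) (S : Finset κ) :
    ∀ g : (ι → Bool) → ℝ, (∀ ω, 0 ≤ g ω) →
    (∀ k ∈ S, ∀ ω b, g (Function.update ω (x k) b) = g ω) →
    (∀ k ∈ S, ∀ ω b, g (Function.update ω (y k) b) = g ω) →
    ∫ ω, g ω * θ ^ inBall D x y S ω ∂(coinMeasure P) ≤ 2 * ∫ ω, g ω ∂(coinMeasure P) := by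
  induction S using Finset.induction_on_min_value D with
  | empty =>
    intro g hg _ _
    have : 0 ≤ ∫ ω, g ω ∂(coinMeasure P) := integral_nonneg hg
    simp only [inBall, Finset.filter_empty, Finset.card_empty, pow_zero, mul_one]
    linarith
  | insert a s ha hmin ih =>
    intro g hg hgx hgy
    have hg0 : 0 ≤ ∫ ω, g ω ∂(coinMeasure P) := integral_nonneg hg
    set Y : Bool → ℝ := fun b => if b = true then 1 else 0 with hY
    set N : Bool → ℝ := fun b => if b = true then 0 else 1 with hN
    set X : Bool → ℝ := fun b => if b = true then θ else 1 with hX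
    have hN0 : ∀ b, 0 ≤ N b := by intro b; cases b <;> simp [hN]
    have hX0 : ∀ b, 0 ≤ X b := by intro b; cases b <;> simp [hX]; linarith
    -- The two terms are the cases that the `y`-coin of `a` comes up true or false. In the second,
    -- both coins of `a` are absorbed into the weight to which the induction hypothesis applies;
    -- this is why the statement is proved for all weights `g`.
    have hle : ∀ ω, g ω * θ ^ inBall D x y (insert a s) ω ≤
        g ω * Y (ω (y a)) +
          ((g ω * N (ω (y a))) * X (ω (x a))) * θ ^ inBall D x y s ω := by
      intro ω
      have h1 := pow_le_pow_right₀ hθ (inBall_insert_le (x := x) (y := y) ha hmin ω)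
      refine (mul_le_mul_of_nonneg_left h1 (hg ω)).trans (le_of_eq ?_)
      by_cases h2 : ω (y a) = true
      · simp [h2, hY, hN]
      · by_cases h3 : ω (x a) = true
        · simp [h2, h3, hY, hN, hX, pow_add]
          ring
        · simp [h2, h3, hY, hN, hX]
    have hxa : ∀ ω b, g (Function.update ω (x a) b) = g ω := hgx a (Finset.mem_insert_self _ _)
    have hya : ∀ ω b, g (Function.update ω (y a) b) = g ω := hgy a (Finset.mem_insert_self _ _)
    have hne : ∀ k ∈ s, k ≠ a := fun k hk h => ha (h ▸ hk)
    have hih := ih (fun ω => (g ω * N (ω (y a))) * X (ω (x a)))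
      (fun ω => mul_nonneg (mul_nonneg (hg ω) (hN0 _)) (hX0 _))
      (fun k hk ω b => by
        rw [hgx k (Finset.mem_insert_of_mem hk), Function.update_of_ne (hxy k a).symm,
          Function.update_of_ne fun h => hne k hk (hx h).symm])
      (fun k hk ω b => by
        rw [hgy k (Finset.mem_insert_of_mem hk), Function.update_of_ne (hxy a k),
          Function.update_of_ne fun h => hne k hk (hy h).symm])
    have e1 : ∫ ω, g ω * Y (ω (y a)) ∂(coinMeasure P) = p' * ∫ ω, g ω ∂(coinMeasure P) := by
      rw [integral_mul_coin _ _ hya, hp']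
      simp [hY]
    have e2 : ∫ ω, (g ω * N (ω (y a))) * X (ω (x a)) ∂(coinMeasure P) =
        (p * θ + (1 - p)) * ((1 - p') * ∫ ω, g ω ∂(coinMeasure P)) := by
      rw [integral_mul_coin (x a) (fun ω => g ω * N (ω (y a))), hp, integral_mul_coin _ _ hya, hp']
      · simp [hN, hX]
      · intro ω b
        rw [hxa, Function.update_of_ne (hxy a a).symm]
    calc ∫ ω, g ω * θ ^ inBall D x y (insert a s) ω ∂(coinMeasure P)
        ≤ ∫ ω, (g ω * Y (ω (y a)) +
          ((g ω * N (ω (y a))) * X (ω (x a))) * θ ^ inBall D x y s ω) ∂(coinMeasure P) :=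
          integral_mono Integrable.of_finite Integrable.of_finite hle
      _ = ∫ ω, g ω * Y (ω (y a)) ∂(coinMeasure P) +
          ∫ ω, ((g ω * N (ω (y a))) * X (ω (x a))) * θ ^ inBall D x y s ω ∂(coinMeasure P) :=
          integral_add Integrable.of_finite Integrable.of_finite
      _ ≤ p' * ∫ ω, g ω ∂(coinMeasure P) +
          2 * ((p * θ + (1 - p)) * ((1 - p') * ∫ ω, g ω ∂(coinMeasure P))) := by
          rw [e1]
          rw [e2] at hih
          linarith
      _ = (p' + 2 * (1 - p') * (1 + p * (θ - 1))) * ∫ ω, g ω ∂(coinMeasure P) := by ring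
      _ ≤ 2 * ∫ ω, g ω ∂(coinMeasure P) := by
          refine mul_le_mul_of_nonneg_right ?_ hg0
          -- The factor is at most `p' + 2 (1 - p') (1 + p' / 2) = 2 - p'^2`, so the constant 2
          -- reproduces itself.
          have : (1 - p') * (p * (θ - 1)) ≤ (1 - p') * (p' / 2) :=
            mul_le_mul_of_nonneg_left hpθ (by linarith)
          nlinarith [sq_nonneg p']

variable [Fintype κ]

/-- The third moment of the number of selected elements of the ball of a selected element. -/
lemma integral_inBall_cube_le {D : κ → ℝ≥0∞} {x y : κ → ι} (hx : Function.Injective x)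
    (hy : Function.Injective y) (hxy : ∀ k k', x k ≠ y k') {p p' : ℝ}
    (hp : ∀ k, (P (x k) : ℝ) = p) (hp' : ∀ k, (P (y k) : ℝ) = p') (hp0 : 0 < p')
    (hpp : p' ≤ p) (hp1 : p' ≤ 1) (heq : p ^ 4 = p' ^ 3) (α : κ) :
    ∫ ω, (if ω (x α) = true then (1 : ℝ) else 0) *
      (inBall D x y Finset.univ ω : ℝ) ^ 3 ∂(coinMeasure P) ≤ 43904 := by
  have hpos : 0 < p := hp0.trans_le hpp
  -- Since `(1 + s)^3 - 1 ≤ 7 s`, the divisor 14 gives exactly the condition `p * (θ - 1) ≤ p' / 2`.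
  set s : ℝ := p' / (14 * p) with hs
  have hs0 : 0 < s := by positivity
  have hs1 : s ≤ 1 := by
    rw [hs, div_le_one (by positivity)]
    linarith
  set θ : ℝ := (1 + s) ^ 3 with hθ
  have hθ1 : 1 ≤ θ := one_le_pow₀ (by linarith)
  have hθ8 : θ ≤ 8 := by
    calc θ ≤ (1 + 1) ^ 3 := by
          rw [hθ]
          gcongr
      _ = 8 := by norm_num
  have hθs : p * (θ - 1) ≤ p' / 2 := by
    have h1 : θ - 1 ≤ 7 * s := by
      rw [hθ]
      nlinarith [mul_nonneg hs0.le (sub_nonneg.2 hs1), mul_nonneg (mul_nonneg hs0.le hs0.le)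
        (sub_nonneg.2 hs1)]
    calc p * (θ - 1) ≤ p * (7 * s) := by gcongr
      _ = p' / 2 := by
        rw [hs]
        field_simp
        norm_num
  have hpt : ∀ m : ℕ, (m : ℝ) ^ 3 ≤ s⁻¹ ^ 3 * θ ^ m := by
    intro m
    have h1 : 1 + (m : ℝ) * s ≤ (1 + s) ^ m := one_add_mul_le_pow (by linarith) m
    have h2 : (m * s : ℝ) ^ 3 ≤ θ ^ m := by
      rw [hθ, ← pow_mul, mul_comm 3 m, pow_mul]
      gcongr
      linarith
    rw [inv_pow, ← div_eq_inv_mul, le_div_iff₀ (by positivity), ← mul_pow]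
    exact h2
  set X : Bool → ℝ := fun b => if b = true then 1 else 0 with hX
  have hX0 : ∀ b, 0 ≤ X b := by intro b; cases b <;> simp [hX]
  have hne : ∀ k ∈ Finset.univ.erase α, k ≠ α := fun k hk => Finset.ne_of_mem_erase hk
  -- The element `α` is left out because its `x`-coin serves as the weight; it adds at most one to
  -- the ball, which costs one factor `θ ≤ 8`.
  have hmain := integral_pow_inBall_le (P := P) (D := D) hx hy hxy hp hp' hp1 hθ1 hθs
    (Finset.univ.erase α) (fun ω => X (ω (x α))) (fun ω => hX0 _)
    (fun k hk ω b => by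
      rw [Function.update_of_ne fun h => hne k hk (hx h).symm])
    (fun k hk ω b => by
      rw [Function.update_of_ne (hxy α k)])
  have hXint : ∫ ω, X (ω (x α)) ∂(coinMeasure P) = p := by
    have := integral_mul_coin (P := P) (x α) (fun _ => 1) (fun _ _ => rfl) X
    simpa [hX, hp] using this
  have hle : ∀ ω : ι → Bool, (if ω (x α) = true then (1 : ℝ) else 0) *
      (inBall D x y Finset.univ ω : ℝ) ^ 3 ≤
      (s⁻¹ ^ 3 * θ) * (X (ω (x α)) * θ ^ inBall D x y (Finset.univ.erase α) ω) := by
    intro ω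
    have h1 := (hpt (inBall D x y Finset.univ ω)).trans (mul_le_mul_of_nonneg_left
      (pow_le_pow_right₀ hθ1 (inBall_univ_le α ω)) (by positivity))
    refine (mul_le_mul_of_nonneg_left h1 (hX0 _)).trans (le_of_eq ?_)
    rw [pow_add, pow_one]
    ring
  refine (integral_mono Integrable.of_finite Integrable.of_finite hle).trans ?_
  rw [integral_const_mul]
  rw [hXint] at hmain
  calc s⁻¹ ^ 3 * θ * ∫ ω, X (ω (x α)) * θ ^ inBall D x y (Finset.univ.erase α) ω ∂(coinMeasure P)
      ≤ s⁻¹ ^ 3 * 8 * (2 * p) := by gcongr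
    -- `43904 = 14^3 · 8 · 2`. One factor `p` selects the centre, and `(p / p')^3` is the scale of
    -- the cube.
    _ = 43904 * (p ^ 4 / p' ^ 3) := by
      rw [hs]
      field_simp
      norm_num
    _ = 43904 := by
      rw [heq, div_self (by positivity), mul_one]

end Coins

end

end PathOracle

/-! ### Counting the stored words and their expectation. -/

namespace PathOracle

noncomputable section

/-! ### The number of stored words -/

section Space

variable {n : ℕ} {G : SimpleGraph (Fin n)} {w : Sym2 (Fin n) → ℝ≥0}

lemma Table.entries_le {K X : Type} [Fintype K] (t : Table K X) : t.entries ≤ Fintype.card K :=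
  Finset.card_le_univ _

lemma ends_entries_le {P : Set (Fin n × Fin n)} {U : Finset (Fin n × Fin n)}
    (hU : ∀ k ∈ P, k ∈ U) : (mkDPPRO G w P).ends.entries ≤ U.card := by
  refine Finset.card_le_card fun k hk => ?_
  rw [Finset.mem_filter] at hk
  by_contra hn
  have : k ∉ P := fun h => hn (hU k h)
  simp [mkDPPRO, this] at hk

lemma branch_entries_le {P : Set (Fin n × Fin n)}
    {U : Finset ((Fin n × Fin n) × (Fin n × Fin n))}
    (hU : ∀ p q z, IsBranching G w P p q z → (p, q) ∈ U) :
    (mkDPPRO G w P).branch.entries ≤ 2 * U.card := by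
  classical
  have hbr : ∀ k, ((mkDPPRO G w P).branch k).isSome = true → IsBranching G w P k.1 k.2.1 k.2.2 := by
    intro k hk
    by_contra hn
    simp [mkDPPRO, hn] at hk
  refine Finset.card_le_mul_card_image_of_maps_to (f := fun k => (k.1, k.2.1)) ?_ 2 ?_
  · intro k hk
    exact hU _ _ k.2.2 (hbr k (Finset.mem_filter.1 hk).2)
  · rintro ⟨p, q⟩ -
    refine le_trans ?_ (card_branching_le_two (G := G) (w := w) P p q)
    rw [← Set.ncard_coe_finset]
    refine Set.ncard_le_ncard_of_injOn (fun k => k.2.2) ?_ ?_ (Set.toFinite _)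
    · rintro ⟨p', q', z⟩ hk
      simp only [Finset.coe_filter, Finset.mem_filter, Finset.mem_univ, true_and, Prod.mk.injEq,
        Set.mem_ofPred_eq] at hk
      obtain ⟨h1, rfl, rfl⟩ := hk
      exact hbr _ h1
    · rintro ⟨p', q', z⟩ hk ⟨p'', q'', z'⟩ hk' h
      simp only [Finset.coe_filter, Finset.mem_filter, Finset.mem_univ, true_and, Prod.mk.injEq,
        Set.mem_ofPred_eq] at hk hk' h
      obtain ⟨-, rfl, rfl⟩ := hk
      obtain ⟨-, rfl, rfl⟩ := hk'
      rw [h]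

lemma gdist_le_of_mem_canonPath {u v z : Fin n} (h : z ∈ canonPath G w u v) :
    gdist G w u z ≤ gdist G w u v ∧ gdist G w z v ≤ gdist G w u v := by
  obtain ⟨p, hp, hpl⟩ := canonPath_of_mem h
  rw [hpl] at h
  obtain ⟨l₁, l₂, hl⟩ := List.append_of_mem h
  obtain ⟨p₁, p₂, rfl, -, -⟩ := exists_append_of_support_eq p hl
  rw [hp.gdist_eq, wlen_append]
  push_cast
  exact ⟨(gdist_le_wlen p₁).trans le_self_add, (gdist_le_wlen p₂).trans le_add_self⟩

open Classical in
/-- The elements of `L` that are nearer to `a` than all elements of `L'`. -/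
def ballLandmarks (G : SimpleGraph (Fin n)) (w : Sym2 (Fin n) → ℝ≥0) (L L' : Set (Fin n))
    (a : Fin n) : Finset (Fin n) :=
  Finset.univ.filter fun x => x ∈ L ∧ gdist G w a x < radius G w L' a

open Classical in
/-- The triples of elements of `L` in the ball of an element of `L`. -/
def ballTuples (G : SimpleGraph (Fin n)) (w : Sym2 (Fin n) → ℝ≥0) (L L' : Set (Fin n)) :
    Finset (Σ _ : Fin n, Fin n × Fin n × Fin n) :=
  (Finset.univ.filter fun a => a ∈ L).sigma fun a =>
    ballLandmarks G w L L' a ×ˢ ballLandmarks G w L L' a ×ˢ ballLandmarks G w L L' a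

variable {L L' : Set (Fin n)}

open Classical in
lemma card_ballTuples : (ballTuples G w L L').card =
    ∑ a with a ∈ L, (ballLandmarks G w L L' a).card ^ 3 := by
  rw [ballTuples, Finset.card_sigma]
  refine Finset.sum_congr rfl fun a _ => ?_
  simp only [Finset.card_product]
  ring

lemma mem_ballTuples {a b c d : Fin n} (ha : a ∈ L) (hb : b ∈ L) (hc : c ∈ L) (hd : d ∈ L)
    (hab : gdist G w a b < radius G w L' a) (hac : gdist G w a c < radius G w L' a)
    (had : gdist G w a d < radius G w L' a) : ⟨a, b, c, d⟩ ∈ ballTuples G w L L' := by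
  simp [ballTuples, ballLandmarks, *]

lemma lt_radius_of_near {a b z c : Fin n} (hab : gdist G w a b < radius G w L' a / 3)
    (haz : gdist G w a z ≤ gdist G w a b) (hzc : gdist G w z c ≤ gdist G w a b) :
    gdist G w a c < radius G w L' a := by
  rw [ENNReal.lt_div_iff_mul_lt (by simp) (by simp)] at hab
  refine lt_of_le_of_lt ?_ hab
  calc gdist G w a c ≤ gdist G w a b + gdist G w a b :=
        (gdist_triangle a z c).trans (add_le_add haz hzc)
    _ = gdist G w a b * 2 := by ring
    _ ≤ gdist G w a b * 3 := by
        gcongr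
        norm_num

/-- The set `P` consists of pairs of elements of `L`, one of which lies in the one-third-ball
of the other one with respect to `L'`. -/
def NearPairs (G : SimpleGraph (Fin n)) (w : Sym2 (Fin n) → ℝ≥0) (L L' : Set (Fin n))
    (P : Set (Fin n × Fin n)) : Prop :=
  ∀ u v, (u, v) ∈ P → u ∈ L ∧ v ∈ L ∧
    (gdist G w u v < radius G w L' u / 3 ∨ gdist G w v u < radius G w L' v / 3)

/-- The centre is an end of the longer path whose one-third-ball contains the other end. From it one
reaches `z`, and then either end of the shorter path, by two legs of at most the longer length,
hence within twice a length smaller than a third of the radius. -/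
lemma exists_ballTuple {P : Set (Fin n × Fin n)} (hP : NearPairs G w L L' P) {u v x y z : Fin n}
    (huv : (u, v) ∈ P) (hx : x ∈ L) (hy : y ∈ L)
    (hz : z ∈ canonPath G w u v) (hz' : z ∈ canonPath G w x y)
    (hle : gdist G w x y ≤ gdist G w u v) :
    ⟨u, v, x, y⟩ ∈ ballTuples G w L L' ∨ ⟨v, u, x, y⟩ ∈ ballTuples G w L L' := by
  obtain ⟨hu, hv, h⟩ := hP u v huv
  obtain ⟨h1, h2⟩ := gdist_le_of_mem_canonPath hz
  obtain ⟨h3, h4⟩ := gdist_le_of_mem_canonPath hz'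
  rw [gdist_comm] at h3
  have h3 := h3.trans hle
  have h4 := h4.trans hle
  rcases h with h | h
  · left
    exact mem_ballTuples hu hv hx hy (lt_radius_of_near h (by simp) le_rfl)
      (lt_radius_of_near h h1 h3) (lt_radius_of_near h h1 h4)
  · right
    rw [gdist_comm u v] at h2 h3 h4
    rw [gdist_comm z v] at h2
    exact mem_ballTuples hv hu hx hy (lt_radius_of_near h (by simp) le_rfl)
      (lt_radius_of_near h h2 h3) (lt_radius_of_near h h2 h4)

/-- A quadruple determines the pair of paths up to which path comes first and which end of the
longer one is the centre. These four options times two branching vertices give 8. -/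
lemma branch_entries_le_of_nearPairs {P : Set (Fin n × Fin n)} (hP : NearPairs G w L L' P) :
    (mkDPPRO G w P).branch.entries ≤ 8 * (ballTuples G w L L').card := by
  classical
  set T := ballTuples G w L L'
  let V := Fin n
  let U : Finset ((V × V) × (V × V)) :=
    (T.image (fun t => ((t.1, t.2.1), t.2.2)) ∪ T.image (fun t => ((t.2.1, t.1), t.2.2))) ∪
      (T.image (fun t => (t.2.2, (t.1, t.2.1))) ∪ T.image (fun t => (t.2.2, (t.2.1, t.1))))
  have hcard : U.card ≤ 4 * T.card := by
    refine (Finset.card_union_le _ _).trans ?_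
    refine (add_le_add (Finset.card_union_le _ _) (Finset.card_union_le _ _)).trans ?_
    have h1 : ∀ f : (Σ _ : Fin n, Fin n × Fin n × Fin n) → (V × V) × (V × V),
        (T.image f).card ≤ T.card := fun f => Finset.card_image_le
    have e1 := h1 fun t => ((t.1, t.2.1), t.2.2)
    have e2 := h1 fun t => ((t.2.1, t.1), t.2.2)
    have e3 := h1 fun t => (t.2.2, (t.1, t.2.1))
    have e4 := h1 fun t => (t.2.2, (t.2.1, t.1))
    omega
  refine (branch_entries_le (U := U) ?_).trans (by omega)
  rintro ⟨u, v⟩ ⟨x, y⟩ z ⟨hp, hq, -, hz, hz', -⟩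
  obtain ⟨hu, hv, -⟩ := hP u v hp
  obtain ⟨hx, hy, -⟩ := hP x y hq
  simp only [U, Finset.mem_union, Finset.mem_image]
  rcases le_total (gdist G w x y) (gdist G w u v) with hle | hle
  · left
    exact (exists_ballTuple hP hp hx hy hz hz' hle).imp (fun h => ⟨_, h, rfl⟩)
      (fun h => ⟨_, h, rfl⟩)
  · right
    exact (exists_ballTuple hP hq hu hv hz' hz hle).imp (fun h => ⟨_, h, rfl⟩)
      (fun h => ⟨_, h, rfl⟩)

lemma ends_entries_le_of_nearPairs {P : Set (Fin n × Fin n)} (hP : NearPairs G w L L' P) :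
    (mkDPPRO G w P).ends.entries ≤ 2 * (ballTuples G w L L').card := by
  classical
  set T := ballTuples G w L L'
  refine (ends_entries_le
    (U := T.image (fun t => (t.1, t.2.1)) ∪ T.image (fun t => (t.2.1, t.1))) ?_).trans ?_
  · rintro ⟨u, v⟩ huv
    obtain ⟨hu, hv, h⟩ := hP u v huv
    simp only [Finset.mem_union, Finset.mem_image]
    rcases h with h | h
    · left
      have h' := lt_radius_of_near h (z := u) (c := v) (by simp) le_rfl
      exact ⟨⟨u, v, v, v⟩, mem_ballTuples hu hv hv hv h' h' h', rfl⟩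
    · right
      have h' := lt_radius_of_near h (z := v) (c := u) (by simp) le_rfl
      exact ⟨⟨v, u, u, u⟩, mem_ballTuples hv hu hu hu h' h' h', rfl⟩
  · refine (Finset.card_union_le _ _).trans ?_
    rw [two_mul]
    exact add_le_add Finset.card_image_le Finset.card_image_le

/-- The constants are `8 = 3 + 5` for forest and home records, and `80 = 9 · 8 + 4 · 2` for
branching and end records. -/
lemma words_level_le_of_lt {h i : ℕ} (L : ℕ → Set (Fin n)) (hi : i < h) :
    (level G w h L i).words ≤ 8 * n + 80 * (ballTuples G w (L i) (L (i + 1))).card := by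
  have hP : NearPairs G w (L i) (L (i + 1)) (levelPairs G w h L i) := by
    rintro u v ⟨h1, h2, -, h3⟩
    exact ⟨h1, h2, (h3.resolve_right fun h => hi.ne h.1).2⟩
  have h1 := branch_entries_le_of_nearPairs hP
  have h2 := ends_entries_le_of_nearPairs hP
  have h3 := (mkDPPRO G w (levelPairs G w h L i)).home.entries_le
  have h4 := (mkForest G w (L i)).entries_le
  rw [Fintype.card_fin] at h3 h4
  simp only [Level.words, level, DPPRO.words]
  omega

open Classical in
lemma words_level_le_top {h : ℕ} (L : ℕ → Set (Fin n)) :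
    (level G w h L h).words ≤ 8 * n + 22 * (Finset.univ.filter fun a => a ∈ L h).card ^ 4 := by
  set S := Finset.univ.filter fun a => a ∈ L h
  have hP : ∀ k ∈ levelPairs G w h L h, k ∈ S ×ˢ S := by
    rintro ⟨u, v⟩ ⟨h1, h2, -⟩
    simp only [Finset.mem_product, S, Finset.mem_filter, Finset.mem_univ, true_and]
    exact ⟨h1, h2⟩
  have h1 := branch_entries_le (G := G) (w := w) (U := (S ×ˢ S) ×ˢ (S ×ˢ S))
    (fun p q z h => Finset.mem_product.2 ⟨hP p h.1, hP q h.2.1⟩)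
  have h2 := ends_entries_le (G := G) (w := w) hP
  have h3 := (mkDPPRO G w (levelPairs G w h L h)).home.entries_le
  have h4 := (mkForest G w (L h)).entries_le
  rw [Fintype.card_fin] at h3 h4
  simp only [Finset.card_product] at h1 h2
  have h5 : S.card * S.card ≤ S.card ^ 4 := by
    rw [← pow_two]
    rcases Nat.eq_zero_or_pos S.card with h | h
    · simp [h]
    · exact Nat.pow_le_pow_right h (by norm_num)
  have h6 : S.card * S.card * (S.card * S.card) = S.card ^ 4 := by ring
  simp only [Level.words, level, DPPRO.words]
  omega

end Space

/-! ### The expected number of stored words -/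

section ExpectedSpace

variable {n : ℕ}

lemma sum_degree_le (G : SimpleGraph (Fin n)) :
    ∑ v, (G.neighborSet v).ncard ≤ 2 * G.edgeSet.ncard := by
  classical
  have h1 : ∀ v, (G.neighborSet v).ncard = G.degree v := fun v => by
    rw [← G.card_neighborSet_eq_degree v, Set.ncard_eq_toFinset_card', Set.toFinset_card]
  have h2 : G.edgeSet.ncard = G.edgeFinset.card := by
    rw [Set.ncard_eq_toFinset_card']
    rfl
  simp only [h1, h2]
  exact G.sum_degrees_eq_twice_card_edges.le

lemma density_nonneg (G : SimpleGraph (Fin n)) : 0 ≤ density G := by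
  unfold density
  positivity

/-- In the density variant the degrees divided by `m / n` sum to at most `2n`, and rounding up adds
at most `n`. -/
lemma sum_copies_le (G : SimpleGraph (Fin n)) (var : Variant) :
    ∑ v, var.copies G v ≤ 3 * n := by
  cases var with
  | byArboricity =>
    simp only [Variant.copies, Finset.sum_const, Finset.card_univ, Fintype.card_fin, smul_eq_mul]
    omega
  | byDensity =>
    simp only [Variant.copies]
    rcases (density_nonneg G).eq_or_lt with h0 | h0
    · simp [← h0]
    have hn : 0 < (n : ℝ) := by
      rcases Nat.eq_zero_or_pos n with rfl | h
      · simp [density] at h0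
      · exact_mod_cast h
    have h1 : ∀ v ∈ (Finset.univ : Finset (Fin n)),
        ((⌈((G.neighborSet v).ncard : ℝ) / density G⌉₊ : ℕ) : ℝ) ≤
          ((G.neighborSet v).ncard : ℝ) / density G + 1 := fun v _ =>
      (Nat.ceil_lt_add_one (by positivity)).le
    have h2 := Finset.sum_le_sum h1
    rw [Finset.sum_add_distrib, ← Finset.sum_div, Finset.sum_const, Finset.card_univ,
      Fintype.card_fin, nsmul_eq_mul, mul_one] at h2
    have h3 : (∑ v, ((G.neighborSet v).ncard : ℝ)) ≤ 2 * G.edgeSet.ncard := by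
      exact_mod_cast sum_degree_le G
    have h4 : (∑ v, ((G.neighborSet v).ncard : ℝ)) / density G ≤ 2 * n := by
      rw [div_le_iff₀ h0]
      refine h3.trans (le_of_eq ?_)
      unfold density
      field_simp
    have : ((∑ v, ⌈((G.neighborSet v).ncard : ℝ) / density G⌉₊ : ℕ) : ℝ) ≤ 3 * n := by
      push_cast
      linarith
    exact_mod_cast this

lemma rho_div_eq {n : ℕ} (hn : 1 ≤ n) (h i : ℕ) :
    rho n h i / n = (n : ℝ) ^ (-(3 / 4 : ℝ) ^ (h + 1 - i)) := by
  have hn0 : (0 : ℝ) < n := by exact_mod_cast hn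
  rw [rho, div_eq_iff hn0.ne', sub_eq_neg_add, Real.rpow_add hn0, Real.rpow_one]

variable {G : SimpleGraph (Fin n)} {w : Sym2 (Fin n) → ℝ≥0} {h : ℕ} {var : Variant}

instance : IsProbabilityMeasure (coinLaw G h var) := by
  unfold coinLaw
  infer_instance

lemma mem_landmarks {ω : Coins G h var} (j : Fin h) {k : Σ v : Fin n, Fin (var.copies G v)}
    (hk : ω (j, k) = true) : k.1 ∈ landmarks G h var ω (j + 1) :=
  ⟨j, rfl, k.2, hk⟩

lemma exists_of_mem_landmarks {ω : Coins G h var} (j : Fin h) {v : Fin n}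
    (hv : v ∈ landmarks G h var ω (j + 1)) :
    ∃ k : Σ v : Fin n, Fin (var.copies G v), k.1 = v ∧ ω (j, k) = true := by
  obtain ⟨j', hj, c, hc⟩ := hv
  obtain rfl : j' = j := Fin.ext (by omega)
  exact ⟨⟨v, c⟩, rfl, hc⟩

open Classical in
lemma card_landmarks_le (ω : Coins G h var) (j : Fin h) :
    (Finset.univ.filter fun a => a ∈ landmarks G h var ω (j + 1)).card ≤
      (Finset.univ.filter fun k => ω (j, k) = true).card := by
  refine le_trans (Finset.card_le_card fun v hv => ?_) (Finset.card_image_le (f := Sigma.fst))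
  obtain ⟨k, rfl, hk⟩ := exists_of_mem_landmarks j (Finset.mem_filter.1 hv).2
  exact Finset.mem_image_of_mem _ (Finset.mem_filter.2 ⟨Finset.mem_univ _, hk⟩)

lemma card_ballLandmarks_le (ω : Coins G h var) (j j' : Fin h) (hj : (j' : ℕ) = j + 1)
    (a : Fin n) :
    (ballLandmarks G w (landmarks G h var ω (j + 1)) (landmarks G h var ω (j + 1 + 1)) a).card ≤
      inBall (fun k : Σ v : Fin n, Fin (var.copies G v) => gdist G w a k.1)
        (fun k => (j, k)) (fun k => (j', k)) Finset.univ ω := by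
  classical
  unfold inBall
  refine le_trans (Finset.card_le_card fun v hv => ?_) (Finset.card_image_le (f := Sigma.fst))
  simp only [ballLandmarks, Finset.mem_filter, Finset.mem_univ, true_and] at hv
  obtain ⟨k, rfl, hk⟩ := exists_of_mem_landmarks j hv.1
  refine Finset.mem_image_of_mem _ ?_
  simp only [Finset.mem_filter, Finset.mem_univ, true_and, forall_true_left]
  refine ⟨hk, fun k' hk' => ?_⟩
  have := mem_landmarks j' hk'
  rw [hj] at this
  exact hv.2.trans_le (radius_le this)

/-- Passing from landmarks to selected copies only increases the count, and it turns the sum into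
one over independent coins with a common probability on each level. -/
lemma card_ballTuples_le (ω : Coins G h var) (j j' : Fin h) (hj : (j' : ℕ) = j + 1) :
    ((ballTuples G w (landmarks G h var ω (j + 1))
      (landmarks G h var ω (j + 1 + 1))).card : ℝ) ≤
      ∑ α : Σ v : Fin n, Fin (var.copies G v), (if ω (j, α) = true then (1 : ℝ) else 0) *
        (inBall (fun k : Σ v : Fin n, Fin (var.copies G v) => gdist G w α.1 k.1)
          (fun k => (j, k)) (fun k => (j', k)) Finset.univ ω : ℝ) ^ 3 := by
  classical
  set f : Fin n → ℕ := fun a => inBall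
    (fun k : Σ v : Fin n, Fin (var.copies G v) => gdist G w a k.1)
    (fun k => (j, k)) (fun k => (j', k)) Finset.univ ω with hf
  have h1 : (ballTuples G w (landmarks G h var ω (j + 1))
      (landmarks G h var ω (j + 1 + 1))).card ≤
      ∑ α : Σ v : Fin n, Fin (var.copies G v), if ω (j, α) = true then f α.1 ^ 3 else 0 := by
    rw [card_ballTuples, ← Finset.sum_filter]
    calc ∑ a with a ∈ landmarks G h var ω (j + 1), (ballLandmarks G w
          (landmarks G h var ω (j + 1)) (landmarks G h var ω (j + 1 + 1)) a).card ^ 3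
        ≤ ∑ a with a ∈ landmarks G h var ω (j + 1), f a ^ 3 :=
          Finset.sum_le_sum fun a _ =>
            Nat.pow_le_pow_left (card_ballLandmarks_le ω j j' hj a) 3
      _ ≤ ∑ a ∈ (Finset.univ.filter fun k : Σ v : Fin n, Fin (var.copies G v) =>
            ω (j, k) = true).image Sigma.fst, f a ^ 3 := by
          refine Finset.sum_le_sum_of_subset fun v hv => ?_
          obtain ⟨k, rfl, hk⟩ := exists_of_mem_landmarks j (Finset.mem_filter.1 hv).2
          exact Finset.mem_image_of_mem _ (Finset.mem_filter.2 ⟨Finset.mem_univ _, hk⟩)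
      _ ≤ ∑ k : Σ v : Fin n, Fin (var.copies G v) with ω (j, k) = true, f k.1 ^ 3 :=
          Finset.sum_image_le_of_nonneg (fun _ _ => Nat.zero_le _)
  refine le_trans (Nat.cast_le.2 h1) (le_of_eq ?_)
  push_cast
  refine Finset.sum_congr rfl fun α _ => ?_
  split_ifs <;> simp [hf]

lemma card_copies_le (G : SimpleGraph (Fin n)) (var : Variant) :
    (Fintype.card (Σ v : Fin n, Fin (var.copies G v)) : ℝ) ≤ 3 * n := by
  have := sum_copies_le G var
  simp only [Fintype.card_sigma, Fintype.card_fin]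
  exact_mod_cast this

lemma integral_words_level_le (hn : 1 ≤ n) (j : Fin h) :
    ∫ ω, ((level G w h (landmarks G h var ω) (j + 1)).words : ℝ) ∂(coinLaw G h var) ≤
      3 * 10 ^ 8 * n := by
  classical
  have hn1 : (1 : ℝ) ≤ n := by exact_mod_cast hn
  have hn0 : (0 : ℝ) < n := by linarith
  have hcard := card_copies_le G var
  have hj := j.2
  set p : ℝ := rho n h (j + 1) / n with hp
  have hpe : p = (n : ℝ) ^ (-(3 / 4 : ℝ) ^ (h + 1 - (j + 1))) := rho_div_eq hn h (j + 1)
  have hp0 : 0 < p := by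
    rw [hpe]
    positivity
  have hinj : ∀ i : Fin h, Function.Injective
      fun k : Σ v : Fin n, Fin (var.copies G v) => (i, k) := fun i a b hab =>
    (Prod.ext_iff.1 hab).2
  by_cases htop : (j : ℕ) + 1 = h
  · set m : ℝ := (n : ℝ) ^ (1 / 4 : ℝ) with hm
    have hm4 : m ^ 4 = n := by
      rw [hm, ← Real.rpow_natCast, ← Real.rpow_mul hn0.le]
      norm_num
    have hm1 : 1 ≤ m := Real.one_le_rpow hn1 (by norm_num)
    have hpm : p * n = m := by
      rw [hpe, show h + 1 - ((j : ℕ) + 1) = 1 by omega, hm]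
      nth_rewrite 2 [← Real.rpow_one (n : ℝ)]
      rw [← Real.rpow_add hn0]
      norm_num
    -- The expected number of selected copies is at most `3 m` with `m = n^(1/4)`, so the fourth
    -- moment is linear in `n`.
    have hint := integral_card_pow_four_le
      (P := fun x : Fin h × (Σ v : Fin n, Fin (var.copies G v)) =>
        ⟨rho n h (x.1 + 1) / n, rho_div_mem n h (x.1 + 1)⟩)
      (hinj j) (p := p) (m := m) (fun k => rfl) hp0.le hm1 (by nlinarith)
    calc ∫ ω, ((level G w h (landmarks G h var ω) (j + 1)).words : ℝ) ∂(coinLaw G h var)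
        ≤ ∫ ω, (8 * (n : ℝ) + 22 * ((Finset.univ.filter fun k => ω (j, k) = true).card : ℝ) ^ 4)
            ∂(coinLaw G h var) := by
          refine integral_mono Integrable.of_finite Integrable.of_finite fun ω => ?_
          have h1 := words_level_le_top (G := G) (w := w) (h := h) (landmarks G h var ω)
          have h2 := Nat.pow_le_pow_left (card_landmarks_le ω j) 4
          rw [htop] at h2 ⊢
          have h3 : (level G w h (landmarks G h var ω) h).words ≤
              8 * n + 22 * (Finset.univ.filter fun k => ω (j, k) = true).card ^ 4 := by omega
          simp only
          exact_mod_cast h3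
      _ = 8 * n + 22 * ∫ ω, ((Finset.univ.filter fun k => ω (j, k) = true).card : ℝ) ^ 4
            ∂(coinLaw G h var) := by
          rw [integral_add Integrable.of_finite Integrable.of_finite, integral_const_mul,
            integral_const_mul]
          simp
      _ ≤ 8 * n + 22 * (3 * 45 ^ 4 * m ^ 4) := by
          gcongr
          exact hint
      _ ≤ 3 * 10 ^ 8 * n := by
          rw [hm4]
          linarith
  · set j' : Fin h := ⟨j + 1, by omega⟩ with hj'
    set p' : ℝ := rho n h (j' + 1) / n with hp'
    have hpe' : p' = (n : ℝ) ^ (-(3 / 4 : ℝ) ^ (h + 1 - (j' + 1))) := rho_div_eq hn h (j' + 1)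
    have hp0' : 0 < p' := by
      rw [hpe']
      positivity
    have hjv : (j' : ℕ) = j + 1 := rfl
    obtain ⟨m, hm⟩ : ∃ m, h + 1 - ((j' : ℕ) + 1) = m := ⟨_, rfl⟩
    have hm' : h + 1 - ((j : ℕ) + 1) = m + 1 := by omega
    rw [hm] at hpe'
    rw [hm'] at hpe
    have hpp : p' ≤ p := by
      rw [hpe, hpe']
      refine Real.rpow_le_rpow_of_exponent_le hn1 (neg_le_neg ?_)
      exact pow_le_pow_of_le_one (by norm_num) (by norm_num) (by omega)
    -- This relation is what the exponents `α_i` are made for: the exponent of `p` is `3/4` of that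
    -- of `p'`.
    have heq : p ^ 4 = p' ^ 3 := by
      rw [hpe, hpe', ← Real.rpow_mul_natCast hn0.le, ← Real.rpow_mul_natCast hn0.le]
      congr 1
      push_cast
      ring
    have hint := fun α : Σ v : Fin n, Fin (var.copies G v) => integral_inBall_cube_le
      (P := fun x : Fin h × (Σ v : Fin n, Fin (var.copies G v)) =>
        ⟨rho n h (x.1 + 1) / n, rho_div_mem n h (x.1 + 1)⟩)
      (D := fun k => gdist G w α.1 k.1)
      (hinj j) (hinj j') (fun k k' hkk => by
        have := congrArg Fin.val (Prod.ext_iff.1 hkk).1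
        simp only at this
        omega) (p := p) (p' := p') (fun k => rfl) (fun k => rfl) hp0' hpp
      (rho_div_mem n h (j' + 1)).2 heq α
    calc ∫ ω, ((level G w h (landmarks G h var ω) (j + 1)).words : ℝ) ∂(coinLaw G h var)
        ≤ ∫ ω, (8 * (n : ℝ) + 80 * ∑ α : Σ v : Fin n, Fin (var.copies G v),
            (if ω (j, α) = true then (1 : ℝ) else 0) *
            (inBall (fun k : Σ v : Fin n, Fin (var.copies G v) => gdist G w α.1 k.1)
              (fun k => (j, k)) (fun k => (j', k)) Finset.univ ω : ℝ) ^ 3)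
            ∂(coinLaw G h var) := by
          refine integral_mono Integrable.of_finite Integrable.of_finite fun ω => ?_
          have h1 := words_level_le_of_lt (G := G) (w := w) (h := h) (i := j + 1)
            (landmarks G h var ω) (by omega)
          have h2 := card_ballTuples_le (w := w) ω j j' hjv
          have h3 : ((level G w h (landmarks G h var ω) (j + 1)).words : ℝ) ≤
              8 * n + 80 * ((ballTuples G w (landmarks G h var ω (j + 1))
                (landmarks G h var ω (j + 1 + 1))).card : ℝ) := by exact_mod_cast h1
          exact h3.trans (by gcongr)
      _ = 8 * n + 80 * ∑ α : Σ v : Fin n, Fin (var.copies G v),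
            ∫ ω, (if ω (j, α) = true then (1 : ℝ) else 0) *
            (inBall (fun k : Σ v : Fin n, Fin (var.copies G v) => gdist G w α.1 k.1)
              (fun k => (j, k)) (fun k => (j', k)) Finset.univ ω : ℝ) ^ 3
            ∂(coinLaw G h var) := by
          rw [integral_add Integrable.of_finite Integrable.of_finite, integral_const_mul,
            integral_const_mul, integral_finsetSum _ fun _ _ => Integrable.of_finite]
          simp
      _ ≤ 8 * n + 80 * ∑ α : Σ v : Fin n, Fin (var.copies G v), 43904 := by
          gcongr with α _
          exact hint α
      _ ≤ 3 * 10 ^ 8 * n := by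
          rw [Finset.sum_const, Finset.card_univ, nsmul_eq_mul]
          linarith

/-- The expected extra space is linear in the number of vertices times the number of levels. -/
theorem expectedSpace_le (hn : 1 ≤ n) : expectedSpace G w h var ≤ 3 * 10 ^ 8 * n * h := by
  have hwords : ∀ ω, ((Lambda G w h var ω).extraWords : ℝ) =
      ∑ j : Fin h, ((level G w h (landmarks G h var ω) (j + 1)).words : ℝ) := by
    intro ω
    rw [Fin.sum_univ_eq_sum_range
      (fun j => ((level G w h (landmarks G h var ω) (j + 1)).words : ℝ)) h]
    simp only [Oracle.extraWords, Lambda, mkOracle, List.map_map]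
    rw [← Nat.cast_sum]
    rfl
  unfold expectedSpace
  simp only [hwords]
  rw [integral_finsetSum _ fun _ _ => Integrable.of_finite]
  refine (Finset.sum_le_sum fun j _ => integral_words_level_le hn j).trans (le_of_eq ?_)
  rw [Finset.sum_const, Finset.card_univ, Fintype.card_fin, nsmul_eq_mul]
  ring

end ExpectedSpace

end

end PathOracle

/-! ### Sizes of the first-level balls, query time, and the final bounds. -/

namespace PathOracle

noncomputable section

/-! ### The number of edges in a ball -/

section BallEdges

variable {n : ℕ} {G : SimpleGraph (Fin n)} {w : Sym2 (Fin n) → ℝ≥0}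

open Classical in
/-- The vertices at distance less than `R` from `s`. -/
def ball (G : SimpleGraph (Fin n)) (w : Sym2 (Fin n) → ℝ≥0) (R : ℝ≥0∞) (s : Fin n) :
    Finset (Fin n) := Finset.univ.filter fun x => gdist G w s x < R

lemma mem_ball {R : ℝ≥0∞} {s x : Fin n} : x ∈ ball G w R s ↔ gdist G w s x < R := by
  simp [ball]

open Classical in
lemma length_relaxed_le_card (R : ℝ≥0∞) (s x : Fin n) :
    (relaxed G w R s x).length ≤ ((ball G w R s).filter fun y => G.Adj x y).card := by
  rw [length_relaxed]
  refine Finset.card_le_card fun y hy => ?_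
  simp only [Finset.mem_filter, Finset.mem_univ, true_and, mem_ball] at hy ⊢
  refine ⟨lt_of_le_of_lt ?_ hy.2, hy.1⟩
  refine (gdist_triangle s x y).trans ?_
  gcongr
  exact gdist_le_of_adj hy.1

lemma ballEdges_eq (R : ℝ≥0∞) (s : Fin n) :
    ballEdges G w R s = ∑ x ∈ ball G w R s, (relaxed G w R s x).length := by
  classical
  rw [ballEdges, ball, Finset.sum_filter_of_ne]
  intro x _ hx
  rw [length_relaxed] at hx
  obtain ⟨y, hy⟩ := Finset.card_pos.1 (Nat.pos_of_ne_zero hx)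
  simp only [Finset.mem_filter, Finset.mem_univ, true_and] at hy
  exact le_self_add.trans_lt hy.2

lemma ballEdges_le_sq (R : ℝ≥0∞) (s : Fin n) : ballEdges G w R s ≤ n * n := by
  refine (Finset.sum_le_sum fun x _ => length_relaxed_le R s x).trans ?_
  simp

lemma arboricity_nonneg (G : SimpleGraph (Fin n)) : 0 ≤ arboricity G := by
  refine Real.iSup_nonneg fun U => div_nonneg (Nat.cast_nonneg _) ?_
  have : (2 : ℝ) ≤ U.1.card := by exact_mod_cast U.2
  linarith

lemma Variant.lam_nonneg (G : SimpleGraph (Fin n)) (var : Variant) : 0 ≤ var.lam G := by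
  cases var
  · exact arboricity_nonneg G
  · exact density_nonneg G

open Classical in
lemma sum_card_adj_le (U : Finset (Fin n)) :
    ∑ x ∈ U, (U.filter fun y => G.Adj x y).card ≤
      2 * {e ∈ G.edgeSet | ∀ x ∈ e, x ∈ U}.ncard := by
  rw [Set.ncard_eq_toFinset_card', ← Finset.card_sigma]
  refine Finset.card_le_mul_card_image_of_maps_to (f := fun a => s(a.1, a.2)) ?_ 2 ?_
  · rintro ⟨x, y⟩ h
    simp only [Finset.mem_sigma, Finset.mem_filter] at h
    simp only [Set.mem_toFinset, Set.mem_ofPred_eq, SimpleGraph.mem_edgeSet]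
    refine ⟨h.2.2, fun z hz => ?_⟩
    rcases Sym2.mem_iff.1 hz with rfl | rfl
    · exact h.1
    · exact h.2.1
  · intro e _
    induction e using Sym2.ind with
    | _ a b =>
      refine (Finset.card_le_card (t := {⟨a, b⟩, ⟨b, a⟩}) ?_).trans Finset.card_le_two
      rintro ⟨x, y⟩ h
      simp only [Finset.mem_filter, Sym2.eq_iff] at h
      simp only [Finset.mem_insert, Finset.mem_singleton, Sigma.mk.injEq, heq_eq_eq]
      exact h.2

lemma card_edges_le (U : Finset (Fin n)) (hU : 2 ≤ U.card) :
    ({e ∈ G.edgeSet | ∀ x ∈ e, x ∈ U}.ncard : ℝ) ≤ arboricity G * U.card := by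
  have h1 : (2 : ℝ) ≤ U.card := by exact_mod_cast hU
  have h2 : ({e ∈ G.edgeSet | ∀ x ∈ e, x ∈ U}.ncard : ℝ) / ((U.card : ℝ) - 1) ≤ arboricity G :=
    le_ciSup (f := fun U : {U : Finset (Fin n) // 2 ≤ U.card} =>
      ({e ∈ G.edgeSet | ∀ x ∈ e, x ∈ U.1}.ncard : ℝ) / ((U.1.card : ℝ) - 1))
      (Set.finite_range _).bddAbove ⟨U, hU⟩
  rw [div_le_iff₀ (by linarith)] at h2
  nlinarith [arboricity_nonneg G]

/-- The copies of a vertex pay for its degree, `λ` each. For density zero, division by zero gives no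
copies, and the graph has no edges. -/
lemma degree_le_density_mul (v : Fin n) : ((G.neighborSet v).ncard : ℝ) ≤
    density G * ⌈((G.neighborSet v).ncard : ℝ) / density G⌉₊ := by
  rcases (density_nonneg G).eq_or_lt with h0 | h0
  · have hn : (n : ℝ) ≠ 0 := by
      have := v.pos
      positivity
    have he : G.edgeSet.ncard = 0 := by
      have := h0.symm
      rw [density, div_eq_zero_iff] at this
      exact_mod_cast this.resolve_right hn
    have hsum := sum_degree_le G
    rw [he, mul_zero, Nat.le_zero, Finset.sum_eq_zero_iff] at hsum
    simp [hsum v (Finset.mem_univ _)]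
  · calc ((G.neighborSet v).ncard : ℝ) =
          density G * (((G.neighborSet v).ncard : ℝ) / density G) := by field_simp
      _ ≤ _ := by
        gcongr
        exact Nat.le_ceil _

/-- A relaxed edge has both ends in the ball. In the first variant the arboricity bounds the edges
inside it, each counted twice; in the second one each degree is at most `λ` times the number of
copies. -/
lemma ballEdges_le (R : ℝ≥0∞) (s : Fin n) (var : Variant) :
    (ballEdges G w R s : ℝ) ≤ 2 * var.lam G * (∑ x ∈ ball G w R s, var.copies G x : ℕ) := by
  classical
  have hle := Finset.sum_le_sum fun x (_ : x ∈ ball G w R s) =>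
    length_relaxed_le_card (G := G) (w := w) R s x
  rw [← ballEdges_eq] at hle
  cases var with
  | byArboricity =>
    simp only [Variant.copies, Variant.lam, Finset.sum_const, smul_eq_mul, mul_one]
    by_cases hU : 2 ≤ (ball G w R s).card
    · have h1 : (ballEdges G w R s : ℝ) ≤
          2 * ({e ∈ G.edgeSet | ∀ x ∈ e, x ∈ ball G w R s}.ncard : ℝ) := by
        exact_mod_cast hle.trans (sum_card_adj_le _)
      have h2 := card_edges_le (G := G) _ hU
      linarith
    · have h1 : ballEdges G w R s = 0 := by
        rw [← Nat.le_zero]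
        refine hle.trans (le_of_eq (Finset.sum_eq_zero fun x hx => ?_))
        rw [Finset.card_eq_zero, Finset.filter_eq_empty_iff]
        intro y hy hadj
        exact hU (Finset.one_lt_card.2 ⟨x, hx, y, hy, hadj.ne⟩)
      rw [h1, Nat.cast_zero]
      have := arboricity_nonneg G
      positivity
  | byDensity =>
    simp only [Variant.copies, Variant.lam]
    have h1 : ∀ x, (((ball G w R s).filter fun y => G.Adj x y).card : ℝ) ≤
        (G.neighborSet x).ncard := by
      intro x
      rw [← Set.ncard_coe_finset]
      refine Nat.cast_le.2 (Set.ncard_le_ncard (fun y hy => ?_) (Set.toFinite _))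
      simp only [Finset.coe_filter, Set.mem_ofPred_eq] at hy
      exact hy.2
    have h2 : (ballEdges G w R s : ℝ) ≤
        ∑ x ∈ ball G w R s, (((ball G w R s).filter fun y => G.Adj x y).card : ℝ) := by
      exact_mod_cast hle
    have h3 := density_nonneg G
    calc (ballEdges G w R s : ℝ)
        ≤ ∑ x ∈ ball G w R s,
            density G * (⌈((G.neighborSet x).ncard : ℝ) / density G⌉₊ : ℝ) :=
          h2.trans (Finset.sum_le_sum fun x _ => (h1 x).trans (degree_le_density_mul x))
      _ = density G * (∑ x ∈ ball G w R s,
            ⌈((G.neighborSet x).ncard : ℝ) / density G⌉₊ : ℕ) := by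
          rw [← Finset.mul_sum]
          push_cast
          rfl
      _ ≤ _ := by
          rw [mul_assoc, two_mul]
          exact le_add_of_nonneg_right (by positivity)

/-- The logarithm must be multiplied by `F`: when `λ = 0` the final bound has no term of order `log
n`, and then `F = 0` leaves just the constant 10. For `F ≥ 1` one uses `F + 2 ≤ n ^ 3`. -/
lemma searchCost_le {n F : ℕ} (hn : 2 ≤ n) (hF : F ≤ n * n) :
    (searchCost F : ℝ) ≤ 10 + 44 * F * Real.log n := by
  rcases Nat.eq_zero_or_pos F with rfl | hF0
  · have : searchCost 0 = 10 := by
      have : Nat.log 2 (0 + 2) = 1 := by norm_num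
      rw [searchCost, this]
    simp [this]
  have hn2 : (2 : ℝ) ≤ n := by exact_mod_cast hn
  have hF1 : (1 : ℝ) ≤ F := by exact_mod_cast hF0
  have hlog2 := Real.log_two_gt_d9
  have hlogn : Real.log 2 ≤ Real.log n := Real.log_le_log (by norm_num) hn2
  have hlog : (Nat.log 2 (F + 2) : ℝ) * Real.log 2 ≤ 3 * Real.log n := by
    have h1 : 2 ^ Nat.log 2 (F + 2) ≤ n ^ 3 := by
      refine (Nat.pow_log_le_self 2 (by omega)).trans ?_
      nlinarith [Nat.mul_le_mul hn hn, Nat.mul_le_mul_right (n * n) hn]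
    have h2 : ((2 : ℝ)) ^ Nat.log 2 (F + 2) ≤ (n : ℝ) ^ 3 := by exact_mod_cast h1
    have h3 := Real.log_le_log (by positivity) h2
    rw [Real.log_pow, Real.log_pow] at h3
    exact_mod_cast h3
  set l : ℝ := ((Nat.log 2 (F + 2) : ℕ) : ℝ) with hl
  have hl0 : 0 ≤ l := Nat.cast_nonneg _
  have key : 5 * l + 15 ≤ 44 * Real.log n := by nlinarith
  have : (searchCost F : ℝ) = 2 * l + 8 + F * (3 * l + 7) := by
    simp [searchCost, hl]
  rw [this]
  nlinarith

end BallEdges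

/-! ### Balls are small with high probability -/

section Whp

variable {n : ℕ} {G : SimpleGraph (Fin n)} {w : Sym2 (Fin n) → ℝ≥0} {h : ℕ} {var : Variant}

lemma coinLaw_no_landmark_le (hh : 1 ≤ h) (S : Finset (Fin n)) :
    (coinLaw G h var).real {ω | ∀ x ∈ S, x ∉ landmarks G h var ω 1} ≤
      Real.exp (-(rho n h 1 / n * (∑ x ∈ S, var.copies G x : ℕ))) := by
  classical
  let j : Fin h := ⟨0, hh⟩
  set T : Finset (Fin h × (Σ v : Fin n, Fin (var.copies G v))) :=
    (S.sigma fun _ => Finset.univ).image fun k => (j, k) with hT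
  have hcard : T.card = ∑ x ∈ S, var.copies G x := by
    rw [hT, Finset.card_image_of_injective _ fun a b hab => (Prod.ext_iff.1 hab).2,
      Finset.card_sigma]
    simp
  rw [← hcard]
  refine le_trans (measureReal_mono fun ω hω => ?_) (coinMeasure_forall_false_le
    (P := fun x : Fin h × (Σ v : Fin n, Fin (var.copies G v)) =>
      ⟨rho n h (x.1 + 1) / n, rho_div_mem n h (x.1 + 1)⟩) T ?_)
  · intro i hi
    obtain ⟨k, hk, rfl⟩ := Finset.mem_image.1 hi
    by_contra hne
    exact hω k.1 (Finset.mem_sigma.1 hk).1 (mem_landmarks j (by simpa using hne))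
  · intro i hi
    obtain ⟨k, hk, rfl⟩ := Finset.mem_image.1 hi
    rfl

/-- The possible values of the radius of `v`. -/
def radii (G : SimpleGraph (Fin n)) (w : Sym2 (Fin n) → ℝ≥0) (v : Fin n) :
    Option (Fin n) → ℝ≥0∞
  | none => ⊤
  | some l => gdist G w v l

lemma exists_radii_eq (L : Set (Fin n)) (v : Fin n) : ∃ o, radius G w L v = radii G w v o := by
  by_cases h : radius G w L v = ⊤
  · exact ⟨none, h⟩
  · obtain ⟨l, -, hl⟩ := exists_radius_eq h
    exact ⟨some l, hl.symm⟩

/-- The ball is random, but its radius is a distance or infinite, so it is one of at most `n(n+1)`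
fixed balls. Being open, it contains no landmark, and this is unlikely for a fixed ball with many
copies. -/
lemma coinLaw_small_balls (hh : 1 ≤ h) (hn : 2 ≤ n) {c : ℝ} (hc : 0 ≤ c) :
    (coinLaw G h var).real {ω | ¬ ∀ v : Fin n,
      ((∑ x ∈ ball G w (radius G w (landmarks G h var ω 1) v) v, var.copies G x : ℕ) : ℝ) ≤
        (c + 3) * (n : ℝ) ^ ((3 / 4 : ℝ) ^ h) * Real.log n} ≤ (n : ℝ) ^ (-c) := by
  classical
  have hn2 : (2 : ℝ) ≤ n := by exact_mod_cast hn
  have hn0 : (0 : ℝ) < n := by linarith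
  set s : ℝ := (c + 3) * (n : ℝ) ^ ((3 / 4 : ℝ) ^ h) * Real.log n with hs
  set I : Finset (Fin n × Option (Fin n)) := Finset.univ.filter fun i =>
    s < ((∑ x ∈ ball G w (radii G w i.1 i.2) i.1, var.copies G x : ℕ) : ℝ) with hI
  have hsub : {ω | ¬ ∀ v : Fin n,
      ((∑ x ∈ ball G w (radius G w (landmarks G h var ω 1) v) v, var.copies G x : ℕ) : ℝ) ≤ s} ⊆
      ⋃ i ∈ I, {ω | ∀ x ∈ ball G w (radii G w i.1 i.2) i.1, x ∉ landmarks G h var ω 1} := by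
    intro ω hω
    simp only [Set.mem_ofPred_eq, not_forall, not_le] at hω
    obtain ⟨v, hv⟩ := hω
    obtain ⟨o, ho⟩ := exists_radii_eq (G := G) (w := w) (landmarks G h var ω 1) v
    simp only [Set.mem_iUnion, Set.mem_ofPred_eq]
    rw [ho] at hv
    refine ⟨(v, o), Finset.mem_filter.2 ⟨Finset.mem_univ _, hv⟩, fun x hx hxl => ?_⟩
    rw [mem_ball, ← ho] at hx
    exact absurd (radius_le hxl) (not_le.2 hx)
  -- Level 1 has sampling probability `n^(-(3/4)^h)`, which cancels the power in `s`. Each large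
  -- ball is thus missed with probability at most `n^(-(c+3))`, and the `n^3` possible balls use up
  -- the 3.
  have hp : rho n h 1 / n * s = (c + 3) * Real.log n := by
    rw [rho_div_eq (by omega), Nat.add_sub_cancel, hs, Real.rpow_neg hn0.le]
    field_simp
  have hp0 : 0 ≤ rho n h 1 / n := (rho_div_mem n h 1).1
  have hcardI : (I.card : ℝ) ≤ (n : ℝ) ^ (3 : ℝ) := by
    have h1 : I.card ≤ n * (n + 1) := (Finset.card_le_univ _).trans (by simp)
    have h2 : n * (n + 1) ≤ n ^ 3 := by nlinarith [Nat.mul_le_mul hn hn]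
    have h3 : (n : ℝ) ^ (3 : ℝ) = ((n ^ 3 : ℕ) : ℝ) := by
      push_cast
      exact_mod_cast Real.rpow_natCast (n : ℝ) 3
    rw [h3]
    exact_mod_cast h1.trans h2
  calc (coinLaw G h var).real _
      ≤ (coinLaw G h var).real
        (⋃ i ∈ I, {ω | ∀ x ∈ ball G w (radii G w i.1 i.2) i.1, x ∉ landmarks G h var ω 1}) :=
        measureReal_mono hsub (measure_ne_top _ _)
    _ ≤ ∑ i ∈ I, (coinLaw G h var).real
        {ω | ∀ x ∈ ball G w (radii G w i.1 i.2) i.1, x ∉ landmarks G h var ω 1} :=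
        measureReal_biUnion_finset_le _ _
    _ ≤ ∑ i ∈ I, (n : ℝ) ^ (-(c + 3)) := by
        refine Finset.sum_le_sum fun i hi => (coinLaw_no_landmark_le hh _).trans ?_
        rw [Real.rpow_def_of_pos hn0]
        refine Real.exp_le_exp.2 ?_
        have h1 := mul_le_mul_of_nonneg_left (Finset.mem_filter.1 hi).2.le hp0
        rw [hp] at h1
        linarith
    _ = I.card * (n : ℝ) ^ (-(c + 3)) := by rw [Finset.sum_const, nsmul_eq_mul]
    _ ≤ (n : ℝ) ^ (3 : ℝ) * (n : ℝ) ^ (-(c + 3)) := by gcongr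
    _ = (n : ℝ) ^ (-c) := by
        rw [← Real.rpow_add hn0]
        congr 1
        ring

lemma log_four_thirds_ge : (1 / 4 : ℝ) ≤ Real.log (4 / 3) := by
  have := Real.one_sub_inv_le_log_of_pos (show (0 : ℝ) < 4 / 3 by norm_num)
  norm_num at this ⊢
  linarith

lemma le_four_mul_log {t : ℝ} (ht : t = (4 / 3 : ℝ) ^ h) : (h : ℝ) ≤ 4 * Real.log t := by
  rw [ht, Real.log_pow]
  nlinarith [log_four_thirds_ge, Nat.cast_nonneg (α := ℝ) h]

theorem fastQueries_whp (hh : 1 ≤ h) {t : ℝ} (ht : t = (4 / 3 : ℝ) ^ h) (hn : 1 ≤ n)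
    (hw : ∀ e ∈ G.edgeSet, 0 < w e) (c : ℝ) {B : ℝ} (hB : B = 176 * (max c 0 + 3) + 120) :
    1 - (n : ℝ) ^ (-c) ≤ (coinLaw G h var).real (FastQueries G w h var
      (B * ((n : ℝ) ^ (1 / t) * var.lam G * Real.log n ^ 2 + Real.log t)) B) := by
  -- For `n = 1` the claimed lower bound on the probability is 0.
  rcases hn.eq_or_lt with rfl | hn
  · simp
  have hn1 : (1 : ℝ) < n := by exact_mod_cast hn
  have hn0 : (0 : ℝ) < n := by linarith
  have hlog0 : 0 ≤ Real.log n := Real.log_nonneg hn1.le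
  set c' : ℝ := max c 0 with hc'
  have hc0 : 0 ≤ c' := le_max_right _ _
  set s : ℝ := (c' + 3) * (n : ℝ) ^ ((3 / 4 : ℝ) ^ h) * Real.log n with hs
  have ht1 : 1 / t = (3 / 4 : ℝ) ^ h := by
    rw [ht, one_div, ← inv_pow]
    norm_num
  have hlam := Variant.lam_nonneg G var
  have hlogt : (h : ℝ) ≤ 4 * Real.log t := le_four_mul_log ht
  have hh1 : (1 : ℝ) ≤ h := by exact_mod_cast hh
  set Bad : Set (Coins G h var) := {ω | ¬ ∀ v : Fin n,
      ((∑ x ∈ ball G w (radius G w (landmarks G h var ω 1) v) v, var.copies G x : ℕ) : ℝ) ≤ s}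
    with hBad
  have hbad : (coinLaw G h var).real Bad ≤ (n : ℝ) ^ (-c) := by
    refine (coinLaw_small_balls hh hn hc0).trans ?_
    exact Real.rpow_le_rpow_of_exponent_le hn1.le (neg_le_neg (le_max_left _ _))
  have hcompl := probReal_compl_eq_one_sub (μ := coinLaw G h var) (Set.toFinite Bad).measurableSet
  have hsub : Badᶜ ⊆ FastQueries G w h var
      (B * ((n : ℝ) ^ (1 / t) * var.lam G * Real.log n ^ 2 + Real.log t)) B := by
    intro ω hω u v hr
    simp only [hBad, Set.mem_compl_iff, Set.mem_ofPred_eq, not_not] at hω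
    obtain ⟨p, h1, -, h3⟩ := query_spec hw hh (landmarks G h var ω) hr
    refine ⟨p, h1, ?_⟩
    have hcost : ∀ v, (searchCost (ballEdges G w (radius G w (landmarks G h var ω 1) v) v) : ℝ) ≤
        10 + 88 * (c' + 3) * ((n : ℝ) ^ (1 / t) * var.lam G * Real.log n ^ 2) := by
      intro v
      refine (searchCost_le hn (ballEdges_le_sq _ _)).trans ?_
      have h4 := ballEdges_le (G := G) (w := w) (radius G w (landmarks G h var ω 1) v) v var
      have h5 := h4.trans (mul_le_mul_of_nonneg_left (hω v) (by positivity))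
      have h6 := mul_le_mul_of_nonneg_right h5 hlog0
      have h7 : 2 * var.lam G * s * Real.log n = 2 * (c' + 3) *
          ((n : ℝ) ^ (1 / t) * var.lam G * Real.log n ^ 2) := by
        rw [hs, ht1]
        ring
      rw [h7] at h6
      linarith
    have h4 : (((Lambda G w h var ω).query u v).steps : ℝ) ≤
        searchCost (ballEdges G w (radius G w (landmarks G h var ω 1) u) u) +
        searchCost (ballEdges G w (radius G w (landmarks G h var ω 1) v) v) + 8 * h + 2 +
          4 * p.length := by exact_mod_cast h3
    have h5 := hcost u
    have h6 := hcost v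
    have hX : 0 ≤ (n : ℝ) ^ (1 / t) * var.lam G * Real.log n ^ 2 := by positivity
    have hlen : (0 : ℝ) ≤ p.length := Nat.cast_nonneg _
    -- Two searches give `2 · 88 = 176` and an additive 20; with the remaining `8 h + 2` the
    -- constants are at most `30 h ≤ 120 log t`.
    rw [hB]
    nlinarith
  have := measureReal_mono (μ := coinLaw G h var) hsub
  rw [hcompl] at this
  linarith

theorem hasStretch (hh : 1 ≤ h) {t : ℝ} (ht : t = (4 / 3 : ℝ) ^ h)
    (hw : ∀ e ∈ G.edgeSet, 0 < w e) : HasStretch G w h var (t ^ Real.logb (4 / 3) 7) := by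
  have h7 : t ^ Real.logb (4 / 3) 7 = 7 ^ h := by
    rw [ht, ← Real.rpow_natCast, ← Real.rpow_mul (by norm_num), mul_comm,
      Real.rpow_mul (by norm_num), Real.rpow_logb (by norm_num) (by norm_num) (by norm_num),
      Real.rpow_natCast]
  intro ω u v hr
  obtain ⟨p, h1, h2, -⟩ := query_spec hw hh (landmarks G h var ω) hr
  refine ⟨p, h1, gdist_le_wlen p, h2.trans (le_of_eq ?_)⟩
  rw [h7, ENNReal.ofReal_pow (by norm_num)]
  norm_num

lemma fastQueries_mono {T T' a a' : ℝ} (hT : T ≤ T') (ha : a ≤ a') :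
    FastQueries G w h var T a ⊆ FastQueries G w h var T' a' := by
  intro ω hω u v hr
  obtain ⟨p, h1, h2⟩ := hω u v hr
  refine ⟨p, h1, h2.trans ?_⟩
  gcongr

end Whp

end

end PathOracle

theorem corollary2 :
    (∀ h : ℕ, 1 ≤ h → ∀ t : ℝ, t = (4 / 3 : ℝ) ^ h →
      ∃ (A : ℝ) (κ : ℕ), ∀ c : ℝ, ∃ B : ℝ,
        ∀ (n : ℕ), 1 ≤ n → ∀ (G : SimpleGraph (Fin n)) (w : Sym2 (Fin n) → ℝ≥0),
          (∀ e ∈ G.edgeSet, 0 < w e) → ∀ var : Variant,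
            expectedSpace G w h var ≤ A * n ∧
            HasStretch G w h var (t ^ Real.logb (4 / 3) 7) ∧
            1 - (n : ℝ) ^ (-c) ≤ (coinLaw G h var).real
              (FastQueries G w h var
                (B * ((n : ℝ) ^ (1 / t) * var.lam G * Real.log n ^ κ + 1)) B)) ∧
    (∃ (A : ℝ) (κ : ℕ), ∀ c : ℝ, ∃ B : ℝ,
      ∀ h : ℕ, 1 ≤ h → ∀ t : ℝ, t = (4 / 3 : ℝ) ^ h →
        ∀ (n : ℕ), 1 ≤ n → ∀ (G : SimpleGraph (Fin n)) (w : Sym2 (Fin n) → ℝ≥0),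
          (∀ e ∈ G.edgeSet, 0 < w e) → ∀ var : Variant,
            expectedSpace G w h var ≤ A * (n * Real.log t) ∧
            HasStretch G w h var (t ^ Real.logb (4 / 3) 7) ∧
            1 - (n : ℝ) ^ (-c) ≤ (coinLaw G h var).real
              (FastQueries G w h var
                (B * ((n : ℝ) ^ (1 / t) * var.lam G * Real.log n ^ κ + Real.log t)) B)) := by
  constructor
  · intro h hh t ht
    -- For fixed `h` both the number of levels and `log t` are absorbed into the constants.
    refine ⟨3 * 10 ^ 8 * h, 2, fun c => ⟨(176 * (max c 0 + 3) + 120) * (1 + Real.log t),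
      fun n hn G w hw var => ⟨?_, hasStretch hh ht hw, ?_⟩⟩⟩
    · exact (expectedSpace_le hn).trans (le_of_eq (by ring))
    · refine (fastQueries_whp hh ht hn hw c rfl).trans (measureReal_mono (fastQueries_mono ?_ ?_))
      all_goals
        have hB : 0 ≤ 176 * (max c 0 + 3) + 120 := by positivity
        have hlogt : 0 ≤ Real.log t := by
          have := le_four_mul_log ht
          have := Nat.cast_nonneg (α := ℝ) h
          linarith
      · have hX : 0 ≤ (n : ℝ) ^ (1 / t) * var.lam G * Real.log n ^ 2 := by
          have := Variant.lam_nonneg G var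
          positivity
        rw [mul_assoc (176 * (max c 0 + 3) + 120 : ℝ)]
        refine mul_le_mul_of_nonneg_left ?_ hB
        nlinarith [mul_nonneg hlogt hX]
      · exact le_mul_of_one_le_right hB (by linarith)
  -- The number of levels is at most `4 log t`, because `log (4/3) ≥ 1/4`.
  · refine ⟨12 * 10 ^ 8, 2, fun c => ⟨_, fun h hh t ht n hn G w hw var =>
      ⟨?_, hasStretch hh ht hw, fastQueries_whp hh ht hn hw c rfl⟩⟩⟩
    refine (expectedSpace_le hn).trans ?_
    have := mul_le_mul_of_nonneg_left (le_four_mul_log ht) (Nat.cast_nonneg (α := ℝ) n)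
    nlinarith
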